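/- Let $\mathsf{PA}$ be first-order Peano arithmetic. Identify binary strings with natural numbers (in length-lexicographic order), so that formulas of arithmetic may speak about strings, and write $|x|$ for the length of a string $x$. An interpreter is a partial computable function on strings, given by a $\Sigma_1$-formula $D(p,x)$ ("program $p$ outputs $x$") that is provably functional in $\mathsf{PA}$: $\mathsf{PA}\vdash\forall p,x,x'\,[D(p,x)\wedge D(p,x')\Rightarrow x=x']$. Let $C_D(x)=\min\{|p| : D(p)=x\}$. Fix an interpreter $D$ that is provably optimal, i.e., for every interpreter $D'$ there is a constant $c$ with $\mathsf{PA}\vdash\forall x\,[C_D(x)\le C_{D'}(x)+c]$, and let $C=C_D$, represented in arithmetic by means of $D$. A $\Pi_1$-formula $U(x)$ is universal if for every closed $\Pi_1$-statement $T$ there is a string $t$ with $\mathsf{PA}\vdash[T\Leftrightarrow U(t)]$; the minimal length of such a $t$ is the $U$-complexity of $T$. Fix a universal $U$ that is optimal, i.e., for every universal $V$ there is a constant $c$ such that the $U$-complexity of every closed $\Pi_1$-statement exceeds its $V$-complexity by at most $c$. The complexity of a closed $\Pi_1$-statement is its $U$-complexity. "True" means true in the standard model. For every $n$ let $r_n$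 be the lexicographically first string of length $n$ with $C(r_n)\ge n$, and consider the following theories, each obtained from $\mathsf{PA}$ by adding axioms: - $A_n$: the single axiom $C(r_n)\ge n$; - $B_n$: for every string $x$ with $C(x)\le n$ an axiom specifying the value of $C(x)$, and one axiom saying that all strings other than these have complexity greater than $n$; - $C_n$: all true closed $\Pi_1$-statements of complexity at most $n$. Then the sequences $(A_n)$, $(B_n)$, $(C_n)$ are pairwise $O(1)$-equivalent, where $(T_n)$ and $(S_n)$ are called $O(1)$-equivalent if for some constant $c$ and all $n$ every theorem of $T_n$ is a theorem of $S_{n+c}$ and every theorem of $S_n$ is a theorem of $T_{n+c}$. In particular, for every infinite set $I$ of natural numbers, $\mathsf{PA}$ with the axioms $C(r_n)\ge n$ for all $n\in I$ has exactly the same theorems as $\mathsf{PA}$ with all true closed $\Pi_1$-statements as axioms. -/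

import Mathlib

open FirstOrder FirstOrder.Language

namespace KolmPA

/-! ### Provability in first-order logic

A natural deduction calculus for classical first-order logic with equality.  Formulas have their
free variables in `ℕ`; the primitive connectives are `⊥`, `⟹`, `=`, relation symbols and `∀'`. -/

section Calculus

variable {L : FirstOrder.Language.{0, 0}}

/-- The formula `φ(t)`, where `φ` has one distinguished (outermost bound) variable. -/
def inst {α : Type} (φ : L.BoundedFormula α 1) (t : L.Term α) : L.Formula α :=
  φ.toFormula.subst (Sum.elim Term.var (fun _ => t))

/-- `Derives Γ φ`: the formula `φ` is derivable from the set of formulas `Γ`. -/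
inductive Derives : Set (L.Formula ℕ) → L.Formula ℕ → Prop
  | ax {Γ : Set (L.Formula ℕ)} {φ : L.Formula ℕ} : φ ∈ Γ → Derives Γ φ
  | weaken {Γ Δ : Set (L.Formula ℕ)} {φ : L.Formula ℕ} : Γ ⊆ Δ → Derives Γ φ → Derives Δ φ
  | impI {Γ : Set (L.Formula ℕ)} {φ ψ : L.Formula ℕ} :
      Derives (insert φ Γ) ψ → Derives Γ (φ ⟹ ψ)
  | impE {Γ : Set (L.Formula ℕ)} {φ ψ : L.Formula ℕ} :
      Derives Γ (φ ⟹ ψ) → Derives Γ φ → Derives Γ ψ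
  | raa {Γ : Set (L.Formula ℕ)} {φ : L.Formula ℕ} :
      Derives (insert (φ ⟹ ⊥) Γ) ⊥ → Derives Γ φ
  | allI {Γ : Set (L.Formula ℕ)} {φ : L.BoundedFormula ℕ 1} (x : ℕ) :
      (∀ ψ ∈ Γ, x ∉ BoundedFormula.freeVarFinset ψ) → x ∉ φ.freeVarFinset →
      Derives Γ (inst φ (Term.var x)) → Derives Γ (∀' φ)
  | allE {Γ : Set (L.Formula ℕ)} {φ : L.BoundedFormula ℕ 1} (t : L.Term ℕ) :
      Derives Γ (∀' φ) → Derives Γ (inst φ t)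
  | eqI {Γ : Set (L.Formula ℕ)} (t : L.Term ℕ) : Derives Γ (Term.equal t t)
  | eqE {Γ : Set (L.Formula ℕ)} {φ : L.BoundedFormula ℕ 1} {s t : L.Term ℕ} :
      Derives Γ (Term.equal s t) → Derives Γ (inst φ s) → Derives Γ (inst φ t)

/-- A sentence viewed as a formula over the variables `ℕ` (none of which occurs free in it). -/
def toOpen (φ : L.Sentence) : L.Formula ℕ := Formula.relabel Empty.elim φ

/-- `Proves T φ`: the sentence `φ` is a theorem of the theory with set of axioms `T`. -/
def Proves (T : L.Theory) (φ : L.Sentence) : Prop := Derives (toOpen '' T) (toOpen φ)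

/-- `TheoryLE T S`: every theorem of `T` is a theorem of `S`. -/
def TheoryLE (T S : L.Theory) : Prop := ∀ φ : L.Sentence, Proves T φ → Proves S φ

/-- `O(1)`-equivalence of two sequences of theories. -/
def O1Equiv (T S : ℕ → L.Theory) : Prop :=
  ∃ c : ℕ, ∀ n : ℕ, TheoryLE (T n) (S (n + c)) ∧ TheoryLE (S n) (T (n + c))

/-- The universal closure of a formula with free variables `0, …, k - 1`. -/
def close {k : ℕ} (φ : L.Formula (Fin k)) : L.Sentence :=
  (BoundedFormula.relabel (Sum.inr : Fin k → Empty ⊕ Fin k) φ).alls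

/-- Universal quantification over the one distinguished free variable. -/
def allLast {α : Type} (φ : L.Formula (α ⊕ Fin 1)) : L.Formula α :=
  BoundedFormula.all (BoundedFormula.relabel (id : α ⊕ Fin 1 → α ⊕ Fin 1) φ)

/-- Substitution of terms that may contain the variables of enclosing quantifiers. -/
def app {k n : ℕ} {α : Type} (φ : L.Formula (Fin k)) (ts : Fin k → L.Term (α ⊕ Fin n)) :
    L.BoundedFormula α n :=
  BoundedFormula.relabel (id : α ⊕ Fin n → α ⊕ Fin n)
    (BoundedFormula.subst φ ts : L.Formula (α ⊕ Fin n))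

end Calculus

/-! ### Peano arithmetic -/

/-- The function symbols `0, S, +, ·`. -/
inductive ArithFunc : ℕ → Type
  | zero : ArithFunc 0
  | succ : ArithFunc 1
  | add : ArithFunc 2
  | mul : ArithFunc 2

/-- The relation symbol `<`. -/
inductive ArithRel : ℕ → Type
  | lt : ArithRel 2

/-- The language of arithmetic. -/
def arith : FirstOrder.Language.{0, 0} := ⟨ArithFunc, ArithRel⟩

section Terms

variable {α : Type}

def zeroT : arith.Term α := Constants.term (L := arith) ArithFunc.zero

def succT (t : arith.Term α) : arith.Term α := Functions.apply₁ (L := arith) ArithFunc.succ t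

def addT (s t : arith.Term α) : arith.Term α := Functions.apply₂ (L := arith) ArithFunc.add s t

def mulT (s t : arith.Term α) : arith.Term α := Functions.apply₂ (L := arith) ArithFunc.mul s t

/-- The numeral `S … S 0`. -/
def numeral : ℕ → arith.Term α
  | 0 => zeroT
  | k + 1 => succT (numeral k)

/-- The atomic formula `s < t`. -/
def ltF {n : ℕ} (s t : arith.Term (α ⊕ Fin n)) : arith.BoundedFormula α n :=
  Relations.boundedFormula₂ (L := arith) ArithRel.lt s t

end Terms

/-- The standard model. -/
instance standardModel : arith.Structure ℕ where
  funMap {_} f v :=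
    match f with
    | ArithFunc.zero => 0
    | ArithFunc.succ => v 0 + 1
    | ArithFunc.add => v 0 + v 1
    | ArithFunc.mul => v 0 * v 1
  RelMap {_} r v :=
    match r with
    | ArithRel.lt => v 0 < v 1

/-- The induction axiom for a formula with parameters `0, …, k - 1` and one distinguished
variable `x`: `φ(0) → ∀ x (φ(x) → φ(S x)) → ∀ x φ(x)`, universally closed. -/
def inductionAxiom {k : ℕ} (φ : arith.Formula (Fin k ⊕ Fin 1)) : arith.Sentence :=
  close
    ((BoundedFormula.subst φ (Sum.elim Term.var (fun _ => zeroT)) : arith.Formula (Fin k)) ⟹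
      (allLast (φ ⟹ BoundedFormula.subst φ
          (Sum.elim (fun i => Term.var (Sum.inl i)) (fun _ => succT (Term.var (Sum.inr 0)))))) ⟹
        allLast φ)

/-- The axioms of Peano arithmetic. -/
inductive IsPAAxiom : arith.Sentence → Prop
  | succ_ne_zero : IsPAAxiom (∀' ∼(succT (&0) =' zeroT))
  | succ_inj : IsPAAxiom (∀' ∀' ((succT (&0) =' succT (&1)) ⟹ (&0 =' &1)))
  | add_zero : IsPAAxiom (∀' (addT (&0) zeroT =' &0))
  | add_succ : IsPAAxiom (∀' ∀' (addT (&0) (succT (&1)) =' succT (addT (&0) (&1))))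
  | mul_zero : IsPAAxiom (∀' (mulT (&0) zeroT =' zeroT))
  | mul_succ : IsPAAxiom (∀' ∀' (mulT (&0) (succT (&1)) =' addT (mulT (&0) (&1)) (&0)))
  | lt_iff : IsPAAxiom (∀' ∀' (ltF (&0) (&1) ⇔ ∃' (addT (&0) (succT (&2)) =' &1)))
  | induction {k : ℕ} (φ : arith.Formula (Fin k ⊕ Fin 1)) : IsPAAxiom (inductionAxiom φ)

/-- Peano arithmetic. -/
def PA : arith.Theory := {φ | IsPAAxiom φ}

/-! ### The arithmetical hierarchy at the bottom -/

/-- A term viewed under one more quantifier (it does not contain the new variable). -/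
def liftT {α : Type} {n : ℕ} (t : arith.Term (α ⊕ Fin n)) : arith.Term (α ⊕ Fin (n + 1)) :=
  t.relabel (Sum.map id Fin.castSucc)

/-- Bounded formulas: all quantifiers are of the form `∀ x < t` or `∃ x < t`. -/
inductive IsDelta0 {α : Type} : {n : ℕ} → arith.BoundedFormula α n → Prop
  | falsum {n : ℕ} : IsDelta0 (BoundedFormula.falsum : arith.BoundedFormula α n)
  | equal {n : ℕ} (s t : arith.Term (α ⊕ Fin n)) : IsDelta0 (BoundedFormula.equal s t)
  | rel {n l : ℕ} (R : arith.Relations l) (ts : Fin l → arith.Term (α ⊕ Fin n)) :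
      IsDelta0 (BoundedFormula.rel R ts)
  | imp {n : ℕ} {φ ψ : arith.BoundedFormula α n} : IsDelta0 φ → IsDelta0 ψ → IsDelta0 (φ ⟹ ψ)
  | ball {n : ℕ} (t : arith.Term (α ⊕ Fin n)) {φ : arith.BoundedFormula α (n + 1)} :
      IsDelta0 φ → IsDelta0 (∀' (ltF (Term.var (Sum.inr (Fin.last n))) (liftT t) ⟹ φ))
  | bex {n : ℕ} (t : arith.Term (α ⊕ Fin n)) {φ : arith.BoundedFormula α (n + 1)} :
      IsDelta0 φ → IsDelta0 (∃' (ltF (Term.var (Sum.inr (Fin.last n))) (liftT t) ⊓ φ))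

/-- `Π₁`-formulas: a bounded formula preceded by universal quantifiers. -/
inductive IsPi1 {α : Type} : {n : ℕ} → arith.BoundedFormula α n → Prop
  | of_delta0 {n : ℕ} {φ : arith.BoundedFormula α n} : IsDelta0 φ → IsPi1 φ
  | all {n : ℕ} {φ : arith.BoundedFormula α (n + 1)} : IsPi1 φ → IsPi1 (∀' φ)

/-- `Σ₁`-formulas: a bounded formula preceded by existential quantifiers. -/
inductive IsSigma1 {α : Type} : {n : ℕ} → arith.BoundedFormula α n → Prop
  | of_delta0 {n : ℕ} {φ : arith.BoundedFormula α n} : IsDelta0 φ → IsSigma1 φ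
  | ex {n : ℕ} {φ : arith.BoundedFormula α (n + 1)} : IsSigma1 φ → IsSigma1 (∃' φ)

/-! ### Binary strings in arithmetic

The string `b₁ … bₖ` is identified with the natural number `N` such that `N + 1` is written
`1 b₁ … bₖ` in binary.  Strings of length `k` correspond to the numbers `N` with
`2 ^ k ≤ N + 1 < 2 ^ (k + 1)`, in lexicographic order. -/

/-- The natural number that represents a binary string. -/
def code (s : List Bool) : ℕ := s.foldl (fun a b => 2 * a + b.toNat) 1 - 1

/-- The numeral of a binary string. -/
def strT {α : Type} (s : List Bool) : arith.Term α := numeral (code s)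

/-- "`x` is a power of two": every divisor of `x` is `1` or even. -/
def powTwo : arith.Formula (Fin 1) :=
  ∀' ((∃' (mulT (&0) (&1) =' Term.var (Sum.inl 0))) ⟹
    ((&0 =' numeral 1) ⊔ ∃' (&0 =' addT (&1) (&1))))

/-- "`|p| ≤ |q| + c`" for strings `p = x₀`, `q = x₁`: every power of two `u` with `q + 1 < u`
(the least such `u` is `2 ^ (|q| + 1)`) satisfies `p + 1 < 2 ^ c * u`. -/
def lenLe (c : ℕ) : arith.Formula (Fin 2) :=
  ∀' (app powTwo ![&0] ⟹ ltF (succT (Term.var (Sum.inl 1))) (&0) ⟹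
    ltF (succT (Term.var (Sum.inl 0))) (mulT (numeral (2 ^ c)) (&0)))

/-! ### Kolmogorov complexity

An interpreter is given by a formula `D(p, x)` ("the program `p` outputs `x`"), with `p = x₀` and
`x = x₁`. -/

/-- `D` is an interpreter, i.e. a partial computable function given by an algorithm: a
`Σ₁`-formula, provably in `PA` the graph of a partial function. -/
def IsInterpreter (D : arith.Formula (Fin 2)) : Prop :=
  IsSigma1 D ∧
  Proves PA (∀' ∀' ∀' (app D ![&0, &1] ⟹ app D ![&0, &2] ⟹ (&1 =' &2)))

/-- The sentence "`C_D(x) ≤ C_D'(x) + c` for all `x`": whenever a program `q` outputs `x` for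
`D'`, some program `p` with `|p| ≤ |q| + c` outputs `x` for `D`. -/
def domination (D D' : arith.Formula (Fin 2)) (c : ℕ) : arith.Sentence :=
  ∀' ∀' (app D' ![&1, &0] ⟹ ∃' (app (lenLe c) ![&2, &1] ⊓ app D ![&2, &0]))

/-- `D` is a provably optimal interpreter. -/
def IsProvablyOptimal (D : arith.Formula (Fin 2)) : Prop :=
  IsInterpreter D ∧
  ∀ D' : arith.Formula (Fin 2), IsInterpreter D' → ∃ c : ℕ, Proves PA (domination D D' c)

/-- The complexity `C_D(x)`: the minimal length of a program that outputs `x` (`⊤` if none). -/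
noncomputable def complexity (D : arith.Formula (Fin 2)) (x : List Bool) : ℕ∞ :=
  ⨅ (p : List Bool) (_ : D.Realize ![code p, code x]), (p.length : ℕ∞)

/-- The formula "`C_D(x) ≥ n`" in one free variable `x`: no program of length less than `n` (that
is, no `p < 2 ^ n - 1`) outputs `x`. -/
def geF (D : arith.Formula (Fin 2)) (n : ℕ) : arith.Formula (Fin 1) :=
  ∀' (ltF (&0) (numeral (2 ^ n - 1)) ⟹ ∼(app D ![&0, Term.var (Sum.inl 0)]))

/-- The formula "`C_D(x) = n`" in one free variable `x`: some program of length at most `n`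
outputs `x`, and `C_D(x) ≥ n`. -/
def eqF (D : arith.Formula (Fin 2)) (n : ℕ) : arith.Formula (Fin 1) :=
  (∃' (ltF (&0) (numeral (2 ^ (n + 1) - 1)) ⊓ app D ![&0, Term.var (Sum.inl 0)])) ⊓ geF D n

/-- The sentence `φ(s)` for a string `s`. -/
def atStr (φ : arith.Formula (Fin 1)) (s : List Bool) : arith.Sentence :=
  BoundedFormula.subst φ (fun _ => strT s)

/-- The formula "`x` is none of the strings in the list". -/
def notIn : List (List Bool) → arith.Formula (Fin 1)
  | [] => ⊤
  | s :: l => ∼(Term.equal (Term.var 0) (strT s)) ⊓ notIn l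

/-- The sentence "all strings outside the list have complexity greater than `n`". -/
def othersGt (D : arith.Formula (Fin 2)) (l : List (List Bool)) (n : ℕ) : arith.Sentence :=
  close (notIn l ⟹ geF D (n + 1))

/-- `r` is the lexicographically first string of length `n` with complexity at least `n`. -/
def IsFirstRandom (D : arith.Formula (Fin 2)) (n : ℕ) (r : List Bool) : Prop :=
  (r.length = n ∧ (n : ℕ∞) ≤ complexity D r) ∧
  ∀ s : List Bool, s.length = n ∧ (n : ℕ∞) ≤ complexity D s → r ≤ s

/-- The axioms `C(r_n) ≥ n` for `n ∈ I`. -/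
def randomAxioms (D : arith.Formula (Fin 2)) (I : Set ℕ) : arith.Theory :=
  {φ | ∃ n ∈ I, ∃ r : List Bool, IsFirstRandom D n r ∧ φ = atStr (geF D n) r}

/-- `A_n`: `PA` with the axiom `C(r_n) ≥ n`. -/
def theoryA (D : arith.Formula (Fin 2)) (n : ℕ) : arith.Theory := PA ∪ randomAxioms D {n}

/-- `B_n`: `PA` with an axiom `C(x) = k` for every string `x` of complexity `k ≤ n`, and the axiom
that all other strings have complexity greater than `n`. -/
def theoryB (D : arith.Formula (Fin 2)) (n : ℕ) : arith.Theory :=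
  PA ∪
  {φ | ∃ (x : List Bool) (k : ℕ), k ≤ n ∧ complexity D x = (k : ℕ∞) ∧ φ = atStr (eqF D k) x} ∪
  {φ | ∃ l : List (List Bool), l.Nodup ∧ (∀ x, x ∈ l ↔ complexity D x ≤ (n : ℕ∞)) ∧
    φ = othersGt D l n}

/-! ### Complexity of `Π₁`-statements -/

/-- A `Π₁`-formula `U(x)` is universal if every closed `Π₁`-statement is provably equivalent to
`U(t)` for some string `t`. -/
def IsUniversalPi1 (U : arith.Formula (Fin 1)) : Prop :=
  IsPi1 U ∧ ∀ T : arith.Sentence, IsPi1 T → ∃ t : List Bool, Proves PA (T ⇔ atStr U t)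

/-- The `U`-complexity of a closed `Π₁`-statement `T`. -/
noncomputable def pi1Complexity (U : arith.Formula (Fin 1)) (T : arith.Sentence) : ℕ∞ :=
  ⨅ (t : List Bool) (_ : Proves PA (T ⇔ atStr U t)), (t.length : ℕ∞)

/-- `U` is an optimal universal `Π₁`-formula. -/
def IsOptimalPi1 (U : arith.Formula (Fin 1)) : Prop :=
  IsUniversalPi1 U ∧
  ∀ V : arith.Formula (Fin 1), IsUniversalPi1 V →
    ∃ c : ℕ, ∀ T : arith.Sentence, IsPi1 T → pi1Complexity U T ≤ pi1Complexity V T + (c : ℕ∞)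

/-- All true closed `Π₁`-statements. -/
def truePi1 : arith.Theory := {φ | IsPi1 φ ∧ ℕ ⊨ φ}

/-- `C_n`: `PA` with all true `Π₁`-statements of complexity at most `n`. -/
def theoryC (U : arith.Formula (Fin 1)) (n : ℕ) : arith.Theory :=
  PA ∪ {φ | φ ∈ truePi1 ∧ pi1Complexity U φ ≤ (n : ℕ∞)}

end KolmPA

/-! Soundness and completeness (`Proves.sound`, `Proves.complete`) turn the comparison of theories
over PA into a comparison of models: `TheoryLE T S` holds as soon as every model of `S` is a model
of `T` (`theoryLE_of_models`). In a model `M` of PA the standard numbers form an initial segment, so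
bounded formulas keep their true values at standard arguments and true `Σ₁`-facts persist in `M`.
The equivalences come from a cycle `A_n ≤ B_n ≤ C_{n+O(1)}` and `C_n ≤ A_{n+O(1)}`.

`A_n ≤ B_n` (`theoryA_le_theoryB`): the complexity of `r_n` is either `n`, which is an axiom of
`B_n`, or greater, and then `r_n` is one of the "other" strings.

`B_n ≤ C_{n+O(1)}` (`theoryB_le_theoryC`): let `p` be the program of length at most `n` that halts
last, or a marker if none halts. "No program of length at most `n` halts later than `p`" is a true
`Π₁`-statement described by `n + O(1)` bits, so it has complexity `n + O(1)` because `U` is optimal.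
If it holds in `M`, every program of length at most `n` that halts in `M` does so by the standard
stage at which `p` halts, hence it halts in reality, with the same output. This settles all axioms
of `B_n`.

`C_n ≤ A_{n+O(1)}` (`theoryC_le_theoryA`): let `U(t)` with `|t| ≤ n` be true but false in `M`. It
can be refuted in `M` only at nonstandard stages, and by such a stage every program that really
halts has produced its output. If `M` also satisfies `C(r_m) ≥ m`, then at this stage `r_m` is the
first string of length `m` that no program shorter than `m` has output. A machine that waits for a
refutation of `U(t)` and prints the first missing string of length `m` therefore prints `r_m` in
`M`. Its input encodes `t` and `m = 2k + j`, with `j = n + 1`, in at most `k + j + 1` bits. By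
provable optimality `r_m` then has in `M` a program of length at most `k + j + 1 + c`, which is less
than `m` for `k = c + 2`: a contradiction.

For an infinite set of indices, each true `Π₁`-statement has finite complexity, so some `A_k` with
`k` in the set proves it. -/

namespace KolmPA

/-! ### Simultaneous substitution -/

section Substitution

variable {L : FirstOrder.Language.{0, 0}} {α β γ : Type}

theorem Term.subst_subst' (t : L.Term α) (σ : α → L.Term β) (τ : β → L.Term γ) :
    (t.subst σ).subst τ = t.subst (fun a => (σ a).subst τ) := by
  induction t with
  | var => rfl
  | func f ts ih => simp only [Term.subst, ih]

theorem Term.relabel_eq_subst (t : L.Term α) (g : α → β) :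
    t.relabel g = t.subst (fun a => Term.var (g a)) := by
  induction t with
  | var => rfl
  | func f ts ih => simp only [Term.subst, Term.relabel, ih]

theorem Term.subst_var' (t : L.Term α) : t.subst Term.var = t := by
  induction t with
  | var => rfl
  | func f ts ih => simp only [Term.subst, ih]

/-- A term viewed under one more quantifier. -/
def up {n : ℕ} (t : L.Term (α ⊕ Fin n)) : L.Term (α ⊕ Fin (n + 1)) :=
  t.relabel (Sum.map id Fin.castSucc)

/-- A substitution extended to one more bound variable. -/
def liftSubst {n m : ℕ} (σ : α ⊕ Fin n → L.Term (β ⊕ Fin m)) :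
    α ⊕ Fin (n + 1) → L.Term (β ⊕ Fin (m + 1)) :=
  Sum.elim (fun a => up (σ (Sum.inl a)))
    (Fin.snoc (α := fun _ => L.Term (β ⊕ Fin (m + 1))) (fun i => up (σ (Sum.inr i)))
      (Term.var (Sum.inr (Fin.last m))))

@[simp] theorem liftSubst_inl {n m : ℕ} (σ : α ⊕ Fin n → L.Term (β ⊕ Fin m)) (a : α) :
    liftSubst σ (Sum.inl a) = up (σ (Sum.inl a)) := rfl

@[simp] theorem liftSubst_castSucc {n m : ℕ} (σ : α ⊕ Fin n → L.Term (β ⊕ Fin m)) (i : Fin n) :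
    liftSubst σ (Sum.inr i.castSucc) = up (σ (Sum.inr i)) := by
  simp [liftSubst]

@[simp] theorem liftSubst_last {n m : ℕ} (σ : α ⊕ Fin n → L.Term (β ⊕ Fin m)) :
    liftSubst σ (Sum.inr (Fin.last n)) = Term.var (Sum.inr (Fin.last m)) := by
  simp [liftSubst]

theorem up_subst {n m : ℕ} (σ : α ⊕ Fin n → L.Term (β ⊕ Fin m)) (t : L.Term (α ⊕ Fin n)) :
    (up t).subst (liftSubst σ) = up (t.subst σ) := by
  unfold up
  rw [Term.relabel_eq_subst, Term.relabel_eq_subst, Term.subst_subst', Term.subst_subst']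
  congr 1
  funext x
  rcases x with a | i
  · simp [Term.subst, up, Term.relabel_eq_subst]
  · simp [Term.subst, up, Term.relabel_eq_subst]

/-- Simultaneous substitution for the free and the dangling bound variables. -/
def bs : ∀ {n m : ℕ}, (α ⊕ Fin n → L.Term (β ⊕ Fin m)) → L.BoundedFormula α n →
    L.BoundedFormula β m
  | _, _, _, .falsum => .falsum
  | _, _, σ, .equal s t => .equal (s.subst σ) (t.subst σ)
  | _, _, σ, .rel R ts => .rel R (fun i => (ts i).subst σ)
  | _, _, σ, .imp φ ψ => .imp (bs σ φ) (bs σ ψ)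
  | _, _, σ, .all φ => .all (bs (liftSubst σ) φ)

theorem liftSubst_comp {n m k : ℕ} (σ : α ⊕ Fin n → L.Term (β ⊕ Fin m))
    (τ : β ⊕ Fin m → L.Term (γ ⊕ Fin k)) :
    (fun x => (liftSubst σ x).subst (liftSubst τ)) = liftSubst (fun x => (σ x).subst τ) := by
  funext x
  rcases x with a | i
  · simp [up_subst]
  · refine Fin.lastCases ?_ (fun i => ?_) i
    · simp [Term.subst]
    · simp [up_subst]

theorem bs_bs {n : ℕ} (φ : L.BoundedFormula α n) : ∀ {m k : ℕ}
    (σ : α ⊕ Fin n → L.Term (β ⊕ Fin m)) (τ : β ⊕ Fin m → L.Term (γ ⊕ Fin k)),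
    bs τ (bs σ φ) = bs (fun x => (σ x).subst τ) φ := by
  induction φ with
  | falsum => intros; rfl
  | equal s t => intros; simp only [bs, Term.subst_subst']
  | rel R ts => intros; simp only [bs, Term.subst_subst']
  | imp φ ψ h1 h2 => intros; simp only [bs, h1, h2]
  | all φ h => intros; simp only [bs, h, liftSubst_comp]

theorem liftSubst_var {n : ℕ} :
    liftSubst (Term.var : α ⊕ Fin n → L.Term (α ⊕ Fin n)) = Term.var := by
  funext x
  rcases x with a | i
  · simp [up, Term.relabel]
  · refine Fin.lastCases ?_ (fun i => ?_) i
    · simp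
    · simp [up, Term.relabel]

theorem bs_var {n : ℕ} (φ : L.BoundedFormula α n) : bs Term.var φ = φ := by
  induction φ with
  | falsum => rfl
  | equal s t => simp only [bs, Term.subst_var']
  | rel R ts => simp only [bs, Term.subst_var']
  | imp φ ψ h1 h2 => simp only [bs, h1, h2]
  | all φ h => simp only [bs, liftSubst_var, h]

/-- Relabelling, substitution of terms and passage to an open formula are all instances of `bs`.
Nested substitutions in `inst`, `toOpen` and `app` therefore collapse by `bs_bs` alone. -/
theorem relabel_eq_bs {n k : ℕ} (g : α → β ⊕ Fin n) (φ : L.BoundedFormula α k) :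
    φ.relabel g = bs (fun x => Term.var (BoundedFormula.relabelAux g k x)) φ := by
  induction φ with
  | falsum => rfl
  | equal s t => simp only [bs, BoundedFormula.relabel, BoundedFormula.mapTermRel,
      Term.relabel_eq_subst]
  | rel R ts => simp only [bs, BoundedFormula.relabel, BoundedFormula.mapTermRel,
      Term.relabel_eq_subst, id]
  | imp φ ψ h1 h2 => rw [BoundedFormula.relabel_imp, h1, h2]; rfl
  | all φ ih =>
    rw [BoundedFormula.relabel_all, ih]
    simp only [bs]
    congr 2
    funext x
    rcases x with a | i
    · simp only [BoundedFormula.relabelAux, Function.comp, Sum.map_inl, liftSubst_inl]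
      rcases g a with b | j
      · simp [up, Term.relabel]
      · simp [up, Term.relabel]
        rfl
    · refine Fin.lastCases ?_ (fun i => ?_) i
      · simp [BoundedFormula.relabelAux]
      · simp [BoundedFormula.relabelAux, up, Term.relabel]

theorem subst_eq_bs {n : ℕ} (φ : L.BoundedFormula α n) (f : α → L.Term β) :
    φ.subst f = bs (Sum.elim (Term.relabel Sum.inl ∘ f) (Term.var ∘ Sum.inr)) φ := by
  induction φ with
  | falsum => rfl
  | equal s t => rfl
  | rel R ts => rfl
  | imp φ ψ h1 h2 =>
    change BoundedFormula.imp (φ.subst f) (ψ.subst f) = _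
    rw [h1, h2]; rfl
  | all φ ih =>
    change BoundedFormula.all (φ.subst f) = _
    rw [ih]
    simp only [bs]
    congr 2
    funext x
    rcases x with a | i
    · simp [up]; rfl
    · refine Fin.lastCases ?_ (fun i => ?_) i
      · simp
      · simp [up, Term.relabel]

theorem toFormula_eq_bs {n : ℕ} (φ : L.BoundedFormula α n) :
    φ.toFormula = bs (fun x => Term.var (Sum.inl x)) φ := by
  induction φ with
  | falsum => rfl
  | equal s t =>
    simp only [BoundedFormula.toFormula, Term.equal, Term.bdEqual, bs, Term.relabel_eq_subst]
  | rel R ts =>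
    simp only [BoundedFormula.toFormula, Relations.formula, Relations.boundedFormula, bs,
      Term.relabel_eq_subst]
  | imp φ ψ h1 h2 => simp only [BoundedFormula.toFormula, bs, h1, h2]
  | all φ ih =>
    simp only [BoundedFormula.toFormula, bs, ih, relabel_eq_bs, bs_bs]
    congr 2
    funext x
    rcases x with a | i
    · simp [up, Term.relabel, Term.subst, BoundedFormula.relabelAux]
    · refine Fin.lastCases ?_ (fun i => ?_) i
      · simp only [liftSubst_last]
        simp [Term.subst, BoundedFormula.relabelAux]
        rfl
      · simp only [liftSubst_castSucc]
        simp [up, Term.subst, Term.relabel, BoundedFormula.relabelAux]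

theorem realize_up {n : ℕ} {M : Type} [L.Structure M] (t : L.Term (α ⊕ Fin n)) (v : α → M)
    (xs : Fin n → M) (a : M) :
    (up t).realize (Sum.elim v (Fin.snoc (α := fun _ => M) xs a)) = t.realize (Sum.elim v xs) := by
  rw [up, Term.realize_relabel]
  congr 1
  funext x
  rcases x with b | i <;> simp

theorem realize_bs {n : ℕ} {M : Type} [L.Structure M] (φ : L.BoundedFormula α n) :
    ∀ {m : ℕ} (σ : α ⊕ Fin n → L.Term (β ⊕ Fin m)) (v : β → M) (xs : Fin m → M),
    (bs σ φ).Realize v xs ↔ φ.Realize (fun a => (σ (Sum.inl a)).realize (Sum.elim v xs))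
      (fun i => (σ (Sum.inr i)).realize (Sum.elim v xs)) := by
  have key : ∀ {n m : ℕ} (σ : α ⊕ Fin n → L.Term (β ⊕ Fin m)) (v : β → M) (xs : Fin m → M),
      (fun x => (σ x).realize (Sum.elim v xs)) =
      Sum.elim (fun a => (σ (Sum.inl a)).realize (Sum.elim v xs))
      (fun i => (σ (Sum.inr i)).realize (Sum.elim v xs)) := by
    intro n m σ v xs
    funext x
    rcases x with a | i <;> rfl
  induction φ with
  | falsum => intros; rfl
  | equal s t =>
    intro m σ v xs
    simp only [bs, BoundedFormula.Realize, Term.realize_subst, key σ v xs]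
  | rel R ts =>
    intro m σ v xs
    simp only [bs, BoundedFormula.Realize, Term.realize_subst, key σ v xs]
  | imp φ ψ h1 h2 => intros; simp only [bs, BoundedFormula.realize_imp, h1, h2]
  | all φ ih =>
    intro m σ v xs
    simp only [bs, BoundedFormula.realize_all, ih]
    refine forall_congr' fun a => ?_
    have : (fun i => (liftSubst σ (Sum.inr i)).realize (Sum.elim v (Fin.snoc (α := fun _ => M) xs a))) =
        Fin.snoc (α := fun _ => M) (fun i => (σ (Sum.inr i)).realize (Sum.elim v xs)) a := by
      funext i
      refine Fin.lastCases ?_ (fun i => ?_) i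
      · simp
      · simp [realize_up]
    rw [this]
    simp only [liftSubst_inl, realize_up]

theorem inst_eq_bs (φ : L.BoundedFormula α 1) (t : L.Term α) :
    inst φ t = bs (Sum.elim (fun a => Term.var (Sum.inl a)) (fun _ => t.relabel Sum.inl)) φ := by
  rw [inst, toFormula_eq_bs, subst_eq_bs, bs_bs]
  congr 1
  funext x
  rcases x with a | i <;> simp [Term.subst, Term.relabel]

theorem toOpen_eq_bs (φ : L.Sentence) :
    toOpen φ = bs (Sum.elim Empty.elim Fin.elim0) φ := by
  rw [toOpen, Formula.relabel, relabel_eq_bs]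
  congr 1
  funext x
  rcases x with a | i
  · exact a.elim
  · exact i.elim0

theorem app_eq_bs {k n : ℕ} (φ : L.Formula (Fin k)) (ts : Fin k → L.Term (α ⊕ Fin n)) :
    app φ ts = bs (Sum.elim ts Fin.elim0) φ := by
  have : app φ ts = bs (fun x => Term.var (BoundedFormula.relabelAux id 0 x))
    (bs (Sum.elim (Term.relabel Sum.inl ∘ ts) (Term.var ∘ Sum.inr)) φ) := by
    rw [← subst_eq_bs, ← relabel_eq_bs]; rfl
  rw [this, bs_bs]
  congr 1
  funext x
  rcases x with a | i
  · simp only [Sum.elim_inl, Function.comp, Term.relabel_eq_subst, Term.subst_subst', Term.subst]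
    conv_rhs => rw [← Term.subst_var' (ts a)]
    congr 1
    funext y
    rcases y with b | j
    · rfl
    · simp [BoundedFormula.relabelAux]; rfl
  · exact i.elim0

theorem realize_inst {M : Type} [L.Structure M] (φ : L.BoundedFormula α 1) (t : L.Term α)
    (v : α → M) : (inst φ t).Realize v ↔ φ.Realize v (fun _ => t.realize v) := by
  rw [inst_eq_bs, Formula.Realize, realize_bs]
  simp only [Sum.elim_inl, Sum.elim_inr, Term.realize_var, Term.realize_relabel]
  rfl

theorem realize_toOpen {M : Type} [L.Structure M] (φ : L.Sentence) (v : ℕ → M) :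
    (toOpen φ).Realize v ↔ M ⊨ φ := by
  rw [toOpen, Formula.realize_relabel, Sentence.Realize, Unique.eq_default (v ∘ Empty.elim)]

theorem realize_app {M : Type} [L.Structure M] {k n : ℕ} (φ : L.Formula (Fin k))
    (ts : Fin k → L.Term (α ⊕ Fin n)) (v : α → M) (xs : Fin n → M) :
    (app φ ts).Realize v xs ↔ φ.Realize (fun i => (ts i).realize (Sum.elim v xs)) := by
  rw [app_eq_bs, realize_bs, Formula.Realize]
  simp only [Sum.elim_inl]
  rw [Unique.eq_default (fun i : Fin 0 => _)]

end Substitution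

/-! ### Soundness -/

section Soundness

variable {L : FirstOrder.Language.{0, 0}} {α β : Type}

theorem Term.realize_congr [DecidableEq α] {n : ℕ} {M : Type} [L.Structure M]
    (t : L.Term (α ⊕ Fin n)) (v w : α → M) (xs : Fin n → M)
    (h : ∀ a ∈ t.varFinsetLeft, v a = w a) :
    t.realize (Sum.elim v xs) = t.realize (Sum.elim w xs) := by
  induction t with
  | var x =>
    rcases x with a | i
    · simpa [Term.varFinsetLeft] using h
    · rfl
  | func f ts ih =>
    simp only [Term.realize_func]
    congr 1
    funext i
    exact ih i fun a ha => h a (by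
      simp only [Term.varFinsetLeft, Finset.mem_biUnion]
      exact ⟨i, Finset.mem_univ _, ha⟩)

theorem realize_congr [DecidableEq α] {n : ℕ} {M : Type} [L.Structure M]
    (φ : L.BoundedFormula α n) : ∀ (v w : α → M) (xs : Fin n → M),
    (∀ a ∈ φ.freeVarFinset, v a = w a) → (φ.Realize v xs ↔ φ.Realize w xs) := by
  induction φ with
  | falsum => intros; rfl
  | equal s t =>
    intro v w xs h
    simp only [BoundedFormula.freeVarFinset, Finset.mem_union] at h
    simp only [BoundedFormula.Realize]
    rw [Term.realize_congr s v w xs fun a ha => h a (.inl ha),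
      Term.realize_congr t v w xs fun a ha => h a (.inr ha)]
  | rel R ts =>
    intro v w xs h
    simp only [BoundedFormula.freeVarFinset, Finset.mem_biUnion] at h
    simp only [BoundedFormula.Realize]
    rw [show (fun i => (ts i).realize (Sum.elim v xs)) = fun i => (ts i).realize (Sum.elim w xs)
      from funext fun i => Term.realize_congr (ts i) v w xs
        fun a ha => h a ⟨i, Finset.mem_univ _, ha⟩]
  | imp φ ψ h1 h2 =>
    intro v w xs h
    simp only [BoundedFormula.freeVarFinset, Finset.mem_union] at h
    rw [BoundedFormula.realize_imp, BoundedFormula.realize_imp,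
      h1 v w xs fun a ha => h a (.inl ha), h2 v w xs fun a ha => h a (.inr ha)]
  | all φ ih =>
    intro v w xs h
    rw [BoundedFormula.realize_all, BoundedFormula.realize_all]
    exact forall_congr' fun a => ih v w _ h

theorem snoc_default {M : Type} (a : M) :
    (Fin.snoc (default : Fin 0 → M) a : Fin 1 → M) = fun _ => a := by
  funext i
  rw [Fin.fin_one_eq_zero i]
  rfl

theorem Derives.sound {Γ : Set (L.Formula ℕ)} {φ : L.Formula ℕ} (h : Derives Γ φ) (M : Type)
    [L.Structure M] : ∀ v : ℕ → M, (∀ ψ ∈ Γ, ψ.Realize v) → φ.Realize v := by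
  induction h with
  | ax h => exact fun v hv => hv _ h
  | weaken h _ ih => exact fun v hv => ih v fun ψ hψ => hv ψ (h hψ)
  | impI _ ih =>
    intro v hv
    rw [Formula.realize_imp]
    intro h
    refine ih v fun ψ hψ => ?_
    rcases hψ with rfl | hψ
    exacts [h, hv ψ hψ]
  | impE _ _ ih1 ih2 => exact fun v hv => Formula.realize_imp.1 (ih1 v hv) (ih2 v hv)
  | raa _ ih =>
    intro v hv
    by_contra h
    refine Formula.realize_bot.1 (ih v fun ψ hψ => ?_)
    rcases hψ with rfl | hψ
    · rw [Formula.realize_imp]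
      exact fun h' => absurd h' h
    · exact hv ψ hψ
  | @allI Γ φ x hΓ hφ _ ih =>
    intro v hv
    rw [Formula.Realize, BoundedFormula.realize_all]
    intro a
    -- The eigenvariable is reassigned to `a`. It is free neither in the hypotheses nor in `φ`, so
    -- both keep their values.
    have h1 := ih (Function.update v x a) fun ψ hψ =>
      (realize_congr ψ _ _ _ fun b hb => by
        rw [Function.update_of_ne]
        rintro rfl
        exact hΓ ψ hψ hb).2 (hv ψ hψ)
    rw [realize_inst] at h1
    have h2 := (realize_congr φ _ v _ fun b hb => by
        rw [Function.update_of_ne]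
        rintro rfl
        exact hφ hb).1 h1
    simpa [snoc_default] using h2
  | allE t _ ih =>
    intro v hv
    rw [realize_inst]
    have h := BoundedFormula.realize_all.1 (ih v hv) (t.realize v)
    rwa [snoc_default] at h
  | eqI t => exact fun v hv => Formula.realize_equal.2 rfl
  | eqE _ _ ih1 ih2 =>
    intro v hv
    have h1 := Formula.realize_equal.1 (ih1 v hv)
    have h2 := ih2 v hv
    rw [realize_inst] at h2 ⊢
    rwa [← h1]

theorem Proves.sound {T : L.Theory} {φ : L.Sentence} (h : Proves T φ) (M : Type)
    [L.Structure M] [Nonempty M] (hM : M ⊨ T) : M ⊨ φ := by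
  have v : ℕ → M := fun _ => Classical.arbitrary M
  rw [← realize_toOpen φ v]
  refine Derives.sound h M v ?_
  rintro _ ⟨ψ, hψ, rfl⟩
  rw [realize_toOpen]
  exact hM.realize_of_mem ψ hψ

end Soundness

/-! ### Completeness -/

section Completeness

variable {L : FirstOrder.Language.{0, 0}} {α β : Type}

theorem freeVarFinset_bs_of_closed [DecidableEq β] {n : ℕ} (φ : L.BoundedFormula α n) :
    ∀ {m : ℕ} (σ : α ⊕ Fin n → L.Term (β ⊕ Fin m)), (∀ y x, x ∉ (σ y).varFinsetLeft) →
    ∀ x, x ∉ (bs σ φ).freeVarFinset := by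
  have hterm : ∀ {n m : ℕ} (t : L.Term (α ⊕ Fin n)) (σ : α ⊕ Fin n → L.Term (β ⊕ Fin m)),
      (∀ y x, x ∉ (σ y).varFinsetLeft) → ∀ x, x ∉ (t.subst σ).varFinsetLeft := by
    intro n m t σ h x
    induction t with
    | var y => exact h y x
    | func f ts ih => simpa [Term.subst, Term.varFinsetLeft] using ih
  have hup : ∀ {m : ℕ} (t : L.Term (β ⊕ Fin m)) (x : β), x ∉ t.varFinsetLeft →
      x ∉ (up t).varFinsetLeft := by
    intro m t x
    induction t with
    | var y => rcases y with y | y <;> simp [up, Term.relabel, Term.varFinsetLeft]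
    | func f ts ih =>
      intro h
      simp only [Term.varFinsetLeft, Finset.mem_biUnion, Finset.mem_univ, true_and, not_exists] at h
      simp only [up, Term.relabel, Term.varFinsetLeft, Finset.mem_biUnion, Finset.mem_univ,
        true_and, not_exists]
      exact fun i => ih i (h i)
  induction φ with
  | falsum => intro m σ h x; simp [bs, BoundedFormula.freeVarFinset]
  | equal s t =>
    intro m σ h x
    simp only [bs, BoundedFormula.freeVarFinset, Finset.mem_union, not_or]
    exact ⟨hterm s σ h x, hterm t σ h x⟩
  | rel R ts =>
    intro m σ h x
    simp only [bs, BoundedFormula.freeVarFinset, Finset.mem_biUnion, not_exists, not_and]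
    exact fun i _ => hterm (ts i) σ h x
  | imp φ ψ h1 h2 =>
    intro m σ h x
    simp only [bs, BoundedFormula.freeVarFinset, Finset.mem_union, not_or]
    exact ⟨h1 σ h x, h2 σ h x⟩
  | all φ ih =>
    intro m σ h
    refine ih (liftSubst σ) fun y x => ?_
    rcases y with a | i
    · exact hup _ x (h _ x)
    · refine Fin.lastCases ?_ (fun i => ?_) i
      · simp [Term.varFinsetLeft]
      · rw [liftSubst_castSucc]
        exact hup _ x (h _ x)

/-- Axioms use up no variables, so the variables themselves can serve as Henkin constants. -/
theorem freeVarFinset_toOpen (φ : L.Sentence) (x : ℕ) :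
    x ∉ BoundedFormula.freeVarFinset (toOpen φ) := by
  rw [toOpen_eq_bs]
  refine freeVarFinset_bs_of_closed φ _ (fun y => ?_) x
  rcases y with a | i
  · exact a.elim
  · exact i.elim0

/-- A derivation uses finitely many hypotheses; hence consistency passes to unions of chains. -/
theorem Derives.exists_finite {Γ : Set (L.Formula ℕ)} {φ : L.Formula ℕ} (h : Derives Γ φ) :
    ∃ Δ ⊆ Γ, Δ.Finite ∧ Derives Δ φ := by
  induction h with
  | ax h => exact ⟨{_}, Set.singleton_subset_iff.2 h, Set.finite_singleton _, .ax rfl⟩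
  | weaken h _ ih =>
    obtain ⟨Δ, h1, h2, h3⟩ := ih
    exact ⟨Δ, h1.trans h, h2, h3⟩
  | @impI Γ φ ψ _ ih =>
    obtain ⟨Δ, h1, h2, h3⟩ := ih
    refine ⟨Δ \ {φ}, ?_, h2.sdiff, .impI (.weaken ?_ h3)⟩
    · rintro x ⟨hx, hx'⟩
      exact (h1 hx).resolve_left hx'
    · intro x hx
      by_cases h : x = φ
      exacts [.inl h, .inr ⟨hx, h⟩]
  | impE _ _ ih1 ih2 =>
    obtain ⟨Δ, h1, h2, h3⟩ := ih1
    obtain ⟨Δ', h1', h2', h3'⟩ := ih2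
    exact ⟨Δ ∪ Δ', Set.union_subset h1 h1', h2.union h2',
      .impE (.weaken Set.subset_union_left h3) (.weaken Set.subset_union_right h3')⟩
  | @raa Γ φ _ ih =>
    obtain ⟨Δ, h1, h2, h3⟩ := ih
    refine ⟨Δ \ {φ ⟹ ⊥}, ?_, h2.sdiff, .raa (.weaken ?_ h3)⟩
    · rintro x ⟨hx, hx'⟩
      exact (h1 hx).resolve_left hx'
    · intro x hx
      by_cases h : x = (φ ⟹ ⊥)
      exacts [.inl h, .inr ⟨hx, h⟩]
  | allI x hΓ hφ _ ih =>
    obtain ⟨Δ, h1, h2, h3⟩ := ih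
    exact ⟨Δ, h1, h2, .allI x (fun ψ hψ => hΓ ψ (h1 hψ)) hφ h3⟩
  | allE t _ ih =>
    obtain ⟨Δ, h1, h2, h3⟩ := ih
    exact ⟨Δ, h1, h2, .allE t h3⟩
  | eqI t => exact ⟨∅, Set.empty_subset _, Set.finite_empty, .eqI t⟩
  | eqE _ _ ih1 ih2 =>
    obtain ⟨Δ, h1, h2, h3⟩ := ih1
    obtain ⟨Δ', h1', h2', h3'⟩ := ih2
    exact ⟨Δ ∪ Δ', Set.union_subset h1 h1', h2.union h2',
      .eqE (.weaken Set.subset_union_left h3) (.weaken Set.subset_union_right h3')⟩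

/-- A set of formulas from which no contradiction is derivable. -/
def Consistent (Γ : Set (L.Formula ℕ)) : Prop := ¬ Derives Γ ⊥

theorem Consistent.sUnion {c : Set (Set (L.Formula ℕ))} (hc : IsChain (· ⊆ ·) c)
    (hne : c.Nonempty) (h : ∀ Γ ∈ c, Consistent Γ) : Consistent (⋃₀ c) := by
  intro hd
  obtain ⟨Δ, h1, h2, h3⟩ := hd.exists_finite
  obtain ⟨Γ, hΓ, hΔ⟩ := hc.directedOn.exists_mem_subset_of_finite_of_subset_sUnion hne h2 h1
  exact h Γ hΓ (.weaken hΔ h3)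

theorem Consistent.exists_maximal {Γ : Set (L.Formula ℕ)} (h : Consistent Γ) :
    ∃ Δ, Γ ⊆ Δ ∧ Maximal Consistent Δ := by
  obtain ⟨Δ, h1, h2⟩ := zorn_subset_nonempty {S | Consistent S}
    (fun c hc hch hne => ⟨⋃₀ c, Consistent.sUnion hch hne hc, fun s hs => Set.subset_sUnion_of_mem hs⟩)
    Γ h
  exact ⟨Δ, h1, h2⟩

/-- A natural number that does not belong to a finite set. -/
def freshVar (s : Finset ℕ) : ℕ := s.sup id + 1

theorem freshVar_notMem (s : Finset ℕ) : freshVar s ∉ s := fun h =>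
  Nat.not_succ_le_self _ (Finset.le_sup (f := id) h)

/-- The Henkin axiom for `∀ φ`, with a witness variable outside `s`. -/
def henkinAxiom (φ : L.BoundedFormula ℕ 1) (s : Finset ℕ) : L.Formula ℕ :=
  inst φ (Term.var (freshVar (s ∪ φ.freeVarFinset))) ⟹ ∀' φ

/-- If the implication is refutable from `Γ`, then `Γ` derives its premise `φ(x)` for a fresh `x`,
hence `∀' φ` by generalization, hence the implication itself. -/
theorem Consistent.insert_henkinAxiom {Γ : Set (L.Formula ℕ)} (h : Consistent Γ)
    (φ : L.BoundedFormula ℕ 1) (s : Finset ℕ)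
    (hs : ∀ ψ ∈ Γ, BoundedFormula.freeVarFinset ψ ⊆ s) :
    Consistent (insert (henkinAxiom φ s) Γ) := by
  intro hd
  have hn := freshVar_notMem (s ∪ φ.freeVarFinset)
  rw [Finset.mem_union, not_or] at hn
  have hneg : Derives Γ (henkinAxiom φ s ⟹ ⊥) := .impI hd
  have hall : Derives Γ (∀' φ) := by
    refine .allI (freshVar (s ∪ φ.freeVarFinset)) (fun ψ hψ hx => hn.1 (hs ψ hψ hx)) hn.2 (.raa ?_)
    refine .impE (.weaken (Set.subset_insert _ _) hneg) (.impI (.raa ?_))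
    exact .impE (.ax (.inr (.inr (.inl rfl)))) (.ax (.inr (.inl rfl)))
  exact h (.impE hneg (.impI (.weaken (Set.subset_insert _ _) hall)))

/-- Henkin axioms are added along an enumeration of the formulas. Since the formulas of `Γ` are
closed, only finitely many variables are in use at each stage, so a fresh witness exists without
enlarging the language. -/
theorem Consistent.exists_henkin [Countable L.Symbols] {Γ : Set (L.Formula ℕ)} (h : Consistent Γ)
    (hΓ : ∀ ψ ∈ Γ, ∀ x, x ∉ BoundedFormula.freeVarFinset ψ) :
    ∃ Δ, Γ ⊆ Δ ∧ Consistent Δ ∧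
      ∀ φ : L.BoundedFormula ℕ 1, ∃ x : ℕ, (inst φ (Term.var x) ⟹ ∀' φ) ∈ Δ := by
  have : Countable (L.BoundedFormula ℕ 1) :=
    (sigma_mk_injective (β := fun n => L.BoundedFormula ℕ n) (i := 1)).countable
  have : Nonempty (L.BoundedFormula ℕ 1) := ⟨⊥⟩
  obtain ⟨e, he⟩ := exists_surjective_nat (L.BoundedFormula ℕ 1)
  let used : ℕ → Finset ℕ := fun n => Nat.rec ∅
    (fun i u => u ∪ BoundedFormula.freeVarFinset (henkinAxiom (e i) u)) n
  let G : ℕ → Set (L.Formula ℕ) := fun n => Nat.rec Γ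
    (fun i S => insert (henkinAxiom (e i) (used i)) S) n
  have hused : ∀ i, used (i + 1) =
    used i ∪ BoundedFormula.freeVarFinset (henkinAxiom (e i) (used i)) := fun _ => rfl
  have hG : ∀ i, G (i + 1) = insert (henkinAxiom (e i) (used i)) (G i) := fun _ => rfl
  have hfree : ∀ i, ∀ ψ ∈ G i, BoundedFormula.freeVarFinset ψ ⊆ used i := by
    intro i
    induction i with
    | zero => exact fun ψ hψ x hx => (hΓ ψ hψ x hx).elim
    | succ i ih =>
      intro ψ hψ
      rw [hused]
      rw [hG] at hψ
      rcases hψ with rfl | hψ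
      · exact Finset.subset_union_right
      · exact (ih ψ hψ).trans Finset.subset_union_left
  have hcons : ∀ i, Consistent (G i) := by
    intro i
    induction i with
    | zero => exact h
    | succ i ih =>
      rw [hG]
      exact ih.insert_henkinAxiom _ _ (hfree i)
  have hmono : Monotone G := monotone_nat_of_le_succ fun i => Set.subset_insert _ _
  refine ⟨⋃₀ Set.range G, ?_, ?_, ?_⟩
  · exact Set.subset_sUnion_of_mem (t := G 0) ⟨0, rfl⟩
  · refine Consistent.sUnion hmono.isChain_range (Set.range_nonempty _) ?_
    rintro _ ⟨i, rfl⟩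
    exact hcons i
  · intro φ
    obtain ⟨i, rfl⟩ := he φ
    exact ⟨_, Set.mem_sUnion.2 ⟨G (i + 1), ⟨i + 1, rfl⟩, .inl rfl⟩⟩

/-! ### Maximal consistent sets and the term model. -/

theorem mem_of_derives {Δ : Set (L.Formula ℕ)} (hΔ : Maximal Consistent Δ) {φ : L.Formula ℕ}
    (h : Derives Δ φ) : φ ∈ Δ := by
  by_contra hφ
  have h1 : ¬ Consistent (insert φ Δ) := fun hc =>
    hφ (hΔ.2 hc (Set.subset_insert _ _) (Set.mem_insert _ _))
  exact hΔ.1 (.impE (.impI (not_not.1 h1)) h)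

theorem imp_mem_iff {Δ : Set (L.Formula ℕ)} (hΔ : Maximal Consistent Δ) {φ ψ : L.Formula ℕ} :
    (φ ⟹ ψ) ∈ Δ ↔ (φ ∈ Δ → ψ ∈ Δ) := by
  constructor
  · exact fun h h' => mem_of_derives hΔ (.impE (.ax h) (.ax h'))
  · intro h
    by_cases hφ : φ ∈ Δ
    · exact mem_of_derives hΔ (.impI (.ax (.inr (h hφ))))
    · have h1 : ¬ Consistent (insert φ Δ) := fun hc =>
        hφ (hΔ.2 hc (Set.subset_insert _ _) (Set.mem_insert _ _))
      exact mem_of_derives hΔ (.impI (.raa (.weaken (Set.subset_insert _ _) (not_not.1 h1))))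

/-- A maximal consistent set that contains a witness for every universal formula. -/
structure IsHenkin (Δ : Set (L.Formula ℕ)) : Prop where
  maximal : Maximal Consistent Δ
  witness : ∀ φ : L.BoundedFormula ℕ 1, ∃ x : ℕ, (inst φ (Term.var x) ⟹ ∀' φ) ∈ Δ

theorem all_mem_iff {Δ : Set (L.Formula ℕ)} (hΔ : IsHenkin Δ) {φ : L.BoundedFormula ℕ 1} :
    (∀' φ) ∈ Δ ↔ ∀ t : L.Term ℕ, inst φ t ∈ Δ := by
  constructor
  · exact fun h t => mem_of_derives hΔ.maximal (.allE t (.ax h))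
  · intro h
    obtain ⟨x, hx⟩ := hΔ.witness φ
    exact (imp_mem_iff hΔ.maximal).1 hx (h _)

/-- Replacement of the dangling bound variables by terms. -/
def instAll {n : ℕ} (φ : L.BoundedFormula ℕ n) (ts : Fin n → L.Term ℕ) : L.Formula ℕ :=
  bs (Sum.elim (fun a => Term.var (Sum.inl a)) (fun i => (ts i).relabel Sum.inl)) φ

/-- The equality rule replaces one distinguished variable. Isolating a coordinate in this way allows
a tuple of terms to be replaced coordinate by coordinate. -/
theorem instAll_eq_inst_update {n : ℕ} (φ : L.BoundedFormula ℕ n) (ts : Fin n → L.Term ℕ)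
    (j : Fin n) : ∃ ψ : L.BoundedFormula ℕ 1, ∀ t, inst ψ t = instAll φ (Function.update ts j t) := by
  refine ⟨bs (Sum.elim (fun a => Term.var (Sum.inl a))
    (fun i => if i = j then Term.var (Sum.inr 0) else (ts i).relabel Sum.inl)) φ, fun t => ?_⟩
  rw [inst_eq_bs, bs_bs, instAll]
  congr 1
  funext x
  rcases x with a | i
  · simp [Term.subst]
  · by_cases h : i = j
    · subst h
      simp [Term.subst]
    · simp [h, Term.relabel_eq_subst, Term.subst_subst', Term.subst]

theorem instAll_congr {Δ : Set (L.Formula ℕ)} (hΔ : IsHenkin Δ) {n : ℕ}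
    (φ : L.BoundedFormula ℕ n) (ts ts' : Fin n → L.Term ℕ)
    (h : ∀ i, Term.equal (ts i) (ts' i) ∈ Δ) (hφ : instAll φ ts ∈ Δ) : instAll φ ts' ∈ Δ := by
  classical
  have key : ∀ S : Finset (Fin n), instAll φ (fun i => if i ∈ S then ts' i else ts i) ∈ Δ := by
    intro S
    induction S using Finset.induction with
    | empty => simpa using hφ
    | insert j S hj ih =>
      obtain ⟨ψ, hψ⟩ := instAll_eq_inst_update φ (fun i => if i ∈ S then ts' i else ts i) j
      have h1 := hψ (ts j)
      have h2 := hψ (ts' j)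
      rw [Function.update_eq_self_iff.2 (by simp [hj])] at h1
      have h3 : (Function.update (fun i => if i ∈ S then ts' i else ts i) j (ts' j)) =
          fun i => if i ∈ insert j S then ts' i else ts i := by
        funext i
        by_cases hi : i = j
        · subst hi; simp
        · simp [hi]
      rw [h3] at h2
      rw [← h2]
      rw [← h1] at ih
      exact mem_of_derives hΔ.maximal (.eqE (.ax (h j)) (.ax ih))
  simpa using key Finset.univ

theorem instAll_equal {n : ℕ} (s t : L.Term (ℕ ⊕ Fin n)) (ts : Fin n → L.Term ℕ) :
    instAll (.equal s t) ts =
      Term.equal (s.subst (Sum.elim Term.var ts)) (t.subst (Sum.elim Term.var ts)) := by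
  have : ∀ s : L.Term (ℕ ⊕ Fin n), s.subst (Sum.elim (fun a => Term.var (Sum.inl a))
      (fun i => (ts i).relabel Sum.inl)) =
      (s.subst (Sum.elim Term.var ts)).relabel (Sum.inl : ℕ → ℕ ⊕ Fin 0) := by
    intro s
    rw [Term.relabel_eq_subst, Term.subst_subst']
    congr 1
    funext x
    rcases x with a | i
    · rfl
    · simp [Term.relabel_eq_subst]
  rw [instAll, bs, Term.equal, this, this]
  rfl

theorem instAll_rel {n k : ℕ} (R : L.Relations k) (us : Fin k → L.Term (ℕ ⊕ Fin n))
    (ts : Fin n → L.Term ℕ) :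
    instAll (.rel R us) ts = instAll (.rel R (fun i : Fin k => Term.var (Sum.inr i)))
      (fun i => (us i).subst (Sum.elim Term.var ts)) := by
  simp only [instAll, bs]
  congr 1
  funext i
  simp only [Term.subst, Sum.elim_inr]
  rw [Term.relabel_eq_subst, Term.subst_subst']
  congr 1
  funext x
  rcases x with a | i
  · rfl
  · simp [Term.relabel_eq_subst]

theorem equal_refl_mem {Δ : Set (L.Formula ℕ)} (hΔ : IsHenkin Δ) (t : L.Term ℕ) :
    Term.equal t t ∈ Δ := mem_of_derives hΔ.maximal (.eqI t)

theorem equal_symm_mem {Δ : Set (L.Formula ℕ)} (hΔ : IsHenkin Δ) {s t : L.Term ℕ}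
    (h : Term.equal s t ∈ Δ) : Term.equal t s ∈ Δ := by
  have := instAll_congr hΔ (.equal (Term.var (Sum.inr 0)) (Term.var (Sum.inr 1)) :
    L.BoundedFormula ℕ 2) ![s, s] ![t, s]
    (by rw [Fin.forall_fin_two]; exact ⟨h, equal_refl_mem hΔ s⟩)
    (by rw [instAll_equal]; exact equal_refl_mem hΔ s)
  rwa [instAll_equal] at this

theorem equal_trans_mem {Δ : Set (L.Formula ℕ)} (hΔ : IsHenkin Δ) {s t u : L.Term ℕ}
    (h : Term.equal s t ∈ Δ) (h' : Term.equal t u ∈ Δ) : Term.equal s u ∈ Δ := by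
  have := instAll_congr hΔ (.equal (Term.var (Sum.inr 0)) (Term.var (Sum.inr 1)) :
    L.BoundedFormula ℕ 2) ![s, t] ![s, u]
    (by rw [Fin.forall_fin_two]; exact ⟨equal_refl_mem hΔ s, h'⟩)
    (by rw [instAll_equal]; exact h)
  rwa [instAll_equal] at this

theorem func_congr_mem {Δ : Set (L.Formula ℕ)} (hΔ : IsHenkin Δ) {n : ℕ} (f : L.Functions n)
    {ts ts' : Fin n → L.Term ℕ} (h : ∀ i, Term.equal (ts i) (ts' i) ∈ Δ) :
    Term.equal (Term.func f ts) (Term.func f ts') ∈ Δ := by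
  have := instAll_congr hΔ (.equal ((Term.func f ts).relabel Sum.inl)
    (Term.func f fun i => Term.var (Sum.inr i)) : L.BoundedFormula ℕ n) ts ts' h
    (by
      rw [instAll_equal, Term.relabel_eq_subst, Term.subst_subst']
      simp only [Term.subst, Sum.elim_inl, Sum.elim_inr, Term.subst_var']
      exact equal_refl_mem hΔ _)
  rw [instAll_equal, Term.relabel_eq_subst, Term.subst_subst'] at this
  simpa only [Term.subst, Sum.elim_inl, Sum.elim_inr, Term.subst_var'] using this

/-- Provable equality of terms. -/
def termSetoid {Δ : Set (L.Formula ℕ)} (hΔ : IsHenkin Δ) : Setoid (L.Term ℕ) where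
  r s t := Term.equal s t ∈ Δ
  iseqv := ⟨equal_refl_mem hΔ, equal_symm_mem hΔ, equal_trans_mem hΔ⟩

/-- The term model of a Henkin set. -/
def TermModel {Δ : Set (L.Formula ℕ)} (hΔ : IsHenkin Δ) : Type := Quotient (termSetoid hΔ)

/-- The class of a term in the term model. -/
def TermModel.mk {Δ : Set (L.Formula ℕ)} (hΔ : IsHenkin Δ) (t : L.Term ℕ) : TermModel hΔ :=
  Quotient.mk (termSetoid hΔ) t

theorem TermModel.mk_eq {Δ : Set (L.Formula ℕ)} (hΔ : IsHenkin Δ) {s t : L.Term ℕ} :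
    TermModel.mk hΔ s = TermModel.mk hΔ t ↔ Term.equal s t ∈ Δ :=
  Quotient.eq (r := termSetoid hΔ)

/-- A representative of a class. -/
noncomputable def TermModel.rep {Δ : Set (L.Formula ℕ)} {hΔ : IsHenkin Δ} (a : TermModel hΔ) :
    L.Term ℕ := Quotient.out a

@[simp] theorem TermModel.mk_rep {Δ : Set (L.Formula ℕ)} {hΔ : IsHenkin Δ} (a : TermModel hΔ) :
    TermModel.mk hΔ a.rep = a := Quotient.out_eq a

noncomputable instance {Δ : Set (L.Formula ℕ)} (hΔ : IsHenkin Δ) : L.Structure (TermModel hΔ) where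
  funMap f xs := TermModel.mk hΔ (Term.func f fun i => (xs i).rep)
  RelMap R xs := instAll (.rel R fun i => Term.var (Sum.inr i)) (fun i => (xs i).rep) ∈ Δ

theorem TermModel.realize_term {Δ : Set (L.Formula ℕ)} (hΔ : IsHenkin Δ) {n : ℕ}
    (t : L.Term (ℕ ⊕ Fin n)) (ts : Fin n → L.Term ℕ) :
    t.realize (Sum.elim (fun x => TermModel.mk hΔ (Term.var x)) (fun i => TermModel.mk hΔ (ts i))) =
      TermModel.mk hΔ (t.subst (Sum.elim Term.var ts)) := by
  induction t with
  | var x => rcases x with a | i <;> rfl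
  | func f us ih =>
    simp only [Term.realize_func, ih, Term.subst]
    refine (TermModel.mk_eq hΔ).2 (func_congr_mem hΔ f fun i => ?_)
    rw [← TermModel.mk_eq, TermModel.mk_rep]

/-- The truth lemma. Every element of the model is the class of a term, so the quantifier case
amounts to `all_mem_iff`, where the Henkin witnesses enter. -/
theorem TermModel.realize_iff {Δ : Set (L.Formula ℕ)} (hΔ : IsHenkin Δ) {n : ℕ}
    (φ : L.BoundedFormula ℕ n) : ∀ ts : Fin n → L.Term ℕ,
    (φ.Realize (fun x => TermModel.mk hΔ (Term.var x)) (fun i => TermModel.mk hΔ (ts i)) ↔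
      instAll φ ts ∈ Δ) := by
  induction φ with
  | falsum =>
    intro ts
    exact ⟨False.elim, fun h => hΔ.maximal.1 (.ax h)⟩
  | equal s t =>
    intro ts
    rw [instAll_equal, BoundedFormula.Realize, TermModel.realize_term, TermModel.realize_term,
      TermModel.mk_eq]
  | rel R us =>
    intro ts
    rw [instAll_rel, BoundedFormula.Realize]
    simp only [TermModel.realize_term]
    constructor
    · refine instAll_congr hΔ _ _ _ fun i => ?_
      rw [← TermModel.mk_eq, TermModel.mk_rep]
    · refine instAll_congr hΔ _ _ _ fun i => ?_
      rw [← TermModel.mk_eq, TermModel.mk_rep]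
  | imp φ ψ h1 h2 =>
    intro ts
    rw [BoundedFormula.realize_imp, h1, h2]
    exact (imp_mem_iff hΔ.maximal).symm
  | @all n φ ih =>
    intro ts
    rw [BoundedFormula.realize_all]
    change _ ↔ (∀' (bs (liftSubst _) φ)) ∈ Δ
    rw [all_mem_iff hΔ]
    have key : ∀ t : L.Term ℕ, inst (bs (liftSubst (Sum.elim (fun a => Term.var (Sum.inl a))
        (fun i => (ts i).relabel Sum.inl))) φ) t =
        instAll φ (Fin.snoc (α := fun _ => L.Term ℕ) ts t) := by
      intro t
      rw [inst_eq_bs, bs_bs, instAll]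
      congr 1
      funext x
      rcases x with a | i
      · simp [up, Term.relabel, Term.subst]
      · refine Fin.lastCases ?_ (fun i => ?_) i
        · rw [liftSubst_last]
          simp [Term.subst]
        · simp [up, Term.relabel_eq_subst, Term.subst_subst', Term.subst]
    have key2 : ∀ t : L.Term ℕ, (Fin.snoc (α := fun _ => TermModel hΔ)
        (fun i => TermModel.mk hΔ (ts i)) (TermModel.mk hΔ t)) =
        fun i => TermModel.mk hΔ (Fin.snoc (α := fun _ => L.Term ℕ) ts t i) := by
      intro t
      funext i
      refine Fin.lastCases ?_ (fun i => ?_) i <;> simp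
    constructor
    · intro h t
      rw [key, ← ih, ← key2]
      exact h _
    · intro h a
      rw [← TermModel.mk_rep a, key2, ih, ← key]
      exact h _

/-- If `φ` is not derivable, `T` together with its negation extends to a maximal Henkin set, whose
term model contradicts the hypothesis. -/
theorem Proves.complete [Countable L.Symbols] {T : L.Theory} {φ : L.Sentence}
    (h : ∀ (M : Type) [L.Structure M] [Nonempty M], M ⊨ T → M ⊨ φ) : Proves T φ := by
  refine .raa ?_
  by_contra hc
  obtain ⟨Γ, hΓ, hcons, hw⟩ := Consistent.exists_henkin hc (by
    rintro _ (rfl | ⟨ψ, -, rfl⟩) x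
    · simpa [BoundedFormula.freeVarFinset] using freeVarFinset_toOpen φ x
    · exact freeVarFinset_toOpen ψ x)
  obtain ⟨Δ, hΔ, hmax⟩ := hcons.exists_maximal
  have H : IsHenkin Δ := ⟨hmax, fun φ => (hw φ).imp fun _ hx => hΔ hx⟩
  have : Nonempty (TermModel H) := ⟨TermModel.mk H (Term.var 0)⟩
  have key : ∀ ψ : L.Sentence, TermModel H ⊨ ψ ↔ toOpen ψ ∈ Δ := by
    intro ψ
    rw [← realize_toOpen ψ (fun x => TermModel.mk H (Term.var x)), Formula.Realize]
    have h1 := TermModel.realize_iff H (toOpen ψ) Fin.elim0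
    have h2 : instAll (toOpen ψ) Fin.elim0 = toOpen ψ := by
      rw [instAll]
      conv_rhs => rw [← bs_var (toOpen ψ)]
      congr 1
      funext x
      rcases x with a | i
      · rfl
      · exact i.elim0
    rw [h2] at h1
    rw [← h1]
    exact iff_of_eq (congrArg _ (Subsingleton.elim _ _))
  have hφ : toOpen φ ∈ Δ := by
    rw [← key]
    refine h (TermModel H) ((Theory.model_iff T).2 fun ψ hψ => ?_)
    rw [key]
    exact hΔ (hΓ (.inr ⟨ψ, hψ, rfl⟩))
  exact H.maximal.1 (.impE (.ax (hΔ (hΓ (.inl rfl)))) (.ax hφ))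

end Completeness

/-! ### Models of Peano arithmetic -/

instance : Countable arith.Symbols := by
  have h1 : Countable (Σ l, arith.Functions l) := by
    refine Function.Surjective.countable (α := Fin 4) (f := fun i => match i with
      | 0 => ⟨0, ArithFunc.zero⟩ | 1 => ⟨1, ArithFunc.succ⟩
      | 2 => ⟨2, ArithFunc.add⟩ | 3 => ⟨2, ArithFunc.mul⟩) ?_
    rintro ⟨_, _ | _ | _ | _⟩
    exacts [⟨0, rfl⟩, ⟨1, rfl⟩, ⟨2, rfl⟩, ⟨3, rfl⟩]
  have h2 : Countable (Σ l, arith.Relations l) := by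
    refine Function.Surjective.countable (α := Unit) (f := fun _ => ⟨2, ArithRel.lt⟩) ?_
    rintro ⟨_, R⟩
    cases R
    exact ⟨(), rfl⟩
  exact inferInstanceAs (Countable ((Σ l, arith.Functions l) ⊕ (Σ l, arith.Relations l)))

section Structure

variable {M : Type} [arith.Structure M]

variable (M) in
/-- The interpretation of `0`. -/
def sZero : M := Structure.funMap (L := arith) ArithFunc.zero ![]

/-- The interpretation of `S`. -/
def sSucc (a : M) : M := Structure.funMap (L := arith) ArithFunc.succ ![a]

/-- The interpretation of `+`. -/
def sAdd (a b : M) : M := Structure.funMap (L := arith) ArithFunc.add ![a, b]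

/-- The interpretation of `·`. -/
def sMul (a b : M) : M := Structure.funMap (L := arith) ArithFunc.mul ![a, b]

/-- The interpretation of `<`. -/
def sLt (a b : M) : Prop := Structure.RelMap (L := arith) ArithRel.lt ![a, b]

end Structure

section Realize

variable {α : Type} {n : ℕ} {M : Type} [arith.Structure M]

theorem realize_zeroT (v : α → M) :
    (zeroT : arith.Term α).realize v = sZero M :=
  congrArg (Structure.funMap (L := arith) ArithFunc.zero) (Subsingleton.elim _ _)

theorem realize_succT (v : α → M) (t : arith.Term α) :
    (succT t).realize v = sSucc (t.realize v) :=
  Term.realize_functions_apply₁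

theorem realize_addT (v : α → M) (s t : arith.Term α) :
    (addT s t).realize v = sAdd (s.realize v) (t.realize v) :=
  Term.realize_functions_apply₂

theorem realize_mulT (v : α → M) (s t : arith.Term α) :
    (mulT s t).realize v = sMul (s.realize v) (t.realize v) :=
  Term.realize_functions_apply₂

theorem realize_ltF (v : α → M) (xs : Fin n → M) (s t : arith.Term (α ⊕ Fin n)) :
    (ltF s t).Realize v xs ↔ sLt (s.realize (Sum.elim v xs)) (t.realize (Sum.elim v xs)) :=
  BoundedFormula.realize_rel₂

theorem realize_close {k : ℕ} (φ : arith.Formula (Fin k)) :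
    M ⊨ close φ ↔ ∀ p : Fin k → M, φ.Realize p := by
  rw [close, Sentence.Realize, BoundedFormula.realize_alls]
  refine forall_congr' fun p => ?_
  rw [Formula.Realize, BoundedFormula.realize_relabel]
  exact iff_of_eq (congrArg₂ _ rfl (Subsingleton.elim _ _))

theorem realize_allLast (φ : arith.Formula (α ⊕ Fin 1)) (v : α → M) :
    (allLast φ).Realize v ↔ ∀ a : M, φ.Realize (Sum.elim v fun _ => a) := by
  rw [allLast, Formula.Realize, BoundedFormula.realize_all]
  refine forall_congr' fun a => ?_
  rw [Formula.Realize, BoundedFormula.realize_relabel, snoc_default]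
  exact iff_of_eq (congrArg₂ _ rfl (Subsingleton.elim _ _))

theorem realize_subst {β : Type} (φ : arith.Formula α) (f : α → arith.Term β) (v : β → M) :
    Formula.Realize (BoundedFormula.subst φ f) v ↔ φ.Realize fun a => (f a).realize v := by
  rw [Formula.Realize, BoundedFormula.realize_subst]
  rfl

theorem realize_inductionAxiom {k : ℕ} (φ : arith.Formula (Fin k ⊕ Fin 1)) :
    M ⊨ inductionAxiom φ ↔ ∀ p : Fin k → M,
      φ.Realize (Sum.elim p fun _ => sZero M) →
      (∀ a : M, φ.Realize (Sum.elim p fun _ => a) →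
        φ.Realize (Sum.elim p fun _ => sSucc a)) →
      ∀ a : M, φ.Realize (Sum.elim p fun _ => a) := by
  rw [inductionAxiom, realize_close]
  refine forall_congr' fun p => ?_
  rw [Formula.realize_imp, Formula.realize_imp, realize_allLast, realize_allLast]
  simp only [Formula.realize_imp, realize_subst]
  have h0 : (fun a => Term.realize p (Sum.elim Term.var (fun _ => zeroT) a)) =
      Sum.elim p fun _ : Fin 1 => sZero M := by
    funext x
    rcases x with i | i
    · rfl
    · exact realize_zeroT p
  have h1 : ∀ a : M, (fun x => Term.realize (Sum.elim p fun _ : Fin 1 => a)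
        (Sum.elim (fun i => Term.var (Sum.inl i)) (fun _ => succT (Term.var (Sum.inr 0))) x)) =
      Sum.elim p fun _ : Fin 1 => sSucc a := by
    intro a
    funext x
    rcases x with i | i
    · rfl
    · exact realize_succT _ _
  rw [h0]
  simp only [h1]

end Realize

/-- The models of Peano arithmetic. -/
abbrev PAModel := Theory.ModelType.{0, 0, 0} PA

namespace PAModel

section Axioms

variable (M : PAModel)

instance : Zero M := ⟨sZero M⟩
instance : Add M := ⟨sAdd⟩
instance : Mul M := ⟨sMul⟩
instance : LT M := ⟨sLt⟩

variable {M}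

@[simp] theorem sZero_eq : sZero M = 0 := rfl
@[simp] theorem sAdd_eq (a b : M) : sAdd a b = a + b := rfl
@[simp] theorem sMul_eq (a b : M) : sMul a b = a * b := rfl
@[simp] theorem sLt_iff (a b : M) : sLt a b ↔ a < b := .rfl

theorem realize_axiom {φ : arith.Sentence} (h : IsPAAxiom φ) : M ⊨ φ :=
  M.is_model.realize_of_mem φ h

theorem sc_ne_zero (a : M) : sSucc a ≠ 0 := by
  have := realize_axiom (M := M) .succ_ne_zero
  simp [Sentence.Realize, Formula.Realize, realize_succT, realize_zeroT, Fin.snoc] at this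
  exact this a

theorem sc_inj {a b : M} (h : sSucc a = sSucc b) : a = b := by
  have := realize_axiom (M := M) .succ_inj
  simp [Sentence.Realize, Formula.Realize, realize_succT, Fin.snoc] at this
  exact this a b h

theorem add_zero' (a : M) : a + 0 = a := by
  have := realize_axiom (M := M) .add_zero
  simp [Sentence.Realize, Formula.Realize, realize_addT, realize_zeroT, Fin.snoc] at this
  exact this a

theorem add_sc (a b : M) : a + sSucc b = sSucc (a + b) := by
  have := realize_axiom (M := M) .add_succ
  simp [Sentence.Realize, Formula.Realize, realize_addT, realize_succT, Fin.snoc] at this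
  exact this a b

theorem mul_zero' (a : M) : a * 0 = 0 := by
  have := realize_axiom (M := M) .mul_zero
  simp [Sentence.Realize, Formula.Realize, realize_mulT, realize_zeroT, Fin.snoc] at this
  exact this a

theorem mul_sc (a b : M) : a * sSucc b = a * b + a := by
  have := realize_axiom (M := M) .mul_succ
  simp [Sentence.Realize, Formula.Realize, realize_addT, realize_mulT, realize_succT, Fin.snoc] at this
  exact this a b

theorem lt_iff (a b : M) : a < b ↔ ∃ c, a + sSucc c = b := by
  have := realize_axiom (M := M) .lt_iff
  simp [Sentence.Realize, Formula.Realize, realize_addT, realize_ltF, realize_succT, Fin.snoc] at this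
  exact this a b

theorem induction {k : ℕ} (φ : arith.Formula (Fin k ⊕ Fin 1)) (p : Fin k → M)
    (h0 : φ.Realize (Sum.elim p fun _ => 0))
    (h1 : ∀ a : M, φ.Realize (Sum.elim p fun _ => a) → φ.Realize (Sum.elim p fun _ => sSucc a))
    (a : M) : φ.Realize (Sum.elim p fun _ => a) :=
  (realize_inductionAxiom φ).1 (realize_axiom (.induction φ)) p h0 h1 a

/-- Induction is available for definable predicates only, so each use exhibits a formula with
parameters and checks that it defines `P`. -/
theorem induct {P : M → Prop} {k : ℕ} (φ : arith.Formula (Fin k ⊕ Fin 1)) (p : Fin k → M)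
    (h : ∀ a, φ.Realize (Sum.elim p fun _ => a) ↔ P a) (h0 : P 0)
    (h1 : ∀ a, P a → P (sSucc a)) (a : M) : P a :=
  (h a).1 (induction φ p ((h 0).2 h0) (fun b hb => (h _).2 (h1 b ((h b).1 hb))) a)

/-! ### A model of PA as an ordered commutative semiring. -/

instance : One M := ⟨sSucc 0⟩

theorem sSucc_zero : sSucc (0 : M) = 1 := rfl

theorem sSucc_eq (a : M) : sSucc a = a + 1 := by
  rw [← sSucc_zero, add_sc, add_zero']

theorem zero_add' (a : M) : 0 + a = a := by
  refine induct (P := fun a => 0 + a = a) (k := 0) (Term.equal (addT zeroT (Term.var (Sum.inr 0))) (Term.var (Sum.inr 0)))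
    ![] (fun a => ?_) (add_zero' 0) (fun a h => ?_) a
  · simp [Formula.realize_equal, realize_addT, realize_zeroT]
  · rw [add_sc, h]

theorem sc_add (a b : M) : sSucc a + b = sSucc (a + b) := by
  refine induct (P := fun b => sSucc a + b = sSucc (a + b)) (k := 1) (Term.equal (addT (succT (Term.var (Sum.inl 0))) (Term.var (Sum.inr 0)))
    (succT (addT (Term.var (Sum.inl 0)) (Term.var (Sum.inr 0)))))
    ![a] (fun b => ?_) ?_ (fun b h => ?_) b
  · simp [Formula.realize_equal, realize_addT, realize_succT]
  · rw [add_zero', add_zero']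
  · rw [add_sc, h, add_sc]

theorem add_comm' (a b : M) : a + b = b + a := by
  refine induct (P := fun b => a + b = b + a) (k := 1) (Term.equal (addT (Term.var (Sum.inl 0)) (Term.var (Sum.inr 0)))
    (addT (Term.var (Sum.inr 0)) (Term.var (Sum.inl 0))))
    ![a] (fun b => ?_) ?_ (fun b h => ?_) b
  · simp [Formula.realize_equal, realize_addT]
  · rw [add_zero', zero_add']
  · rw [add_sc, h, sc_add]

theorem add_assoc' (a b c : M) : a + b + c = a + (b + c) := by
  refine induct (P := fun c => a + b + c = a + (b + c)) (k := 2) (Term.equal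
    (addT (addT (Term.var (Sum.inl 0)) (Term.var (Sum.inl 1))) (Term.var (Sum.inr 0)))
    (addT (Term.var (Sum.inl 0)) (addT (Term.var (Sum.inl 1)) (Term.var (Sum.inr 0)))))
    ![a, b] (fun c => ?_) ?_ (fun c h => ?_) c
  · simp [Formula.realize_equal, realize_addT]
  · rw [add_zero', add_zero']
  · rw [add_sc, add_sc, add_sc, h]

instance : AddCommMonoid M where
  add_assoc := add_assoc'
  zero_add := zero_add'
  add_zero := add_zero'
  add_comm := add_comm'
  nsmul := nsmulRec

theorem mul_succ' (a b : M) : a * (b + 1) = a * b + a := by rw [← sSucc_eq, mul_sc]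

theorem zero_mul' (a : M) : 0 * a = 0 := by
  refine induct (P := fun a => 0 * a = 0) (k := 0) (Term.equal (mulT zeroT (Term.var (Sum.inr 0))) zeroT)
    ![] (fun a => ?_) (mul_zero' 0) (fun a h => ?_) a
  · simp [Formula.realize_equal, realize_mulT, realize_zeroT]
  · rw [mul_sc, h, add_zero]

theorem succ_mul' (a b : M) : (a + 1) * b = a * b + b := by
  refine induct (P := fun b => (a + 1) * b = a * b + b) (k := 1) (Term.equal (mulT (addT (Term.var (Sum.inl 0)) (succT zeroT))
    (Term.var (Sum.inr 0)))
    (addT (mulT (Term.var (Sum.inl 0)) (Term.var (Sum.inr 0))) (Term.var (Sum.inr 0))))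
    ![a] (fun b => ?_) ?_ (fun b h => ?_) b
  · simp [Formula.realize_equal, realize_addT, realize_mulT, realize_succT, realize_zeroT,
      sSucc_zero]
  · rw [mul_zero', mul_zero', add_zero]
  · rw [mul_sc, mul_sc, h, sSucc_eq]
    abel

theorem mul_comm' (a b : M) : a * b = b * a := by
  refine induct (P := fun b => a * b = b * a) (k := 1) (Term.equal (mulT (Term.var (Sum.inl 0)) (Term.var (Sum.inr 0)))
    (mulT (Term.var (Sum.inr 0)) (Term.var (Sum.inl 0))))
    ![a] (fun b => ?_) ?_ (fun b h => ?_) b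
  · simp [Formula.realize_equal, realize_mulT]
  · rw [mul_zero', zero_mul']
  · rw [sSucc_eq, mul_succ', h, succ_mul']

theorem mul_add' (a b c : M) : a * (b + c) = a * b + a * c := by
  refine induct (P := fun c => a * (b + c) = a * b + a * c) (k := 2) (Term.equal
    (mulT (Term.var (Sum.inl 0)) (addT (Term.var (Sum.inl 1)) (Term.var (Sum.inr 0))))
    (addT (mulT (Term.var (Sum.inl 0)) (Term.var (Sum.inl 1)))
      (mulT (Term.var (Sum.inl 0)) (Term.var (Sum.inr 0)))))
    ![a, b] (fun c => ?_) ?_ (fun c h => ?_) c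
  · simp [Formula.realize_equal, realize_mulT, realize_addT]
  · rw [mul_zero', add_zero, add_zero]
  · rw [add_sc, mul_sc, mul_sc, h, add_assoc]

theorem mul_assoc' (a b c : M) : a * b * c = a * (b * c) := by
  refine induct (P := fun c => a * b * c = a * (b * c)) (k := 2) (Term.equal
    (mulT (mulT (Term.var (Sum.inl 0)) (Term.var (Sum.inl 1))) (Term.var (Sum.inr 0)))
    (mulT (Term.var (Sum.inl 0)) (mulT (Term.var (Sum.inl 1)) (Term.var (Sum.inr 0)))))
    ![a, b] (fun c => ?_) ?_ (fun c h => ?_) c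
  · simp [Formula.realize_equal, realize_mulT]
  · rw [mul_zero', mul_zero', mul_zero']
  · rw [mul_sc, mul_sc, h, mul_add']

theorem mul_one' (a : M) : a * 1 = a := by
  rw [← sSucc_zero, mul_sc, mul_zero', zero_add]

instance : CommSemiring M where
  left_distrib := mul_add'
  right_distrib a b c := by rw [mul_comm', mul_add', mul_comm' c, mul_comm' c]
  zero_mul := zero_mul'
  mul_zero := mul_zero'
  mul_assoc := mul_assoc'
  one_mul a := by rw [mul_comm', mul_one']
  mul_one := mul_one'
  mul_comm := mul_comm'

theorem add_right_cancel' (a b c : M) : a + c = b + c → a = b := by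
  refine induct (P := fun c => a + c = b + c → a = b) (k := 2) (Term.equal
    (addT (Term.var (Sum.inl 0)) (Term.var (Sum.inr 0)))
    (addT (Term.var (Sum.inl 1)) (Term.var (Sum.inr 0))) ⟹
    Term.equal (Term.var (Sum.inl 0)) (Term.var (Sum.inl 1)))
    ![a, b] (fun c => ?_) ?_ (fun c h => ?_) c
  · simp [Formula.realize_equal, realize_addT]
  · rw [add_zero, add_zero]
    exact id
  · rw [add_sc, add_sc]
    exact fun h' => h (sc_inj h')

theorem eq_zero_or_succ (a : M) : a = 0 ∨ ∃ b, a = b + 1 := by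
  refine induct (P := fun a => a = 0 ∨ ∃ b, a = b + 1) (k := 0)
    (Term.equal (Term.var (Sum.inr 0)) zeroT ⊔
      ∃' (Term.var (Sum.inl (Sum.inr 0)) =' succT (&0)))
    ![] (fun c => ?_) (.inl rfl) (fun c h => .inr ⟨c, sSucc_eq c⟩) a
  simp [Formula.Realize, Term.equal, realize_zeroT, realize_succT, sSucc_eq, Fin.snoc]

theorem lt_iff_exists (a b : M) : a < b ↔ ∃ c, a + (c + 1) = b := by
  simp only [lt_iff, sSucc_eq]

theorem trichotomy (a b : M) : a < b ∨ a = b ∨ b < a := by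
  refine induct (P := fun b => a < b ∨ a = b ∨ b < a) (k := 1)
    (ltF (Term.var (Sum.inl (Sum.inl 0))) (Term.var (Sum.inl (Sum.inr 0))) ⊔
      (Term.equal (Term.var (Sum.inl 0)) (Term.var (Sum.inr 0)) ⊔
       ltF (Term.var (Sum.inl (Sum.inr 0))) (Term.var (Sum.inl (Sum.inl 0)))))
    ![a] (fun c => ?_) ?_ (fun c h => ?_) b
  · simp [Formula.Realize, Term.equal, realize_ltF]
  · rcases eq_zero_or_succ a with rfl | ⟨c, rfl⟩
    · exact .inr (.inl rfl)
    · exact .inr (.inr ((lt_iff_exists _ _).2 ⟨c, zero_add _⟩))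
  · simp only [lt_iff_exists, sSucc_eq] at h ⊢
    rcases h with ⟨d, rfl⟩ | rfl | ⟨d, rfl⟩
    · exact .inl ⟨d + 1, by ring⟩
    · exact .inl ⟨0, by ring⟩
    · rcases eq_zero_or_succ d with rfl | ⟨e, rfl⟩
      · exact .inr (.inl (by ring))
      · exact .inr (.inr ⟨e, by ring⟩)

theorem lt_irrefl' (a : M) : ¬ a < a := by
  rw [lt_iff_exists]
  rintro ⟨c, hc⟩
  have : c + 1 + a = 0 + a := by rw [zero_add, add_comm, hc]
  have := add_right_cancel' _ _ _ this
  rw [← sSucc_eq] at this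
  exact sc_ne_zero c this

theorem lt_trans' {a b c : M} (h : a < b) (h' : b < c) : a < c := by
  rw [lt_iff_exists] at *
  obtain ⟨d, rfl⟩ := h
  obtain ⟨e, rfl⟩ := h'
  exact ⟨d + 1 + e, by ring⟩

instance : LE M := ⟨fun a b => a < b ∨ a = b⟩

theorem le_iff' (a b : M) : a ≤ b ↔ a < b ∨ a = b := .rfl

noncomputable instance : LinearOrder M where
  le_refl a := .inr rfl
  le_trans a b c := by
    rintro (h | rfl) (h' | rfl)
    exacts [.inl (lt_trans' h h'), .inl h, .inl h', .inr rfl]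
  lt_iff_le_not_ge a b := by
    constructor
    · refine fun h => ⟨.inl h, ?_⟩
      rintro (h' | rfl)
      exacts [lt_irrefl' a (lt_trans' h h'), lt_irrefl' _ h]
    · rintro ⟨h | rfl, h'⟩
      exacts [h, (h' (.inr rfl)).elim]
  le_antisymm a b := by
    rintro (h | rfl) (h' | h')
    exacts [(lt_irrefl' a (lt_trans' h h')).elim, h'.symm, rfl, rfl]
  le_total a b := by
    rcases trichotomy a b with h | rfl | h
    exacts [.inl (.inl h), .inl (.inr rfl), .inr (.inl h)]
  toDecidableLE := Classical.decRel _

theorem le_iff_exists (a b : M) : a ≤ b ↔ ∃ c, a + c = b := by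
  rw [le_iff', lt_iff_exists]
  constructor
  · rintro (⟨c, rfl⟩ | rfl)
    exacts [⟨_, rfl⟩, ⟨0, add_zero _⟩]
  · rintro ⟨c, rfl⟩
    rcases eq_zero_or_succ c with rfl | ⟨d, rfl⟩
    exacts [.inr (add_zero _).symm, .inl ⟨d, rfl⟩]

theorem add_lt_add_left' {a b : M} (h : a < b) (c : M) : c + a < c + b := by
  rw [lt_iff_exists] at *
  obtain ⟨d, rfl⟩ := h
  exact ⟨d, by ring⟩

theorem mul_lt_mul_of_pos_left' {a b c : M} (h : a < b) (hc : 0 < c) : c * a < c * b := by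
  rw [lt_iff_exists] at *
  obtain ⟨d, rfl⟩ := h
  obtain ⟨e, rfl⟩ := hc
  exact ⟨e * d + d + e, by ring⟩

instance : IsStrictOrderedRing M where
  add_le_add_left a b h c := by
    obtain ⟨d, rfl⟩ := (le_iff_exists a b).1 h
    exact (le_iff_exists _ _).2 ⟨d, by ring⟩
  le_of_add_le_add_left a b c h := by
    by_contra! h'
    exact absurd h (not_le.2 (add_lt_add_left' h' a))
  zero_le_one := (le_iff_exists _ _).2 ⟨1, zero_add 1⟩
  exists_pair_ne := ⟨1, 0, sc_ne_zero 0⟩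
  mul_lt_mul_of_pos_left a ha b c h := mul_lt_mul_of_pos_left' h ha
  mul_lt_mul_of_pos_right a ha b c h := by
    change b * a < c * a
    rw [mul_comm b, mul_comm c]
    exact mul_lt_mul_of_pos_left' h ha

instance : CanonicallyOrderedAdd M where
  exists_add_of_le := fun {a b} h => by
    obtain ⟨c, hc⟩ := (le_iff_exists a b).1 h
    exact ⟨c, hc.symm⟩
  le_add_self a b := (le_iff_exists _ _).2 ⟨b, add_comm _ _⟩
  le_self_add a b := (le_iff_exists _ _).2 ⟨b, rfl⟩

theorem lt_add_one_iff' {a b : M} : a < b + 1 ↔ a ≤ b := by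
  rw [lt_iff_exists, le_iff_exists]
  refine exists_congr fun c => ?_
  rw [← add_assoc, add_left_inj]

/-- The standard numbers are an initial segment of every model. Absoluteness rests on this, and so
does the fact that programs of standardly bounded length are standard. -/
theorem exists_cast_of_lt {a : M} {n : ℕ} (h : a < n) : ∃ m < n, a = m := by
  induction n with
  | zero =>
    rw [Nat.cast_zero] at h
    exact absurd h not_lt_zero
  | succ n ih =>
    rw [Nat.cast_succ, lt_add_one_iff'] at h
    rcases h.lt_or_eq with h | h
    · obtain ⟨m, hm, rfl⟩ := ih h
      exact ⟨m, by omega, rfl⟩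
    · exact ⟨n, by omega, h⟩

theorem realize_numeral {α : Type} (v : α → M) (n : ℕ) :
    (numeral n : arith.Term α).realize v = n := by
  induction n with
  | zero => rw [numeral, realize_zeroT, Nat.cast_zero]; rfl
  | succ n ih => rw [numeral, realize_succT, ih, sSucc_eq, Nat.cast_succ]

/-- The least number principle for a formula with parameters. -/
theorem exists_least {P : M → Prop} {k : ℕ} (φ : arith.Formula (Fin k ⊕ Fin 1)) (p : Fin k → M)
    (h : ∀ a, φ.Realize (Sum.elim p fun _ => a) ↔ P a) (hex : ∃ a, P a) :
    ∃ a, P a ∧ ∀ b < a, ¬ P b := by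
  by_contra! hno
  -- Strong induction as ordinary induction on "nothing below `a` satisfies `P`", which is again
  -- definable.
  have key : ∀ a : M, ∀ b < a, ¬ P b := by
    intro a
    refine induct (P := fun a => ∀ b < a, ¬ P b) (k := k)
      (∀' (ltF (&0) (Term.var (Sum.inl (Sum.inr 0))) ⟹
        ∼(bs (Sum.elim (Sum.elim (fun i => Term.var (Sum.inl (Sum.inl i)))
          (fun _ => Term.var (Sum.inr 0))) Fin.elim0) φ))) p (fun a => ?_) ?_ ?_ a
    · rw [Formula.Realize, BoundedFormula.realize_all]
      refine forall_congr' fun b => ?_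
      rw [BoundedFormula.realize_imp, realize_ltF, BoundedFormula.realize_not, realize_bs, ← h,
        Formula.Realize, snoc_default]
      refine imp_congr .rfl (not_congr (iff_of_eq ?_))
      congr 1
      · funext x
        rcases x with i | i <;> rfl
      · exact Subsingleton.elim _ _
    · exact fun b hb => absurd hb not_lt_zero
    · intro a ha b hb hPb
      rw [sSucc_eq, lt_add_one_iff'] at hb
      rcases hb.lt_or_eq with hb | rfl
      · exact ha b hb hPb
      · obtain ⟨c, hc, hPc⟩ := hno b hPb
        exact ha c hc hPc
  obtain ⟨a, ha⟩ := hex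
  exact key (a + 1) a (lt_add_one_iff'.2 le_rfl) ha

end Axioms

end PAModel

/-! ### The standard model satisfies PA. -/

section Standard

@[simp] theorem sZero_nat : sZero ℕ = 0 := rfl
@[simp] theorem sSucc_nat (a : ℕ) : sSucc a = a + 1 := rfl
@[simp] theorem sAdd_nat (a b : ℕ) : sAdd a b = a + b := rfl
@[simp] theorem sMul_nat (a b : ℕ) : sMul a b = a * b := rfl
@[simp] theorem sLt_nat (a b : ℕ) : sLt a b ↔ a < b := .rfl

theorem realize_numeral_nat {α : Type} (v : α → ℕ) (n : ℕ) :
    (numeral n : arith.Term α).realize v = n := by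
  induction n with
  | zero => rw [numeral, realize_zeroT]; rfl
  | succ n ih => rw [numeral, realize_succT, ih, sSucc_nat]

theorem nat_models_PA : ℕ ⊨ PA := by
  refine (Theory.model_iff PA).2 fun φ hφ => ?_
  cases hφ with
  | induction φ =>
    rw [realize_inductionAxiom]
    intro p h0 h1 a
    induction a with
    | zero => exact h0
    | succ a ih => exact h1 a ih
  | lt_iff =>
    simp [Sentence.Realize, Formula.Realize, realize_addT, realize_ltF, realize_succT, Fin.snoc]
    intro a b
    constructor
    · exact fun h => ⟨b - a - 1, by omega⟩
    · rintro ⟨c, rfl⟩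
      omega
  | _ =>
    simp [Sentence.Realize, Formula.Realize, realize_addT, realize_mulT, realize_succT,
      realize_zeroT, Fin.snoc, add_assoc, mul_add]

end Standard

/-! ### Bounded formulas -/

section Delta0

variable {α β : Type} {n m : ℕ}

/-- The bounded quantifier `∀ x < t`. -/
def ballF (t : arith.Term (α ⊕ Fin n)) (φ : arith.BoundedFormula α (n + 1)) :
    arith.BoundedFormula α n := ∀' (ltF (Term.var (Sum.inr (Fin.last n))) (liftT t) ⟹ φ)

/-- The bounded quantifier `∃ x < t`. -/
def bexF (t : arith.Term (α ⊕ Fin n)) (φ : arith.BoundedFormula α (n + 1)) :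
    arith.BoundedFormula α n := ∃' (ltF (Term.var (Sum.inr (Fin.last n))) (liftT t) ⊓ φ)

section Realize

variable {M : Type} [arith.Structure M]

theorem realize_liftT (t : arith.Term (α ⊕ Fin n)) (v : α → M) (xs : Fin n → M) (a : M) :
    (liftT t).realize (Sum.elim v (Fin.snoc (α := fun _ => M) xs a)) =
      t.realize (Sum.elim v xs) := realize_up t v xs a

@[simp] theorem realize_ballF (t : arith.Term (α ⊕ Fin n)) (φ : arith.BoundedFormula α (n + 1))
    (v : α → M) (xs : Fin n → M) : (ballF t φ).Realize v xs ↔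
      ∀ a, sLt a (t.realize (Sum.elim v xs)) → φ.Realize v (Fin.snoc xs a) := by
  simp only [ballF, BoundedFormula.realize_all, BoundedFormula.realize_imp, realize_ltF,
    realize_liftT, Term.realize_var, Sum.elim_inr, Fin.snoc_last]

@[simp] theorem realize_bexF (t : arith.Term (α ⊕ Fin n)) (φ : arith.BoundedFormula α (n + 1))
    (v : α → M) (xs : Fin n → M) : (bexF t φ).Realize v xs ↔
      ∃ a, sLt a (t.realize (Sum.elim v xs)) ∧ φ.Realize v (Fin.snoc xs a) := by
  simp only [bexF, BoundedFormula.realize_ex, BoundedFormula.realize_inf, realize_ltF,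
    realize_liftT, Term.realize_var, Sum.elim_inr, Fin.snoc_last]

end Realize

theorem IsDelta0.not {φ : arith.BoundedFormula α n} (h : IsDelta0 φ) : IsDelta0 (∼φ) :=
  .imp h .falsum

theorem IsDelta0.inf {φ ψ : arith.BoundedFormula α n} (h : IsDelta0 φ) (h' : IsDelta0 ψ) :
    IsDelta0 (φ ⊓ ψ) := .imp (.imp h (.imp h' .falsum)) .falsum

theorem IsDelta0.sup {φ ψ : arith.BoundedFormula α n} (h : IsDelta0 φ) (h' : IsDelta0 ψ) :
    IsDelta0 (φ ⊔ ψ) := .imp (.not h) h'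

theorem IsDelta0.ballF {t : arith.Term (α ⊕ Fin n)} {φ : arith.BoundedFormula α (n + 1)}
    (h : IsDelta0 φ) : IsDelta0 (ballF t φ) := .ball t h

theorem IsDelta0.bexF {t : arith.Term (α ⊕ Fin n)} {φ : arith.BoundedFormula α (n + 1)}
    (h : IsDelta0 φ) : IsDelta0 (bexF t φ) := .bex t h

theorem IsDelta0.ltF (s t : arith.Term (α ⊕ Fin n)) : IsDelta0 (ltF s t) := .rel _ _

theorem IsDelta0.bdEqual (s t : arith.Term (α ⊕ Fin n)) : IsDelta0 (s =' t) := .equal s t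

theorem bs_ltF (σ : α ⊕ Fin n → arith.Term (β ⊕ Fin m)) (s t : arith.Term (α ⊕ Fin n)) :
    bs σ (ltF s t) = ltF (s.subst σ) (t.subst σ) := by
  simp only [ltF, Relations.boundedFormula₂, Relations.boundedFormula, bs]
  congr 1
  funext i
  revert i
  rw [Fin.forall_fin_two]
  exact ⟨rfl, rfl⟩

theorem bs_ballF (σ : α ⊕ Fin n → arith.Term (β ⊕ Fin m)) (t : arith.Term (α ⊕ Fin n))
    (φ : arith.BoundedFormula α (n + 1)) :
    bs σ (ballF t φ) = ballF (t.subst σ) (bs (liftSubst σ) φ) := by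
  simp only [ballF, bs, bs_ltF]
  rw [show (liftT t).subst (liftSubst σ) = liftT (t.subst σ) from up_subst σ t]
  simp only [Term.subst, liftSubst_last]

theorem bs_bexF (σ : α ⊕ Fin n → arith.Term (β ⊕ Fin m)) (t : arith.Term (α ⊕ Fin n))
    (φ : arith.BoundedFormula α (n + 1)) :
    bs σ (bexF t φ) = bexF (t.subst σ) (bs (liftSubst σ) φ) := by
  change ∃' (bs (liftSubst σ) (ltF _ _) ⊓ bs (liftSubst σ) φ) = _
  rw [bs_ltF, show (liftT t).subst (liftSubst σ) = liftT (t.subst σ) from up_subst σ t]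
  simp only [Term.subst, liftSubst_last]
  rfl

theorem IsDelta0.bs {φ : arith.BoundedFormula α n} (h : IsDelta0 φ) : ∀ {m : ℕ}
    (σ : α ⊕ Fin n → arith.Term (β ⊕ Fin m)), IsDelta0 (bs σ φ) := by
  induction h with
  | falsum => exact fun _ => .falsum
  | equal s t => exact fun _ => .equal _ _
  | rel R ts => exact fun _ => .rel _ _
  | imp _ _ h1 h2 => exact fun σ => .imp (h1 σ) (h2 σ)
  | ball t _ ih =>
    intro m σ
    have h := bs_ballF σ t
    simp only [KolmPA.ballF] at h
    rw [h]
    exact .ball _ (ih _)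
  | bex t _ ih =>
    intro m σ
    have h := bs_bexF σ t
    simp only [KolmPA.bexF] at h
    rw [h]
    exact .bex _ (ih _)

theorem IsPi1.bs {φ : arith.BoundedFormula α n} (h : IsPi1 φ) : ∀ {m : ℕ}
    (σ : α ⊕ Fin n → arith.Term (β ⊕ Fin m)), IsPi1 (bs σ φ) := by
  induction h with
  | of_delta0 h => exact fun σ => .of_delta0 (h.bs σ)
  | all _ ih => exact fun σ => .all (ih _)

theorem IsDelta0.app {k : ℕ} {φ : arith.Formula (Fin k)} (h : IsDelta0 φ)
    (ts : Fin k → arith.Term (α ⊕ Fin n)) : IsDelta0 (app φ ts) := by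
  rw [app_eq_bs]
  exact h.bs _

theorem atStr_eq_bs (φ : arith.Formula (Fin 1)) (s : List Bool) :
    atStr φ s = bs (Sum.elim (Term.relabel Sum.inl ∘ fun _ => strT s) (Term.var ∘ Sum.inr)) φ :=
  subst_eq_bs _ _

theorem IsPi1.atStr {φ : arith.Formula (Fin 1)} (h : IsPi1 φ) (s : List Bool) :
    IsPi1 (atStr φ s) := by
  rw [atStr_eq_bs]
  exact h.bs _

theorem realize_atStr {M : PAModel} (φ : arith.Formula (Fin 1)) (s : List Bool) :
    M ⊨ atStr φ s ↔ φ.Realize ![((code s : ℕ) : M)] := by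
  rw [atStr, Sentence.Realize, realize_subst]
  simp only [strT, PAModel.realize_numeral]
  rw [show (fun _ : Fin 1 => ((code s : ℕ) : M)) = ![((code s : ℕ) : M)] from
    funext fun i => by rw [Fin.fin_one_eq_zero i]; rfl]

theorem realize_atStr_nat (φ : arith.Formula (Fin 1)) (s : List Bool) :
    ℕ ⊨ atStr φ s ↔ φ.Realize ![code s] := by
  rw [atStr, Sentence.Realize, realize_subst]
  simp only [strT, realize_numeral_nat]
  rw [show (fun _ : Fin 1 => code s) = ![code s] from
    funext fun i => by rw [Fin.fin_one_eq_zero i]; rfl]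

/-! ### Absoluteness of bounded formulas -/

theorem realize_term_cast {M : PAModel} (t : arith.Term α) (v : α → ℕ) :
    t.realize (fun a => (v a : M)) = ((t.realize v : ℕ) : M) := by
  induction t with
  | var => rfl
  | @func l f ts ih =>
    simp only [Term.realize_func, ih]
    change ArithFunc l at f
    cases f with
    | zero =>
      rw [Matrix.empty_eq (fun i => _)]
      rw [Matrix.empty_eq (fun i => Term.realize v (ts i))]
      exact Nat.cast_zero.symm
    | succ =>
      have : (fun i => ((Term.realize v (ts i) : ℕ) : M)) = ![((Term.realize v (ts 0) : ℕ) : M)] := by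
        funext i
        rw [Fin.fin_one_eq_zero i]
        rfl
      rw [this]
      exact (PAModel.sSucc_eq _).trans (Nat.cast_succ _).symm
    | add =>
      have : (fun i => ((Term.realize v (ts i) : ℕ) : M)) =
          ![((Term.realize v (ts 0) : ℕ) : M), ((Term.realize v (ts 1) : ℕ) : M)] := by
        funext i
        revert i
        rw [Fin.forall_fin_two]
        exact ⟨rfl, rfl⟩
      rw [this]
      exact (Nat.cast_add _ _).symm
    | mul =>
      have : (fun i => ((Term.realize v (ts i) : ℕ) : M)) =
          ![((Term.realize v (ts 0) : ℕ) : M), ((Term.realize v (ts 1) : ℕ) : M)] := by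
        funext i
        revert i
        rw [Fin.forall_fin_two]
        exact ⟨rfl, rfl⟩
      rw [this]
      exact (Nat.cast_mul _ _).symm

theorem realize_term_cast' {M : PAModel} (t : arith.Term (α ⊕ Fin n)) (v : α → ℕ)
    (xs : Fin n → ℕ) : t.realize (Sum.elim (fun a => (v a : M)) (fun i => (xs i : M))) =
      ((t.realize (Sum.elim v xs) : ℕ) : M) := by
  rw [← realize_term_cast]
  congr 1
  funext x
  rcases x with a | i <;> rfl

theorem snoc_cast {M : PAModel} (xs : Fin n → ℕ) (a : ℕ) :
    (Fin.snoc (fun i => (xs i : M)) (a : M) : Fin (n + 1) → M) =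
      fun i => (((Fin.snoc xs a : Fin (n + 1) → ℕ) i : ℕ) : M) := by
  funext i
  refine Fin.lastCases ?_ (fun i => ?_) i <;> simp

/-- At standard arguments the bound of a quantifier is standard, so the quantifier ranges over the
same numbers in `M` and in `ℕ`. -/
theorem IsDelta0.realize_cast {M : PAModel} {φ : arith.BoundedFormula α n} (h : IsDelta0 φ) :
    ∀ (v : α → ℕ) (xs : Fin n → ℕ),
    φ.Realize (fun a => (v a : M)) (fun i => (xs i : M)) ↔ φ.Realize v xs := by
  induction h with
  | falsum => exact fun _ _ => .rfl
  | equal s t =>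
    intro v xs
    simp only [BoundedFormula.Realize, realize_term_cast', Nat.cast_inj]
  | @rel n l R ts =>
    intro v xs
    simp only [BoundedFormula.Realize, realize_term_cast']
    change ArithRel l at R
    cases R
    have : (fun i => ((Term.realize (Sum.elim v xs) (ts i) : ℕ) : M)) =
        ![((Term.realize (Sum.elim v xs) (ts 0) : ℕ) : M),
          ((Term.realize (Sum.elim v xs) (ts 1) : ℕ) : M)] := by
      funext i
      revert i
      rw [Fin.forall_fin_two]
      exact ⟨rfl, rfl⟩
    rw [this]
    exact Nat.cast_lt (α := M)
  | imp _ _ h1 h2 =>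
    intro v xs
    rw [BoundedFormula.realize_imp, BoundedFormula.realize_imp, h1, h2]
  | ball t _ ih =>
    intro v xs
    have h1 := realize_ballF (M := M) t
    have h2 := realize_ballF (M := ℕ) t
    simp only [KolmPA.ballF] at h1 h2
    rw [h1, h2, realize_term_cast']
    constructor
    · intro h a ha
      rw [← ih, ← snoc_cast]
      exact h a ((PAModel.sLt_iff _ _).2 (Nat.cast_lt.2 ((sLt_nat _ _).1 ha)))
    · intro h a ha
      obtain ⟨b, hb, rfl⟩ := PAModel.exists_cast_of_lt ha
      rw [snoc_cast, ih]
      exact h b hb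
  | bex t _ ih =>
    intro v xs
    have h1 := realize_bexF (M := M) t
    have h2 := realize_bexF (M := ℕ) t
    simp only [KolmPA.bexF] at h1 h2
    rw [h1, h2, realize_term_cast']
    constructor
    · rintro ⟨a, ha, h⟩
      obtain ⟨b, hb, rfl⟩ := PAModel.exists_cast_of_lt ha
      rw [snoc_cast, ih] at h
      exact ⟨b, hb, h⟩
    · rintro ⟨a, ha, h⟩
      rw [← ih, ← snoc_cast] at h
      exact ⟨a, (PAModel.sLt_iff _ _).2 (Nat.cast_lt.2 ((sLt_nat _ _).1 ha)), h⟩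

theorem IsDelta0.realize_formula_cast {M : PAModel} {φ : arith.Formula α} (h : IsDelta0 φ)
    (v : α → ℕ) : φ.Realize (fun a => (v a : M)) ↔ φ.Realize v := by
  refine Iff.trans (iff_of_eq ?_)
    ((h.realize_cast (M := M) v Fin.elim0).trans (iff_of_eq ?_))
  · exact congrArg (BoundedFormula.Realize φ _) (Subsingleton.elim _ _)
  · exact congrArg (BoundedFormula.Realize φ _) (Subsingleton.elim _ _)

/-! ### Stages of `Σ₁`- and `Π₁`-formulas -/

/-- The free variables together with a stage. -/
def withStage {M : Type} (w : M) (v : α → M) : Option α → M := fun o => o.elim w v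

theorem realize_withStage {M : Type} [arith.Structure M] (φ : arith.BoundedFormula α n) (w : M)
    (v : α → M) (xs : Fin n → M) :
    (KolmPA.bs (fun x => Term.var (Sum.map some id x)) φ : arith.BoundedFormula (Option α) n).Realize
      (withStage w v) xs ↔ φ.Realize v xs := by
  rw [realize_bs]
  rfl

/-- One stage, the new variable `none`, bounds a whole block of quantifiers. Monotonicity in the
stage is carried along so that the bound for a new quantifier and the stage for the remaining ones
can be merged into a maximum. -/
theorem IsSigma1.exists_stages {φ : arith.BoundedFormula α n} (h : IsSigma1 φ) :
    ∃ ψ : arith.BoundedFormula (Option α) n, IsDelta0 ψ ∧ ∀ (M : PAModel) (v : α → M)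
      (xs : Fin n → M), (φ.Realize v xs ↔ ∃ w, ψ.Realize (withStage w v) xs) ∧
      ∀ w w', w ≤ w' → ψ.Realize (withStage w v) xs → ψ.Realize (withStage w' v) xs := by
  induction h with
  | @of_delta0 n φ h =>
    refine ⟨_, h.bs fun x => Term.var (Sum.map some id x), fun M v xs => ⟨?_, ?_⟩⟩
    · simp only [realize_withStage, exists_const]
    · simp only [realize_withStage]
      exact fun _ _ _ => id
  | ex _ ih =>
    obtain ⟨ψ, h1, h2⟩ := ih
    refine ⟨KolmPA.bexF (Term.var (Sum.inl none)) ψ, h1.bexF, fun M v xs => ⟨?_, ?_⟩⟩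
    · simp only [realize_bexF, BoundedFormula.realize_ex, Term.realize_var, Sum.elim_inl,
        PAModel.sLt_iff, (h2 M v _).1]
      constructor
      · rintro ⟨a, w, h⟩
        refine ⟨max w (a + 1), a, ?_, (h2 M v _).2 _ _ (le_max_left _ _) h⟩
        exact lt_of_lt_of_le (lt_add_one a) (le_max_right _ _)
      · rintro ⟨w, a, -, h⟩
        exact ⟨a, w, h⟩
    · simp only [realize_bexF, Term.realize_var, Sum.elim_inl, PAModel.sLt_iff]
      rintro w w' hw ⟨a, ha, h⟩
      exact ⟨a, lt_of_lt_of_le ha hw, (h2 M v _).2 _ _ hw h⟩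

theorem IsPi1.exists_stages {φ : arith.BoundedFormula α n} (h : IsPi1 φ) :
    ∃ ψ : arith.BoundedFormula (Option α) n, IsDelta0 ψ ∧ ∀ (M : PAModel) (v : α → M)
      (xs : Fin n → M), (φ.Realize v xs ↔ ∀ w, ψ.Realize (withStage w v) xs) ∧
      ∀ w w', w ≤ w' → ψ.Realize (withStage w' v) xs → ψ.Realize (withStage w v) xs := by
  induction h with
  | @of_delta0 n φ h =>
    refine ⟨_, h.bs fun x => Term.var (Sum.map some id x), fun M v xs => ⟨?_, ?_⟩⟩
    · simp only [realize_withStage, forall_const]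
    · simp only [realize_withStage]
      exact fun _ _ _ => id
  | all _ ih =>
    obtain ⟨ψ, h1, h2⟩ := ih
    refine ⟨KolmPA.ballF (Term.var (Sum.inl none)) ψ, h1.ballF, fun M v xs => ⟨?_, ?_⟩⟩
    · simp only [realize_ballF, BoundedFormula.realize_all, Term.realize_var, Sum.elim_inl,
        PAModel.sLt_iff, (h2 M v _).1]
      constructor
      · exact fun h w a _ => h a w
      · intro h a w
        refine (h2 M v _).2 _ _ (le_max_left w (a + 1)) (h _ a ?_)
        exact lt_of_lt_of_le (lt_add_one a) (le_max_right _ _)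
    · simp only [realize_ballF, Term.realize_var, Sum.elim_inl, PAModel.sLt_iff]
      intro w w' hw h a ha
      exact (h2 M v _).2 _ _ hw (h a (lt_of_lt_of_le ha hw))

/-- `δ(p, x, w)` is a bounded formula saying that `D(p, x)` is witnessed before stage `w`. -/
structure IsStageSigma (D : arith.Formula (Fin 2)) (δ : arith.Formula (Fin 3)) : Prop where
  delta0 : IsDelta0 δ
  realize : ∀ (M : PAModel) (p x : M), D.Realize ![p, x] ↔ ∃ w, δ.Realize ![p, x, w]
  mono : ∀ (M : PAModel) (p x w w' : M), w ≤ w' → δ.Realize ![p, x, w] → δ.Realize ![p, x, w']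

/-- `υ(t, w)` is a bounded formula saying that `U(t)` is not refuted before stage `w`. -/
structure IsStagePi (U : arith.Formula (Fin 1)) (υ : arith.Formula (Fin 2)) : Prop where
  delta0 : IsDelta0 υ
  realize : ∀ (M : PAModel) (t : M), U.Realize ![t] ↔ ∀ w, υ.Realize ![t, w]
  anti : ∀ (M : PAModel) (t w w' : M), w ≤ w' → υ.Realize ![t, w'] → υ.Realize ![t, w]

theorem IsSigma1.exists_isStageSigma {D : arith.Formula (Fin 2)} (h : IsSigma1 D) :
    ∃ δ, IsStageSigma D δ := by
  obtain ⟨ψ, h1, h2⟩ := h.exists_stages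
  let σ : Option (Fin 2) ⊕ Fin 0 → arith.Term (Fin 3 ⊕ Fin 0) :=
    Sum.elim (fun o => Term.var (Sum.inl (o.elim 2 Fin.castSucc))) Fin.elim0
  have key : ∀ (M : PAModel) (p x w : M), Formula.Realize (KolmPA.bs σ ψ) ![p, x, w] ↔
      ψ.Realize (withStage w ![p, x]) default := by
    intro M p x w
    rw [Formula.Realize, realize_bs]
    have e1 : (fun a => (σ (Sum.inl a)).realize (Sum.elim ![p, x, w] default)) =
        withStage w ![p, x] := by
      funext o
      rcases o with _ | i
      · rfl
      · revert i
        rw [Fin.forall_fin_two]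
        exact ⟨rfl, rfl⟩
    rw [e1]
    exact iff_of_eq (congrArg _ (Subsingleton.elim _ _))
  refine ⟨KolmPA.bs σ ψ, h1.bs _, fun M p x => ?_, fun M p x w w' hw => ?_⟩
  · simp only [key]
    exact (h2 M _ _).1
  · simp only [key]
    exact (h2 M _ _).2 _ _ hw

theorem IsPi1.exists_isStagePi {U : arith.Formula (Fin 1)} (h : IsPi1 U) :
    ∃ υ, IsStagePi U υ := by
  obtain ⟨ψ, h1, h2⟩ := h.exists_stages
  let σ : Option (Fin 1) ⊕ Fin 0 → arith.Term (Fin 2 ⊕ Fin 0) :=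
    Sum.elim (fun o => Term.var (Sum.inl (o.elim 1 Fin.castSucc))) Fin.elim0
  have key : ∀ (M : PAModel) (t w : M), Formula.Realize (KolmPA.bs σ ψ) ![t, w] ↔
      ψ.Realize (withStage w ![t]) default := by
    intro M t w
    rw [Formula.Realize, realize_bs]
    have e1 : (fun a => (σ (Sum.inl a)).realize (Sum.elim ![t, w] default)) =
        withStage w ![t] := by
      funext o
      rcases o with _ | i
      · rfl
      · rw [Fin.fin_one_eq_zero i]
        rfl
    rw [e1]
    exact iff_of_eq (congrArg _ (Subsingleton.elim _ _))
  refine ⟨KolmPA.bs σ ψ, h1.bs _, fun M t => ?_, fun M t w w' hw => ?_⟩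
  · simp only [key]
    exact (h2 M _ _).1
  · simp only [key]
    exact (h2 M _ _).2 _ _ hw

end Delta0

/-! ### Binary strings as numbers -/

section Strings

theorem foldl_bits_append (a : ℕ) (s : List Bool) (b : Bool) :
    (s ++ [b]).foldl (fun a b => 2 * a + b.toNat) a =
      2 * s.foldl (fun a b => 2 * a + b.toNat) a + b.toNat := by
  simp

theorem foldl_bits_bounds (s : List Bool) : ∀ a : ℕ,
    a * 2 ^ s.length ≤ s.foldl (fun a b => 2 * a + b.toNat) a ∧
      s.foldl (fun a b => 2 * a + b.toNat) a < (a + 1) * 2 ^ s.length := by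
  induction s with
  | nil => simp
  | cons b s ih =>
    intro a
    obtain ⟨h1, h2⟩ := ih (2 * a + b.toNat)
    have hb : b.toNat ≤ 1 := Bool.toNat_le b
    simp only [List.foldl_cons, List.length_cons, pow_succ]
    constructor
    · nlinarith [Nat.zero_le (b.toNat * 2 ^ s.length)]
    · nlinarith [Nat.mul_le_mul_right (2 ^ s.length) hb]

theorem code_add_one (s : List Bool) :
    code s + 1 = s.foldl (fun a b => 2 * a + b.toNat) 1 := by
  have h := (foldl_bits_bounds s 1).1
  have := Nat.one_le_two_pow (n := s.length)
  rw [code]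
  omega

theorem two_pow_length_le (s : List Bool) : 2 ^ s.length ≤ code s + 1 := by
  rw [code_add_one]
  simpa using (foldl_bits_bounds s 1).1

theorem code_lt_two_pow (s : List Bool) : code s + 1 < 2 ^ (s.length + 1) := by
  rw [code_add_one, pow_succ, mul_comm]
  simpa using (foldl_bits_bounds s 1).2

theorem length_lt_iff {s : List Bool} {n : ℕ} : s.length < n ↔ code s + 1 < 2 ^ n := by
  constructor
  · exact fun h => lt_of_lt_of_le (code_lt_two_pow s) (Nat.pow_le_pow_right (by norm_num) h)
  · exact fun h => (Nat.pow_lt_pow_iff_right (by norm_num)).1 ((two_pow_length_le s).trans_lt h)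

theorem length_eq_iff {s : List Bool} {n : ℕ} :
    s.length = n ↔ 2 ^ n ≤ code s + 1 ∧ code s + 1 < 2 ^ (n + 1) := by
  rw [← length_lt_iff, ← not_lt, ← length_lt_iff]
  omega

theorem exists_code_eq (N : ℕ) : ∃ s, code s = N := by
  induction N using Nat.strong_induction_on with
  | _ N ih =>
    rcases Nat.eq_zero_or_pos N with rfl | hN
    · exact ⟨[], rfl⟩
    -- Codes are shifted by one: removing the last binary digit of `N + 1` leaves the code of the
    -- shorter string plus one.
    · obtain ⟨s, hs⟩ := ih ((N + 1) / 2 - 1) (by omega)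
      have hs' := code_add_one s
      refine ⟨s ++ [decide ((N + 1) % 2 = 1)], ?_⟩
      rw [code, foldl_bits_append, ← hs', hs]
      rcases Nat.mod_two_eq_zero_or_one (N + 1) with h | h <;> simp [h] <;> omega

theorem foldl_bits_lt {s t : List Bool} (h : s.length = t.length) {a b : ℕ} (hab : a < b) :
    s.foldl (fun a b => 2 * a + b.toNat) a < t.foldl (fun a b => 2 * a + b.toNat) b := by
  refine lt_of_lt_of_le (foldl_bits_bounds s a).2 (le_trans ?_ (foldl_bits_bounds t b).1)
  rw [h]
  exact Nat.mul_le_mul_right _ hab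

theorem foldl_bits_lt_of_lt : ∀ {s t : List Bool}, s.length = t.length → s < t → ∀ a : ℕ,
    s.foldl (fun a b => 2 * a + b.toNat) a < t.foldl (fun a b => 2 * a + b.toNat) a
  | [], [], _, h, _ => absurd h (lt_irrefl _)
  | x :: s, y :: t, hl, h, a => by
    simp only [List.length_cons, Nat.succ.injEq] at hl
    rw [List.cons_lt_cons_iff] at h
    simp only [List.foldl_cons]
    rcases h with h | ⟨rfl, h⟩
    · refine foldl_bits_lt hl ?_
      revert h
      cases x <;> cases y <;> simp
    · exact foldl_bits_lt_of_lt hl h _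

theorem code_lt_code_of_lt {s t : List Bool} (hl : s.length = t.length) (h : s < t) :
    code s < code t := by
  have := foldl_bits_lt_of_lt hl h 1
  rw [← code_add_one, ← code_add_one] at this
  omega

theorem code_injective : Function.Injective code := by
  intro s t h
  have hl : s.length = t.length := by
    rw [length_eq_iff, h, ← length_eq_iff]
  rcases lt_trichotomy s t with h' | h' | h'
  · exact absurd h (code_lt_code_of_lt hl h').ne
  · exact h'
  · exact absurd h.symm (code_lt_code_of_lt hl.symm h').ne

theorem le_iff_code_le {s t : List Bool} (hl : s.length = t.length) :
    s ≤ t ↔ code s ≤ code t := by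
  constructor
  · intro h
    rcases h.lt_or_eq with h | rfl
    exacts [(code_lt_code_of_lt hl h).le, le_rfl]
  · intro h
    by_contra! h'
    exact absurd (code_lt_code_of_lt hl.symm h') (not_lt.2 h)

end Strings

/-! ### Complexity -/

section Complexity

variable {D : arith.Formula (Fin 2)}

/-- Lengths are traded for inequalities `p + 1 < 2 ^ n`, which can also be read in nonstandard
models. -/
theorem le_complexity_iff {n : ℕ} {x : List Bool} : (n : ℕ∞) ≤ complexity D x ↔
    ∀ p : ℕ, p + 1 < 2 ^ n → ¬ D.Realize ![p, code x] := by
  simp only [complexity, le_iInf_iff, Nat.cast_le]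
  constructor
  · intro h p hp hD
    obtain ⟨s, rfl⟩ := exists_code_eq p
    exact absurd (h s hD) (not_le.2 (length_lt_iff.2 hp))
  · intro h p hD
    by_contra! hp
    exact h (code p) (length_lt_iff.1 hp) hD

theorem complexity_le_iff {n : ℕ} {x : List Bool} : complexity D x ≤ (n : ℕ∞) ↔
    ∃ p : ℕ, p + 1 < 2 ^ (n + 1) ∧ D.Realize ![p, code x] := by
  have h : complexity D x ≤ (n : ℕ∞) ↔ ¬ ((n + 1 : ℕ) : ℕ∞) ≤ complexity D x := by
    rw [not_le, Nat.cast_succ]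
    exact (ENat.lt_add_one_iff (ENat.natCast_ne_top n)).symm
  rw [h, le_complexity_iff]
  push Not
  rfl

theorem isFirstRandom_iff {n : ℕ} {r : List Bool} : IsFirstRandom D n r ↔
    (2 ^ n ≤ code r + 1 ∧ code r + 1 < 2 ^ (n + 1)) ∧
    (∀ p : ℕ, p + 1 < 2 ^ n → ¬ D.Realize ![p, code r]) ∧
    ∀ y < code r, 2 ^ n ≤ y + 1 → ∃ p : ℕ, p + 1 < 2 ^ n ∧ D.Realize ![p, y] := by
  rw [IsFirstRandom, le_complexity_iff, ← length_eq_iff, and_assoc]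
  refine and_congr_right fun hl => and_congr_right fun _ => ?_
  constructor
  · intro h y hy hny
    obtain ⟨s, rfl⟩ := exists_code_eq y
    by_contra! hno
    have hs : s.length = n := by
      rw [length_eq_iff] at hl ⊢
      exact ⟨hny, by omega⟩
    have := h s ⟨hs, le_complexity_iff.2 hno⟩
    rw [le_iff_code_le (hl.trans hs.symm)] at this
    omega
  · rintro h s ⟨hs, hr⟩
    rw [le_iff_code_le (hl.trans hs.symm)]
    by_contra! hlt
    obtain ⟨p, hp, hD⟩ := h _ hlt (length_eq_iff.1 hs).1
    exact le_complexity_iff.1 hr p hp hD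

theorem exists_isFirstRandom (hD : ∀ p x x' : ℕ, D.Realize ![p, x] → D.Realize ![p, x'] → x = x')
    (n : ℕ) : ∃ r, IsFirstRandom D n r := by
  classical
  have hex : ∃ y, (2 ^ n ≤ y + 1 ∧ y + 1 < 2 ^ (n + 1)) ∧
      ∀ p : ℕ, p + 1 < 2 ^ n → ¬ D.Realize ![p, y] := by
    by_contra! hno
    choose! f hf1 hf2 using hno
    -- Pigeonhole: there are `2 ^ n` strings of length `n` but only `2 ^ n - 1` shorter programs,
    -- and each program has at most one output.
    have hcard := Finset.card_le_card_of_injOn (s := Finset.Ico (2 ^ n - 1) (2 ^ (n + 1) - 1))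
      (t := Finset.range (2 ^ n - 1)) f (fun y hy => by
        rw [Finset.coe_Ico, Set.mem_Ico] at hy
        have := hf1 y ⟨by omega, by omega⟩
        rw [Finset.coe_range, Set.mem_Iio]
        omega) (fun y hy z hz hyz => by
        rw [Finset.coe_Ico, Set.mem_Ico] at hy hz
        have h1 := hf2 y ⟨by omega, by omega⟩
        have h2 := hf2 z ⟨by omega, by omega⟩
        rw [← hyz] at h2
        exact hD _ _ _ h1 h2)
    rw [Nat.card_Ico, Finset.card_range, pow_succ] at hcard
    have := Nat.one_le_two_pow (n := n)
    omega
  obtain ⟨r, hr⟩ := exists_code_eq (Nat.find hex)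
  have hspec := Nat.find_spec hex
  refine ⟨r, isFirstRandom_iff.2 ?_⟩
  rw [hr]
  refine ⟨hspec.1, hspec.2, fun y hy hny => ?_⟩
  have hmin := Nat.find_min hex hy
  by_contra! hno
  exact hmin ⟨⟨hny, by omega⟩, hno⟩

end Complexity

/-! ### The formulas of the statement in models of arithmetic -/

section Readings

/-- The standard model as a model of arithmetic. -/
noncomputable def stdModel : PAModel :=
  haveI := nat_models_PA
  Theory.ModelType.of PA ℕ

theorem vec_cast_two {M : PAModel} (a b : ℕ) :
    (![(a : M), (b : M)]) = fun i => ((![a, b] i : ℕ) : M) := by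
  funext i
  revert i
  rw [Fin.forall_fin_two]
  exact ⟨rfl, rfl⟩

theorem vec_cast_three {M : PAModel} (a b c : ℕ) :
    (![(a : M), (b : M), (c : M)]) = fun i => ((![a, b, c] i : ℕ) : M) := by
  funext i
  fin_cases i <;> rfl

theorem vec_realize_two {M : Type} [arith.Structure M] {α : Type} (s t : arith.Term α) (v : α → M) :
    (fun i => Term.realize v (![s, t] i)) = ![s.realize v, t.realize v] := by
  funext i
  fin_cases i <;> rfl

theorem const_eq_vec {M : Type} (a : M) : (fun _ : Fin 1 => a) = ![a] := by
  funext i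
  fin_cases i
  rfl

theorem vec_realize_three {M : Type} [arith.Structure M] {α : Type} (s t u : arith.Term α)
    (v : α → M) : (fun i => Term.realize v (![s, t, u] i)) =
      ![s.realize v, t.realize v, u.realize v] := by
  funext i
  fin_cases i <;> rfl

theorem vec_realize_six {M : Type} [arith.Structure M] {α : Type} (s t u a b c : arith.Term α)
    (v : α → M) : (fun i => Term.realize v (![s, t, u, a, b, c] i)) =
      ![s.realize v, t.realize v, u.realize v, a.realize v, b.realize v, c.realize v] := by
  funext i
  fin_cases i <;> rfl

theorem IsStageSigma.realize_cast {D : arith.Formula (Fin 2)} {δ : arith.Formula (Fin 3)}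
    (h : IsStageSigma D δ) {M : PAModel} (p x w : ℕ) :
    δ.Realize ![(p : M), (x : M), (w : M)] ↔ δ.Realize ![p, x, w] := by
  rw [vec_cast_three, h.delta0.realize_formula_cast]

theorem IsStageSigma.realize_nat {D : arith.Formula (Fin 2)} {δ : arith.Formula (Fin 3)}
    (h : IsStageSigma D δ) (p x : ℕ) :
    D.Realize ![p, x] ↔ ∃ w : ℕ, δ.Realize ![p, x, w] := h.realize stdModel p x

theorem IsStagePi.realize_cast {U : arith.Formula (Fin 1)} {υ : arith.Formula (Fin 2)}
    (h : IsStagePi U υ) {M : PAModel} (t w : ℕ) :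
    υ.Realize ![(t : M), (w : M)] ↔ υ.Realize ![t, w] := by
  rw [vec_cast_two, h.delta0.realize_formula_cast]

theorem IsStagePi.realize_nat {U : arith.Formula (Fin 1)} {υ : arith.Formula (Fin 2)}
    (h : IsStagePi U υ) (t : ℕ) :
    U.Realize ![t] ↔ ∀ w : ℕ, υ.Realize ![t, w] := h.realize stdModel t

theorem IsSigma1.realize_cast {D : arith.Formula (Fin 2)} (hD : IsSigma1 D) {M : PAModel} {p x : ℕ}
    (h : D.Realize ![p, x]) : D.Realize ![(p : M), (x : M)] := by
  obtain ⟨δ, hδ⟩ := hD.exists_isStageSigma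
  obtain ⟨w, hw⟩ := (hδ.realize_nat p x).1 h
  exact (hδ.realize M p x).2 ⟨w, hδ.realize_cast p x w |>.2 hw⟩

/-- The bridge from provability to truth in models; all later comparisons of theories take place in
models. -/
theorem proves_iff {T : arith.Theory} (hT : PA ⊆ T) {φ : arith.Sentence} :
    Proves T φ ↔ ∀ M : PAModel, M ⊨ T → M ⊨ φ := by
  constructor
  · exact fun h M hM => h.sound M hM
  · refine fun h => Proves.complete fun M _ _ hM => ?_
    have : M ⊨ PA := hM.mono hT
    exact h (Theory.ModelType.of PA M) hM

theorem proves_PA_iff {φ : arith.Sentence} : Proves PA φ ↔ ∀ M : PAModel, M ⊨ φ := by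
  rw [proves_iff subset_rfl]
  exact forall_congr' fun M => ⟨fun h => h M.is_model, fun h _ => h⟩

theorem proves_functional_iff {D : arith.Formula (Fin 2)} :
    Proves PA (∀' ∀' ∀' (app D ![&0, &1] ⟹ app D ![&0, &2] ⟹ (&1 =' &2))) ↔
    ∀ (M : PAModel) (p x x' : M), D.Realize ![p, x] → D.Realize ![p, x'] → x = x' := by
  rw [proves_PA_iff]
  refine forall_congr' fun M => ?_
  simp [Sentence.Realize, Formula.Realize, realize_app, vec_realize_two, Fin.snoc]

theorem IsInterpreter.functional {D : arith.Formula (Fin 2)} (hD : IsInterpreter D) (M : PAModel)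
    (p x x' : M) : D.Realize ![p, x] → D.Realize ![p, x'] → x = x' :=
  proves_functional_iff.1 hD.2 M p x x'

theorem realize_powTwo {M : PAModel} (x : M) : powTwo.Realize ![x] ↔
    ∀ d : M, (∃ e, d * e = x) → d = 1 ∨ ∃ a, d = a + a := by
  simp [powTwo, Formula.Realize, Fin.snoc, realize_mulT, realize_addT, PAModel.realize_numeral]

/-- Both factors of a divisor pair of `2 ^ k` are at most `2 ^ k`, hence standard, so ordinary
arithmetic decides. -/
theorem realize_powTwo_two_pow {M : PAModel} (k : ℕ) : powTwo.Realize ![((2 ^ k : ℕ) : M)] := by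
  rw [realize_powTwo]
  rintro d ⟨e, hde⟩
  have hne : d * e ≠ 0 := by
    rw [hde]
    exact_mod_cast (Nat.two_pow_pos k).ne'
  have hone : ∀ a : M, a ≠ 0 → 1 ≤ a := fun a ha =>
    PAModel.lt_add_one_iff'.1 (lt_add_of_pos_left 1 (pos_iff_ne_zero.2 ha))
  have hd := hone d (left_ne_zero_of_mul hne)
  have he := hone e (right_ne_zero_of_mul hne)
  have hd' : d < ((2 ^ k + 1 : ℕ) : M) := by
    rw [Nat.cast_succ, ← hde]
    exact PAModel.lt_add_one_iff'.2 (le_mul_of_one_le_right (zero_le (a := d)) he)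
  have he' : e < ((2 ^ k + 1 : ℕ) : M) := by
    rw [Nat.cast_succ, ← hde]
    exact PAModel.lt_add_one_iff'.2 (le_mul_of_one_le_left (zero_le (a := e)) hd)
  obtain ⟨a, -, rfl⟩ := PAModel.exists_cast_of_lt hd'
  obtain ⟨b, -, rfl⟩ := PAModel.exists_cast_of_lt he'
  have hab : a * b = 2 ^ k := by exact_mod_cast hde
  obtain ⟨j, -, rfl⟩ := (Nat.dvd_prime_pow Nat.prime_two).1 (Dvd.intro b hab)
  rcases j with _ | j
  · exact .inl (by norm_num)
  · exact .inr ⟨((2 ^ j : ℕ) : M), by rw [← Nat.cast_add, pow_succ, mul_two]⟩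

theorem realize_lenLe {M : PAModel} (c : ℕ) (p q : M) : (lenLe c).Realize ![p, q] ↔
    ∀ u : M, powTwo.Realize ![u] → q + 1 < u → p + 1 < ((2 ^ c : ℕ) : M) * u := by
  simp [lenLe, Formula.Realize, Fin.snoc, realize_mulT, realize_succT, PAModel.realize_numeral,
    realize_ltF, realize_app, PAModel.sSucc_eq, const_eq_vec]

/-- For a standard `q` the single instance `u = 2 ^ l` suffices; it bounds `p` by a standard number,
so `p` is standard too. -/
theorem lt_of_realize_lenLe {M : PAModel} {c l q : ℕ} {p : M} (h : (lenLe c).Realize ![p, (q : M)])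
    (hq : q + 1 < 2 ^ l) : p + 1 < ((2 ^ (c + l) : ℕ) : M) := by
  have := (realize_lenLe c p q).1 h _ (realize_powTwo_two_pow l) (by exact_mod_cast hq)
  rw [pow_add]
  exact_mod_cast this

theorem realize_domination {M : PAModel} (D D' : arith.Formula (Fin 2)) (c : ℕ) :
    M ⊨ domination D D' c ↔ ∀ x q : M, D'.Realize ![q, x] →
      ∃ p, (lenLe c).Realize ![p, q] ∧ D.Realize ![p, x] := by
  simp [domination, Sentence.Realize, Formula.Realize, Fin.snoc, realize_app, vec_realize_two]

theorem realize_geF {M : PAModel} (D : arith.Formula (Fin 2)) (n : ℕ) (x : M) :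
    (geF D n).Realize ![x] ↔ ∀ p : ℕ, p + 1 < 2 ^ n → ¬ D.Realize ![(p : M), x] := by
  have h : (geF D n).Realize ![x] ↔ ∀ p : M, p < ((2 ^ n - 1 : ℕ) : M) → ¬ D.Realize ![p, x] := by
    simp [geF, Formula.Realize, Fin.snoc, realize_app, vec_realize_two, realize_ltF,
      PAModel.realize_numeral]
  rw [h]
  constructor
  · exact fun h p hp => h p (Nat.cast_lt.2 (by omega))
  · intro h p hp
    obtain ⟨p, hp, rfl⟩ := PAModel.exists_cast_of_lt hp
    exact h p (by omega)

theorem realize_eqF {M : PAModel} (D : arith.Formula (Fin 2)) (n : ℕ) (x : M) :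
    (eqF D n).Realize ![x] ↔ (∃ p : ℕ, p + 1 < 2 ^ (n + 1) ∧ D.Realize ![(p : M), x]) ∧
      (geF D n).Realize ![x] := by
  have h : (eqF D n).Realize ![x] ↔
      (∃ p : M, p < ((2 ^ (n + 1) - 1 : ℕ) : M) ∧ D.Realize ![p, x]) ∧
      (geF D n).Realize ![x] := by
    simp [eqF, Formula.Realize, Fin.snoc, realize_app, vec_realize_two, realize_ltF,
      PAModel.realize_numeral]
  rw [h]
  refine and_congr_left fun _ => ?_
  constructor
  · rintro ⟨p, hp, hD⟩
    obtain ⟨p, hp, rfl⟩ := PAModel.exists_cast_of_lt hp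
    exact ⟨p, by omega, hD⟩
  · rintro ⟨p, hp, hD⟩
    exact ⟨p, Nat.cast_lt.2 (by omega), hD⟩

theorem realize_notIn {M : PAModel} (l : List (List Bool)) (x : M) :
    (notIn l).Realize ![x] ↔ ∀ s ∈ l, x ≠ code s := by
  induction l with
  | nil => simp [notIn]
  | cons s l ih =>
    simp only [notIn, Formula.realize_inf, ih, List.mem_cons, forall_eq_or_imp]
    refine and_congr_left fun _ => ?_
    simp [Formula.realize_equal, Formula.realize_not, strT, PAModel.realize_numeral]

theorem realize_othersGt {M : PAModel} (D : arith.Formula (Fin 2)) (l : List (List Bool)) (n : ℕ) :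
    M ⊨ othersGt D l n ↔ ∀ x : M, (∀ s ∈ l, x ≠ code s) → (geF D (n + 1)).Realize ![x] := by
  rw [othersGt, realize_close]
  constructor
  · exact fun h x hx => Formula.realize_imp.1 (h ![x]) ((realize_notIn l x).2 hx)
  · intro h p
    rw [show p = ![p 0] from funext fun i => by rw [Fin.fin_one_eq_zero i]; rfl,
      Formula.realize_imp, realize_notIn]
    exact h _

end Readings

/-! ### Powers of two by a bounded formula -/

section PowTwo

/-- A bounded formula defining the powers of two. -/
def powTwoB : arith.Formula (Fin 1) :=
  ltF zeroT (Term.var (Sum.inl 0)) ⊓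
  ballF (succT (Term.var (Sum.inl 0)))
    (bexF (succT (Term.var (Sum.inl 0))) (mulT (&0) (&1) =' Term.var (Sum.inl 0)) ⟹
      ((&0 =' succT zeroT) ⊔ bexF (&0) (&0 =' addT (&1) (&1))))

theorem isDelta0_powTwoB : IsDelta0 powTwoB :=
  .inf (.ltF _ _) (.ballF (.imp (.bexF (.bdEqual _ _)) (.sup (.bdEqual _ _) (.bexF (.bdEqual _ _)))))

/-- A positive number that is not a power of two has an odd prime divisor, which is neither `1` nor
even. -/
theorem realize_powTwoB_nat (x : ℕ) : powTwoB.Realize ![x] ↔ ∃ k, x = 2 ^ k := by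
  have h : powTwoB.Realize ![x] ↔ 0 < x ∧ ∀ d < x + 1, (∃ e < x + 1, d * e = x) →
      d = 1 ∨ ∃ a < d, d = a + a := by
    simp [powTwoB, Formula.Realize, Fin.snoc, realize_mulT, realize_addT, realize_succT,
      realize_zeroT, realize_ltF]
  rw [h]
  constructor
  · rintro ⟨hx, h⟩
    rcases Nat.eq_two_pow_or_exists_odd_prime_and_dvd x with ⟨k, hk⟩ | ⟨p, hp, ⟨e, he⟩, hodd⟩
    · exact ⟨k, hk⟩
    · have h1 := Nat.le_of_dvd hx ⟨e, he⟩
      have h2 := Nat.le_of_dvd hx (Dvd.intro_left p he.symm)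
      rcases h p (by omega) ⟨e, by omega, he.symm⟩ with rfl | ⟨a, -, rfl⟩
      · exact absurd hp Nat.not_prime_one
      · obtain ⟨b, hb⟩ := hodd
        omega
  · rintro ⟨k, rfl⟩
    refine ⟨Nat.two_pow_pos k, fun d _ => ?_⟩
    rintro ⟨e, -, he⟩
    obtain ⟨j, -, rfl⟩ := (Nat.dvd_prime_pow Nat.prime_two).1 (Dvd.intro e he)
    rcases j with _ | j
    · exact .inl rfl
    · exact .inr ⟨2 ^ j, Nat.pow_lt_pow_right (by norm_num) (by omega), by rw [pow_succ, mul_two]⟩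

theorem realize_powTwoB_cast {M : PAModel} (x : ℕ) :
    powTwoB.Realize ![(x : M)] ↔ ∃ k, x = 2 ^ k := by
  rw [← realize_powTwoB_nat, ← isDelta0_powTwoB.realize_formula_cast (M := M)]
  exact iff_of_eq (congrArg _ (funext fun i => by rw [Fin.fin_one_eq_zero i]; rfl))

end PowTwo

/-! ### The last halting program -/

section LastHalting

variable (δ : arith.Formula (Fin 3)) (υ : arith.Formula (Fin 2))

/-- "The program `p` halts before stage `w`." -/
def haltsF : arith.Formula (Fin 2) :=
  bexF (Term.var (Sum.inl 1)) (app δ ![Term.var (Sum.inl 0), &0, Term.var (Sum.inl 1)])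

/-- "Before stage `v`, no program `q` with `q + 1 < s` halts later than `p`", where `p + 1 = s`
means that none of them halts at all. -/
def lastF : arith.Formula (Fin 3) :=
  ballF (Term.var (Sum.inl 2)) (ballF (Term.var (Sum.inl 0))
    (ltF (succT (&1)) (Term.var (Sum.inl 0)) ⟹
      (((succT (Term.var (Sum.inl 1)) =' Term.var (Sum.inl 0)) ⊔
        app (haltsF δ) ![Term.var (Sum.inl 1), &0]) ⟹
      (app (haltsF δ) ![&1, Term.var (Sum.inl 2)] ⟹ app (haltsF δ) ![&1, &0]))))

/-- The formula `lastF` at the pair `(s, p)` encoded by `y = s + p - 1`, with `s` a power of two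
and `p < s`. -/
def decodedLastF : arith.Formula (Fin 2) :=
  ballF (succT (succT (Term.var (Sum.inl 0)))) (ballF (&0)
    (app powTwoB ![&0] ⟹ ((succT (Term.var (Sum.inl 0)) =' addT (&0) (&1)) ⟹
      app (lastF δ) ![&0, &1, Term.var (Sum.inl 1)])))

/-- A `Π₁`-formula that is `U` at the even numbers and `decodedLastF` at the odd numbers. -/
def joinF : arith.Formula (Fin 1) :=
  ∀' (ballF (succT (Term.var (Sum.inl 0)))
      ((Term.var (Sum.inl 0) =' addT (&1) (&1)) ⟹ app υ ![&1, &0]) ⊓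
    ballF (succT (Term.var (Sum.inl 0)))
      ((Term.var (Sum.inl 0) =' succT (addT (&1) (&1))) ⟹ app (decodedLastF δ) ![&1, &0]))

variable {δ υ}

theorem isDelta0_haltsF (hδ : IsDelta0 δ) : IsDelta0 (haltsF δ) := .bexF (hδ.app _)

theorem isDelta0_lastF (hδ : IsDelta0 δ) : IsDelta0 (lastF δ) :=
  .ballF (.ballF (.imp (.ltF _ _) (.imp (.sup (.bdEqual _ _) ((isDelta0_haltsF hδ).app _))
    (.imp ((isDelta0_haltsF hδ).app _) ((isDelta0_haltsF hδ).app _)))))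

theorem isDelta0_decodedLastF (hδ : IsDelta0 δ) : IsDelta0 (decodedLastF δ) :=
  .ballF (.ballF (.imp (isDelta0_powTwoB.app _) (.imp (.bdEqual _ _) ((isDelta0_lastF hδ).app _))))

theorem isPi1_joinF (hδ : IsDelta0 δ) (hυ : IsDelta0 υ) : IsPi1 (joinF δ υ) :=
  .all (.of_delta0 (.inf (.ballF (.imp (.bdEqual _ _) (hυ.app _)))
    (.ballF (.imp (.bdEqual _ _) ((isDelta0_decodedLastF hδ).app _)))))

section Realize

variable {M : Type} [arith.Structure M]

theorem realize_haltsF (p w : M) :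
    (haltsF δ).Realize ![p, w] ↔ ∃ x, sLt x w ∧ δ.Realize ![p, x, w] := by
  simp [haltsF, Formula.Realize, Fin.snoc, realize_app, vec_realize_three]

theorem realize_lastF (s p v : M) : (lastF δ).Realize ![s, p, v] ↔
    ∀ w, sLt w v → ∀ q, sLt q s → sLt (sSucc q) s →
      (sSucc p = s ∨ (haltsF δ).Realize ![p, w]) → (haltsF δ).Realize ![q, v] →
      (haltsF δ).Realize ![q, w] := by
  simp [lastF, Formula.Realize, Fin.snoc, realize_app, vec_realize_two, realize_ltF,
    realize_succT]

theorem realize_decodedLastF (y v : M) : (decodedLastF δ).Realize ![y, v] ↔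
    ∀ s, sLt s (sSucc (sSucc y)) → ∀ p, sLt p s → powTwoB.Realize ![s] → sSucc y = sAdd s p →
      (lastF δ).Realize ![s, p, v] := by
  simp [decodedLastF, Formula.Realize, Fin.snoc, realize_app, vec_realize_three, const_eq_vec,
    realize_succT, realize_addT]

theorem realize_joinF (x : M) : (joinF δ υ).Realize ![x] ↔
    ∀ v, (∀ y, sLt y (sSucc x) → x = sAdd y y → υ.Realize ![y, v]) ∧
      (∀ y, sLt y (sSucc x) → x = sSucc (sAdd y y) → (decodedLastF δ).Realize ![y, v]) := by
  simp [joinF, Formula.Realize, Fin.snoc, realize_app, vec_realize_two,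
    realize_succT, realize_addT]

end Realize

/-- The bound `y ≤ x` makes `y` standard in every model, so parity selects the branch: the odd one
is vacuous and the even one forces `y = t`. -/
theorem realize_joinF_two_mul {U : arith.Formula (Fin 1)} (hυ : IsStagePi U υ) {M : PAModel}
    (t : ℕ) : (joinF δ υ).Realize ![((2 * t : ℕ) : M)] ↔ U.Realize ![(t : M)] := by
  rw [realize_joinF, hυ.realize]
  simp only [PAModel.sLt_iff, PAModel.sSucc_eq, PAModel.sAdd_eq]
  refine forall_congr' fun v => ⟨fun h => ?_, fun h => ⟨?_, ?_⟩⟩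
  · refine h.1 t ?_ (by push_cast; ring)
    exact_mod_cast (by omega : t < 2 * t + 1)
  · intro y hy hty
    obtain ⟨y, -, rfl⟩ := PAModel.exists_cast_of_lt (n := 2 * t + 1) (by exact_mod_cast hy)
    have : 2 * t = y + y := by exact_mod_cast hty
    obtain rfl : t = y := by omega
    exact h
  · intro y hy hty
    obtain ⟨y, -, rfl⟩ := PAModel.exists_cast_of_lt (n := 2 * t + 1) (by exact_mod_cast hy)
    have : 2 * t = y + y + 1 := by exact_mod_cast hty
    omega

/-- Among the finitely many programs `q` with `q + 1 < N` that halt, `p` maximizes the first halting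
time. If none halts, the marker `p = N - 1`, which is not itself one of these programs, makes the
claim vacuous. -/
theorem exists_last_halting {H : ℕ → ℕ → Prop} (hH : ∀ p w w', w ≤ w' → H p w → H p w') {N : ℕ}
    (hN : 0 < N) : ∃ p < N, (p + 1 = N ∨ ∃ w, H p w) ∧
      ∀ w v q, q + 1 < N → (p + 1 = N ∨ H p w) → H q v → H q w := by
  classical
  by_cases hex : ∃ q, q + 1 < N ∧ ∃ w, H q w
  · have hne : ((Finset.range (N - 1)).filter fun q => ∃ w, H q w).Nonempty := by
      obtain ⟨q, hq, hw⟩ := hex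
      exact ⟨q, by simp only [Finset.mem_filter, Finset.mem_range]; exact ⟨by omega, hw⟩⟩
    obtain ⟨p, hp, hmax⟩ := Finset.exists_max_image _
      -- The default `0` is never used, since the maximum is taken over halting programs.
      (fun q => if h : ∃ w, H q w then Nat.find h else 0) hne
    simp only [Finset.mem_filter, Finset.mem_range] at hp hmax
    refine ⟨p, by omega, .inr hp.2, fun w v q hq hpw hqv => ?_⟩
    have hpw' : H p w := hpw.resolve_left (by omega)
    have h1 := hmax q ⟨by omega, v, hqv⟩
    rw [dif_pos ⟨v, hqv⟩, dif_pos hp.2] at h1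
    exact hH q _ _ (h1.trans (Nat.find_min' hp.2 hpw')) (Nat.find_spec (⟨v, hqv⟩ : ∃ w, H q w))
  · push Not at hex
    exact ⟨N - 1, by omega, .inl (by omega), fun w v q hq _ h => (hex q hq v h).elim⟩

theorem haltsF_mono_nat {D : arith.Formula (Fin 2)} (hδ : IsStageSigma D δ) (p w w' : ℕ)
    (hw : w ≤ w') (h : (haltsF δ).Realize ![p, w]) : (haltsF δ).Realize ![p, w'] := by
  rw [realize_haltsF] at *
  simp only [sLt_nat] at *
  obtain ⟨x, hx, h⟩ := h
  -- The order of a model of PA is by definition "`<` or `=`", also for `stdModel`.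
  exact ⟨x, by omega, hδ.mono stdModel p x w w' hw.lt_or_eq h⟩

theorem realize_haltsF_cast (hδ : IsDelta0 δ) {M : PAModel} (p w : ℕ) :
    (haltsF δ).Realize ![(p : M), (w : M)] ↔ (haltsF δ).Realize ![p, w] := by
  rw [vec_cast_two, (isDelta0_haltsF hδ).realize_formula_cast]

/-- Some true instance of `joinF` of length `n + 2` determines the outputs of all programs of
length at most `n`. -/
theorem exists_joinF_determines {D : arith.Formula (Fin 2)} (hD : IsInterpreter D)
    (hδ : IsStageSigma D δ) (n : ℕ) : ∃ z : ℕ, z + 1 < 2 ^ (n + 3) ∧ (joinF δ υ).Realize ![z] ∧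
      ∀ M : PAModel, (joinF δ υ).Realize ![(z : M)] → ∀ q : ℕ, q + 1 < 2 ^ (n + 1) → ∀ x : M,
        D.Realize ![(q : M), x] → ∃ x' : ℕ, x = x' ∧ D.Realize ![q, x'] := by
  obtain ⟨p, hpN, hp, hlast⟩ := exists_last_halting (H := fun p w => (haltsF δ).Realize ![p, w])
    (haltsF_mono_nat hδ) (Nat.two_pow_pos (n + 1))
  have hpos := Nat.two_pow_pos (n + 1)
  -- The odd number `2 y + 1` selects the second branch of `joinF`, at `y + 1 = s + p` with `s = 2 ^
  -- (n + 1)`. The length bound follows from `2 (s + p) < 4 s`.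
  refine ⟨2 * (2 ^ (n + 1) - 1 + p) + 1, ?_, ?_, ?_⟩
  · rw [pow_succ 2 (n + 2), pow_succ 2 (n + 1)]
    omega
  · rw [realize_joinF]
    simp only [sLt_nat, sSucc_nat, sAdd_nat]
    refine fun v => ⟨fun y _ hy => by omega, fun y _ hy => ?_⟩
    rw [realize_decodedLastF]
    simp only [sLt_nat, sSucc_nat, sAdd_nat, realize_powTwoB_nat]
    rintro s - p' hp' ⟨k, rfl⟩ hyp
    -- The pair is recovered from the sum: since `p < s`, the number `s + p` lies in `[s, 2 s)`,
    -- which contains only one power of two.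
    have hk : k = n + 1 := by
      have h1 : 2 ^ k < 2 ^ (n + 1 + 1) := by rw [pow_succ 2 (n + 1)]; omega
      have h2 : 2 ^ (n + 1) < 2 ^ (k + 1) := by rw [pow_succ]; omega
      rw [Nat.pow_lt_pow_iff_right (by norm_num)] at h1 h2
      omega
    subst hk
    obtain rfl : p' = p := by omega
    rw [realize_lastF]
    simp only [sLt_nat, sSucc_nat]
    exact fun w _ q _ hq h h' => hlast w v q hq h h'
  · intro M hM q hq x hx
    rw [realize_joinF] at hM
    simp only [PAModel.sLt_iff, PAModel.sSucc_eq, PAModel.sAdd_eq] at hM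
    -- This stage `w` is standard: the true halting time of `p`, or any number if `p` is the marker.
    obtain ⟨w, hw⟩ : ∃ w, p + 1 = 2 ^ (n + 1) ∨ (haltsF δ).Realize ![p, w] := by
      rcases hp with hp | ⟨w, hw⟩
      exacts [⟨0, .inl hp⟩, ⟨w, .inr hw⟩]
    obtain ⟨v, hv⟩ := (hδ.realize M q x).1 hx
    -- The stage in `M` must reach the witness `v` for `D(q, x)`, exceed the output `x` as `haltsF`
    -- demands, and exceed `w` so that `w` is among the compared stages.
    have hM' := (hM (max v (max (x + 1) (w + 1)))).2 ((2 ^ (n + 1) - 1 + p : ℕ) : M)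
      (by exact_mod_cast (by omega)) (by push_cast; ring)
    rw [realize_decodedLastF] at hM'
    simp only [PAModel.sLt_iff, PAModel.sSucc_eq, PAModel.sAdd_eq] at hM'
    have hM'' := hM' ((2 ^ (n + 1) : ℕ) : M) (by exact_mod_cast (by omega)) (p : M)
      (by exact_mod_cast hpN) ((realize_powTwoB_cast _).2 ⟨_, rfl⟩)
      (by exact_mod_cast (by omega))
    rw [realize_lastF] at hM''
    simp only [PAModel.sLt_iff, PAModel.sSucc_eq] at hM''
    have hq' := hM'' (w : M)
      ((lt_add_one _).trans_le ((le_max_right _ _).trans (le_max_right _ _))) (q : M)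
      (by exact_mod_cast (by omega)) (by exact_mod_cast hq)
      (hw.imp (fun h => by exact_mod_cast h) fun h => (realize_haltsF_cast hδ.delta0 p w).2 h)
      ((realize_haltsF _ _).2 ⟨x, (PAModel.sLt_iff _ _).2
        ((lt_add_one x).trans_le ((le_max_left _ _).trans (le_max_right _ _))),
        hδ.mono M _ _ _ _ (le_max_left _ _) hv⟩)
    -- Now `q` halts in `M` by the standard stage `w`, so by absoluteness it really halts. Provable
    -- functionality identifies the two outputs.
    rw [realize_haltsF_cast hδ.delta0, realize_haltsF] at hq'
    obtain ⟨x', -, hx'⟩ := hq'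
    have hx'' := (hδ.realize_nat q x').2 ⟨w, hx'⟩
    exact ⟨x', hD.functional M _ _ _ hx (hD.1.realize_cast hx''), hx''⟩

end LastHalting

/-! ### From `Π₁`-statements to complexities -/

section Comparison

theorem theoryLE_of_models {T S : arith.Theory} (hT : PA ⊆ T) (hS : PA ⊆ S)
    (h : ∀ M : PAModel, M ⊨ S → M ⊨ T) : TheoryLE T S := fun _ hφ =>
  (proves_iff hS).2 fun M hM => (proves_iff hT).1 hφ M (h M hM)

theorem TheoryLE.trans {T S R : arith.Theory} (h : TheoryLE T S) (h' : TheoryLE S R) :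
    TheoryLE T R := fun φ hφ => h' φ (h φ hφ)

theorem PA_subset_theoryA (D : arith.Formula (Fin 2)) (n : ℕ) : PA ⊆ theoryA D n :=
  Set.subset_union_left

theorem PA_subset_theoryB (D : arith.Formula (Fin 2)) (n : ℕ) : PA ⊆ theoryB D n :=
  Set.subset_union_left.trans Set.subset_union_left

theorem PA_subset_theoryC (U : arith.Formula (Fin 1)) (n : ℕ) : PA ⊆ theoryC U n :=
  Set.subset_union_left

theorem theoryC_mono (U : arith.Formula (Fin 1)) {m n : ℕ} (h : m ≤ n) :
    TheoryLE (theoryC U m) (theoryC U n) := by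
  refine theoryLE_of_models (PA_subset_theoryC _ _) (PA_subset_theoryC _ _) fun M hM =>
    hM.mono (Set.union_subset_union_right _ ?_)
  exact fun φ hφ => ⟨hφ.1, hφ.2.trans (by exact_mod_cast h)⟩

theorem theoryA_models_iff {M : PAModel} {D : arith.Formula (Fin 2)} {I : Set ℕ} :
    M ⊨ PA ∪ randomAxioms D I ↔ ∀ n ∈ I, ∀ r, IsFirstRandom D n r →
      (geF D n).Realize ![((code r : ℕ) : M)] := by
  rw [Theory.model_union_iff, and_iff_right M.is_model, Theory.model_iff]
  constructor
  · intro h n hn r hr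
    exact (realize_atStr _ _).1 (h _ ⟨n, hn, r, hr, rfl⟩)
  · rintro h _ ⟨n, hn, r, hr, rfl⟩
    exact (realize_atStr _ _).2 (h n hn r hr)

/-- Each of the finitely many short programs has at most one output. Without such a list, `theoryB`
would contain no axiom about the remaining strings. -/
theorem finite_complexity_le {D : arith.Formula (Fin 2)} (hD : IsInterpreter D) (n : ℕ) :
    ∃ l : List (List Bool), l.Nodup ∧ ∀ x, x ∈ l ↔ complexity D x ≤ (n : ℕ∞) := by
  have hfin : {x | complexity D x ≤ (n : ℕ∞)}.Finite := by
    have hsub : Set.Finite {x : List Bool | ∃ p ∈ Finset.range (2 ^ (n + 1)),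
        D.Realize ![p, code x]} := by
      have : {x : List Bool | ∃ p ∈ Finset.range (2 ^ (n + 1)), D.Realize ![p, code x]} =
          ⋃ p ∈ Finset.range (2 ^ (n + 1)), {x | D.Realize ![p, code x]} := by
        ext x
        simp
      rw [this]
      refine Set.Finite.biUnion (Finset.finite_toSet _) fun p _ => Set.Subsingleton.finite ?_
      exact fun x hx y hy => code_injective (hD.functional stdModel p _ _ hx hy)
    refine hsub.subset fun x hx => ?_
    obtain ⟨p, hp, hpx⟩ := complexity_le_iff.1 hx
    exact ⟨p, Finset.mem_range.2 (by omega), hpx⟩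
  exact ⟨hfin.toFinset.toList, Finset.nodup_toList _, fun x => by simp⟩

theorem theoryA_le_theoryB {D : arith.Formula (Fin 2)} (hD : IsInterpreter D) (n : ℕ) :
    TheoryLE (theoryA D n) (theoryB D n) := by
  refine theoryLE_of_models (PA_subset_theoryA _ _) (PA_subset_theoryB _ _) fun M hM => ?_
  rw [theoryA, theoryA_models_iff]
  rintro m hm r hr
  obtain rfl : n = m := hm.symm
  have hM' := (Theory.model_iff _).1 hM
  by_cases hle : complexity D r ≤ (n : ℕ∞)
  · have heq : complexity D r = (n : ℕ∞) := le_antisymm hle hr.1.2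
    have := (realize_atStr _ _).1 (hM' _ (.inl (.inr ⟨r, n, le_rfl, heq, rfl⟩)))
    exact ((realize_eqF _ _ _).1 this).2
  · obtain ⟨l, hl, hmem⟩ := finite_complexity_le hD n
    have := (realize_othersGt _ _ _).1 (hM' _ (.inr ⟨l, hl, hmem, rfl⟩)) (code r) (fun s hs h => by
      have h : code r = code s := by exact_mod_cast h
      rw [code_injective h, ← hmem] at hle
      exact hle hs)
    rw [realize_geF] at this ⊢
    refine fun p hp => this p (hp.trans_le (Nat.pow_le_pow_right (by norm_num) (by omega)))

/-- The axioms of `B_n` speak only of outputs of programs of length at most `n`. True outputs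
persist in `M` because `D` is `Σ₁`, and the hypothesis says that `M` adds no new ones. -/
theorem models_theoryB {D : arith.Formula (Fin 2)} (hD : IsInterpreter D) {M : PAModel} {n : ℕ}
    (h : ∀ q : ℕ, q + 1 < 2 ^ (n + 1) → ∀ x : M, D.Realize ![(q : M), x] →
      ∃ x' : ℕ, x = x' ∧ D.Realize ![q, x']) : M ⊨ theoryB D n := by
  rw [theoryB, Theory.model_union_iff, Theory.model_union_iff, and_iff_right M.is_model,
    Theory.model_iff, Theory.model_iff]
  constructor
  · rintro _ ⟨x, k, hk, hx, rfl⟩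
    rw [realize_atStr, realize_eqF, realize_geF]
    constructor
    · obtain ⟨p, hp, hpx⟩ := complexity_le_iff.1 hx.le
      exact ⟨p, hp, hD.1.realize_cast hpx⟩
    · intro p hp hpx
      obtain ⟨x', hx', hpx'⟩ := h p
        (hp.trans_le (Nat.pow_le_pow_right (by norm_num) (by omega))) _ hpx
      have : code x = x' := by exact_mod_cast hx'
      rw [← this] at hpx'
      exact le_complexity_iff.1 hx.ge p hp hpx'
  · rintro _ ⟨l, hl, hmem, rfl⟩
    rw [realize_othersGt]
    intro x hx
    rw [realize_geF]
    intro p hp hpx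
    obtain ⟨x', rfl, hpx'⟩ := h p hp x hpx
    obtain ⟨s, rfl⟩ := exists_code_eq x'
    exact hx s ((hmem s).2 (complexity_le_iff.2 ⟨p, hp, hpx'⟩)) rfl

theorem realize_iff_atStr {M : PAModel} {T : arith.Sentence} {U : arith.Formula (Fin 1)}
    {t : List Bool} (h : Proves PA (T ⇔ atStr U t)) :
    M ⊨ T ↔ U.Realize ![((code t : ℕ) : M)] := by
  rw [← realize_atStr]
  exact (Sentence.realize_iff M).1 (proves_PA_iff.1 h M)

theorem isUniversalPi1_joinF {δ : arith.Formula (Fin 3)} {υ : arith.Formula (Fin 2)}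
    (hδ : IsDelta0 δ) {U : arith.Formula (Fin 1)} (hU : IsUniversalPi1 U) (hυ : IsStagePi U υ) :
    IsUniversalPi1 (joinF δ υ) := by
  refine ⟨isPi1_joinF hδ hυ.delta0, fun T hT => ?_⟩
  obtain ⟨t, ht⟩ := hU.2 T hT
  obtain ⟨s, hs⟩ := exists_code_eq (2 * code t)
  refine ⟨s, proves_PA_iff.2 fun M => (Sentence.realize_iff M).2 ?_⟩
  rw [realize_atStr, hs, realize_joinF_two_mul hυ, realize_iff_atStr ht]

/-- Since `joinF` is universal through its even arguments, optimality of `U` costs only a constant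
`c` on its odd instances too. The further `2` is the overhead of the instance that names the last
halting program. -/
theorem theoryB_le_theoryC {D : arith.Formula (Fin 2)} (hD : IsInterpreter D)
    {U : arith.Formula (Fin 1)} (hU : IsOptimalPi1 U) :
    ∃ c : ℕ, ∀ n, TheoryLE (theoryB D n) (theoryC U (n + c)) := by
  obtain ⟨δ, hδ⟩ := hD.1.exists_isStageSigma
  obtain ⟨υ, hυ⟩ := hU.1.1.exists_isStagePi
  obtain ⟨c, hc⟩ := hU.2 _ (isUniversalPi1_joinF hδ.delta0 hU.1 hυ)
  refine ⟨c + 2, fun n => theoryLE_of_models (PA_subset_theoryB _ _) (PA_subset_theoryC _ _)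
    fun M hM => ?_⟩
  obtain ⟨z, hz, htrue, hdet⟩ := exists_joinF_determines (υ := υ) hD hδ n
  obtain ⟨s, rfl⟩ := exists_code_eq z
  have hpi : IsPi1 (atStr (joinF δ υ) s) := (isPi1_joinF hδ.delta0 hυ.delta0).atStr s
  have hlen : s.length ≤ n + 2 := Nat.lt_succ_iff.1 (length_lt_iff.2 hz)
  have hcomp : pi1Complexity U (atStr (joinF δ υ) s) ≤ ((n + (c + 2) : ℕ) : ℕ∞) := by
    refine (hc _ hpi).trans ?_
    have : pi1Complexity (joinF δ υ) (atStr (joinF δ υ) s) ≤ (s.length : ℕ∞) :=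
      iInf₂_le s (proves_PA_iff.2 fun M => (Sentence.realize_iff M).2 .rfl)
    refine (add_le_add_left this _).trans ?_
    exact_mod_cast (by omega : s.length + c ≤ n + (c + 2))
  have hmem := (Theory.model_iff _).1 hM (atStr (joinF δ υ) s)
    (.inr ⟨⟨hpi, (realize_atStr_nat _ _).2 htrue⟩, hcomp⟩)
  exact models_theoryB hD (hdet M ((realize_atStr _ _).1 hmem))

end Comparison

/-! ### Uniformization -/

section Uniformization

/-- The value `x` of the first stage-value pair `(v, x)`, `x < v`, with `ε(q, x, v)`. -/
def uniformF (ε : arith.Formula (Fin 3)) : arith.Formula (Fin 2) :=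
  ∃' (((ltF (Term.var (Sum.inl 1)) (&0) ⊓
      app ε ![Term.var (Sum.inl 0), Term.var (Sum.inl 1), &0]) ⊓
    ballF (&0) (ballF (&1) (∼(app ε ![Term.var (Sum.inl 0), &2, &1])))) ⊓
    ballF (Term.var (Sum.inl 1)) (∼(app ε ![Term.var (Sum.inl 0), &1, &0])))

variable {ε : arith.Formula (Fin 3)}

theorem isSigma1_uniformF (hε : IsDelta0 ε) : IsSigma1 (uniformF ε) :=
  .ex (.of_delta0 (.inf (.inf (.inf (.ltF _ _) (hε.app _)) (.ballF (.ballF (.not (hε.app _)))))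
    (.ballF (.not (hε.app _)))))

theorem realize_uniformF {M : PAModel} (q x : M) : (uniformF ε).Realize ![q, x] ↔
    ∃ v, ((x < v ∧ ε.Realize ![q, x, v]) ∧ ∀ v' < v, ∀ x' < v', ¬ ε.Realize ![q, x', v']) ∧
      ∀ x' < x, ¬ ε.Realize ![q, x', v] := by
  simp [uniformF, Formula.Realize, Fin.snoc, realize_app, vec_realize_three, realize_ltF]

/-- Two outputs share the first successful stage and then the least value there. This needs nothing
about `ε` beyond boundedness, so functionality is provable even when `ε` itself has many values. -/
theorem isInterpreter_uniformF (hε : IsDelta0 ε) : IsInterpreter (uniformF ε) := by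
  refine ⟨isSigma1_uniformF hε, proves_functional_iff.2 fun M q x x' h h' => ?_⟩
  rw [realize_uniformF] at h h'
  obtain ⟨v, ⟨⟨hx, hv⟩, hmin⟩, hminx⟩ := h
  obtain ⟨v', ⟨⟨hx', hv'⟩, hmin'⟩, hminx'⟩ := h'
  obtain rfl : v = v' := by
    rcases lt_trichotomy v v' with h | h | h
    exacts [(hmin' v h x hx hv).elim, h, (hmin v' h x' hx' hv').elim]
  rcases lt_trichotomy x x' with h | h | h
  exacts [(hminx' x h hv).elim, h, (hminx x' h hv').elim]

/-- The least number principle is applied to the stage and then to the value. The selected value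
need not be `x`, but it satisfies `ε` at some stage. -/
theorem exists_realize_uniformF {M : PAModel} {q x v : M} (hx : x < v)
    (hv : ε.Realize ![q, x, v]) :
    ∃ y w, (uniformF ε).Realize ![q, y] ∧ ε.Realize ![q, y, w] := by
  obtain ⟨w, ⟨y, hyw, hy⟩, hw⟩ := PAModel.exists_least (P := fun w : M => ∃ y < w, ε.Realize ![q, y, w])
    (k := 1) (bexF (Term.var (Sum.inl (Sum.inr 0)))
      (app ε ![Term.var (Sum.inl (Sum.inl 0)), &0, Term.var (Sum.inl (Sum.inr 0))])) ![q]
    (fun w => by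
      simp [Formula.Realize, Fin.snoc, realize_app, vec_realize_three]) ⟨v, x, hx, hv⟩
  obtain ⟨z, hz, hzmin⟩ := PAModel.exists_least (P := fun y : M => ε.Realize ![q, y, w])
    (k := 2) (app ε ![Term.var (Sum.inl (Sum.inl 0)), Term.var (Sum.inl (Sum.inr 0)),
      Term.var (Sum.inl (Sum.inl 1))]) ![q, w]
    (fun y => by
      simp [Formula.Realize, realize_app, vec_realize_three]) ⟨y, hy⟩
  have hzy : z ≤ y := by
    by_contra! h
    exact hzmin y h hy
  refine ⟨z, w, (realize_uniformF q z).2 ⟨w, ⟨⟨hzy.trans_lt hyw, hz⟩, ?_⟩, hzmin⟩, hz⟩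
  intro v' hv' x' hx' h
  exact hw v' hv' ⟨x', hx', h⟩

end Uniformization

/-! ### The interpreter that searches for refutations -/

section Search

variable (δ : arith.Formula (Fin 3)) (υ : arith.Formula (Fin 2))

/-- "Some program `p` with `p + 1 < m` outputs `x` before stage `v`", at `(x, v, m)`. -/
def outF : arith.Formula (Fin 3) :=
  bexF (Term.var (Sum.inl 2)) (ltF (succT (&0)) (Term.var (Sum.inl 2)) ⊓
    app δ ![&0, Term.var (Sum.inl 0), Term.var (Sum.inl 1)])

/-- "`x` is the first number with `m ≤ x + 1 < 2 m` that is not output before stage `v` by a program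
`p` with `p + 1 < m`", at `(x, v, m)`. -/
def firstMissingF : arith.Formula (Fin 3) :=
  ((ltF (Term.var (Sum.inl 2)) (succT (succT (Term.var (Sum.inl 0)))) ⊓
    ltF (succT (Term.var (Sum.inl 0))) (addT (Term.var (Sum.inl 2)) (Term.var (Sum.inl 2)))) ⊓
    ∼(app (outF δ) ![Term.var (Sum.inl 0), Term.var (Sum.inl 1), Term.var (Sum.inl 2)])) ⊓
  ballF (Term.var (Sum.inl 0)) (ltF (Term.var (Sum.inl 2)) (succT (succT (&0))) ⟹
    app (outF δ) ![&0, Term.var (Sum.inl 1), Term.var (Sum.inl 2)])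

/-- The matrix of `searchF`, at `(q, x, v, u, s, t)`. -/
def searchMatrixF : arith.Formula (Fin 6) :=
  (((app powTwoB ![Term.var (Sum.inl 3)] ⊓ app powTwoB ![Term.var (Sum.inl 4)]) ⊓
    (succT (Term.var (Sum.inl 0)) =' mulT (Term.var (Sum.inl 3))
      (succT (addT (addT (Term.var (Sum.inl 4)) (Term.var (Sum.inl 5)))
        (addT (Term.var (Sum.inl 4)) (Term.var (Sum.inl 5))))))) ⊓
    ∼(app υ ![Term.var (Sum.inl 5), Term.var (Sum.inl 2)])) ⊓
  app (firstMissingF δ) ![Term.var (Sum.inl 1), Term.var (Sum.inl 2),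
    mulT (mulT (Term.var (Sum.inl 3)) (Term.var (Sum.inl 3))) (Term.var (Sum.inl 4))]

/-- "`q + 1 = u (2 (s + t) + 1)`, where `u` and `s > t` are powers of two, `U(t)` is refuted
before stage `v`, and `x` is the first missing number at this stage for `m = u² s`",
at `(q, x, v)`. -/
def searchF : arith.Formula (Fin 3) :=
  bexF (succT (succT (Term.var (Sum.inl 0)))) (bexF (succT (succT (Term.var (Sum.inl 0))))
    (bexF (&1) (app (searchMatrixF δ υ) ![Term.var (Sum.inl 0), Term.var (Sum.inl 1),
      Term.var (Sum.inl 2), &0, &1, &2])))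

variable {δ υ}

theorem isDelta0_outF (hδ : IsDelta0 δ) : IsDelta0 (outF δ) :=
  .bexF (.inf (.ltF _ _) (hδ.app _))

theorem isDelta0_firstMissingF (hδ : IsDelta0 δ) : IsDelta0 (firstMissingF δ) :=
  .inf (.inf (.inf (.ltF _ _) (.ltF _ _)) (.not ((isDelta0_outF hδ).app _)))
    (.ballF (.imp (.ltF _ _) ((isDelta0_outF hδ).app _)))

theorem isDelta0_searchF (hδ : IsDelta0 δ) (hυ : IsDelta0 υ) : IsDelta0 (searchF δ υ) :=
  .bexF (.bexF (.bexF (IsDelta0.app (.inf (.inf (.inf (.inf (isDelta0_powTwoB.app _)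
    (isDelta0_powTwoB.app _)) (.bdEqual _ _)) (.not (hυ.app _)))
    ((isDelta0_firstMissingF hδ).app _)) _)))

variable {M : PAModel}

theorem realize_outF (x v m : M) : (outF δ).Realize ![x, v, m] ↔
    ∃ p, p < m ∧ p + 1 < m ∧ δ.Realize ![p, x, v] := by
  simp [outF, Formula.Realize, Fin.snoc, realize_app, vec_realize_three, realize_ltF,
    realize_succT, PAModel.sSucc_eq]

theorem realize_firstMissingF (x v m : M) : (firstMissingF δ).Realize ![x, v, m] ↔
    ((m < x + 1 + 1 ∧ x + 1 < m + m) ∧ ¬ (outF δ).Realize ![x, v, m]) ∧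
      ∀ y < x, m < y + 1 + 1 → (outF δ).Realize ![y, v, m] := by
  simp [firstMissingF, Formula.Realize, Fin.snoc, realize_app, vec_realize_three, realize_ltF,
    realize_succT, realize_addT, PAModel.sSucc_eq]

theorem realize_searchMatrixF (q x v u s t : M) :
    (searchMatrixF δ υ).Realize ![q, x, v, u, s, t] ↔
    (((powTwoB.Realize ![u] ∧ powTwoB.Realize ![s]) ∧ q + 1 = u * (s + t + (s + t) + 1)) ∧
      ¬ υ.Realize ![t, v]) ∧ (firstMissingF δ).Realize ![x, v, u * u * s] := by
  simp [searchMatrixF, Formula.Realize, realize_app, vec_realize_three, vec_realize_two,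
    const_eq_vec, realize_succT, realize_addT, realize_mulT, PAModel.sSucc_eq]

theorem realize_searchF (q x v : M) : (searchF δ υ).Realize ![q, x, v] ↔
    ∃ u < q + 1 + 1, ∃ s < q + 1 + 1, ∃ t < s,
      (searchMatrixF δ υ).Realize ![q, x, v, u, s, t] := by
  simp [searchF, Formula.Realize, Fin.snoc, realize_app, vec_realize_six,
    realize_succT, PAModel.sSucc_eq]

/-- The power of two dividing the number gives `k`; the leading binary digit of `2 ^ j + t` gives
`j`, because `t < 2 ^ j`. -/
theorem decode_unique {k j t k' j' t' : ℕ} (ht : t < 2 ^ j) (ht' : t' < 2 ^ j')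
    (h : 2 ^ k * (2 ^ j + t + (2 ^ j + t) + 1) = 2 ^ k' * (2 ^ j' + t' + (2 ^ j' + t') + 1)) :
    k = k' ∧ j = j' ∧ t = t' := by
  have hk : ∀ {a b x y : ℕ}, 2 ^ a * (x + x + 1) = 2 ^ b * (y + y + 1) → ¬ a < b := by
    intro a b x y h hab
    obtain ⟨d, rfl⟩ := Nat.exists_eq_add_of_lt hab
    rw [add_assoc a d 1, pow_add, mul_assoc, pow_succ 2 d] at h
    have := Nat.eq_of_mul_eq_mul_left (Nat.two_pow_pos a) h
    have h2 : 2 ^ d * 2 * (y + y + 1) = 2 * (2 ^ d * (y + y + 1)) := by ring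
    omega
  obtain rfl : k = k' := le_antisymm (not_lt.1 (hk h.symm)) (not_lt.1 (hk h))
  have h' := Nat.eq_of_mul_eq_mul_left (Nat.two_pow_pos k) h
  have hj : ∀ {a b x y : ℕ}, x < 2 ^ a → 2 ^ a + x = 2 ^ b + y → ¬ a < b := by
    intro a b x y hx h hab
    have := Nat.pow_le_pow_right (n := 2) (by norm_num) (Nat.succ_le_of_lt hab)
    rw [Nat.succ_eq_add_one, pow_succ] at this
    omega
  have h'' : 2 ^ j + t = 2 ^ j' + t' := by omega
  obtain rfl : j = j' := le_antisymm (not_lt.1 (hj ht' h''.symm)) (not_lt.1 (hj ht h''))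
  exact ⟨rfl, rfl, by omega⟩

/-- A standard program bounds all its decoded data, so decoding in `M` agrees with decoding in `ℕ`.
The factor `u = 2 ^ k` lengthens `q` by `k` bits but raises the target length `2 k + j` by `2 k`;
this gain later absorbs the constant of optimality. -/
theorem realize_searchF_encode {k j t q : ℕ} (ht : t < 2 ^ j)
    (hq : q + 1 = 2 ^ k * (2 ^ j + t + (2 ^ j + t) + 1)) (x v : M) :
    (searchF δ υ).Realize ![(q : M), x, v] ↔ ¬ υ.Realize ![(t : M), v] ∧
      (firstMissingF δ).Realize ![x, v, ((2 ^ (2 * k + j) : ℕ) : M)] := by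
  have hpow : ((2 ^ (2 * k + j) : ℕ) : M) = ((2 ^ k : ℕ) : M) * ((2 ^ k : ℕ) : M) *
      ((2 ^ j : ℕ) : M) := by
    rw [← Nat.cast_mul, ← Nat.cast_mul]
    congr 1
    ring
  rw [realize_searchF]
  constructor
  · rintro ⟨u, hu, s, hs, t', ht', h⟩
    obtain ⟨u, -, rfl⟩ := PAModel.exists_cast_of_lt (n := q + 1 + 1) (by exact_mod_cast hu)
    obtain ⟨s, -, rfl⟩ := PAModel.exists_cast_of_lt (n := q + 1 + 1) (by exact_mod_cast hs)
    obtain ⟨t', hlt, rfl⟩ := PAModel.exists_cast_of_lt ht'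
    rw [realize_searchMatrixF, realize_powTwoB_cast, realize_powTwoB_cast] at h
    obtain ⟨⟨⟨⟨⟨k', rfl⟩, ⟨j', rfl⟩⟩, hq'⟩, hυ⟩, hm⟩ := h
    have hq'' : q + 1 = 2 ^ k' * (2 ^ j' + t' + (2 ^ j' + t') + 1) := by exact_mod_cast hq'
    obtain ⟨rfl, rfl, rfl⟩ := decode_unique ht hlt (hq.symm.trans hq'')
    rw [hpow]
    exact ⟨hυ, hm⟩
  · rintro ⟨hυ, hm⟩
    have h1 := Nat.two_pow_pos k
    have h2 : 2 ^ k ≤ q + 1 := by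
      rw [hq]
      exact Nat.le_mul_of_pos_right _ (by omega)
    have h3 : 2 ^ j ≤ q + 1 := by
      rw [hq]
      exact le_trans (by omega) (Nat.le_mul_of_pos_left _ h1)
    refine ⟨((2 ^ k : ℕ) : M), by exact_mod_cast (by omega), ((2 ^ j : ℕ) : M),
      by exact_mod_cast (by omega), (t : M), by exact_mod_cast ht, ?_⟩
    rw [realize_searchMatrixF, realize_powTwoB_cast, realize_powTwoB_cast, ← hpow]
    exact ⟨⟨⟨⟨⟨k, rfl⟩, ⟨j, rfl⟩⟩, by exact_mod_cast hq⟩, hυ⟩, hm⟩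

/-- In a model where a true `Π₁`-statement `U(t)` fails and `r` is the first random string, the
search outputs `r`. -/
theorem realize_search_of_not {D : arith.Formula (Fin 2)} (hδ : IsStageSigma D δ)
    {U : arith.Formula (Fin 1)} (hυ : IsStagePi U υ) {k j t q : ℕ} (ht : t < 2 ^ j)
    (hq : q + 1 = 2 ^ k * (2 ^ j + t + (2 ^ j + t) + 1)) {r : List Bool}
    (hr : IsFirstRandom D (2 * k + j) r) (hrM : (geF D (2 * k + j)).Realize ![((code r : ℕ) : M)])
    (htrue : U.Realize ![t]) (hfalse : ¬ U.Realize ![(t : M)]) :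
    (uniformF (searchF δ υ)).Realize ![(q : M), ((code r : ℕ) : M)] := by
  rw [isFirstRandom_iff] at hr
  rw [realize_geF] at hrM
  set m := 2 * k + j
  -- `U(t)` is true, so no standard stage refutes it; a refuting stage lies above all standard
  -- numbers.
  have hbig : ∀ (v : M), ¬ υ.Realize ![(t : M), v] → ∀ w : ℕ, (w : M) ≤ v := by
    intro v hv w
    by_contra! h
    exact hv (hυ.anti M _ _ _ h.le ((hυ.realize_cast t w).2 ((hυ.realize_nat t).1 htrue w)))
  -- Hence every real computation of a short program is finished by a refuting stage.
  have hout : ∀ (x : ℕ) (v : M), ¬ υ.Realize ![(t : M), v] →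
      ∀ p : ℕ, p + 1 < 2 ^ m → D.Realize ![p, x] →
      (outF δ).Realize ![(x : M), v, ((2 ^ m : ℕ) : M)] := by
    intro x v hv p hp hpx
    obtain ⟨w, hw⟩ := (hδ.realize_nat p x).1 hpx
    rw [realize_outF]
    exact ⟨p, by exact_mod_cast (by omega), by exact_mod_cast hp,
      hδ.mono M _ _ _ _ (hbig v hv w) ((hδ.realize_cast p x w).2 hw)⟩
  have hnot : ∀ v : M, ¬ (outF δ).Realize ![((code r : ℕ) : M), v, ((2 ^ m : ℕ) : M)] := by
    intro v h
    rw [realize_outF] at h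
    obtain ⟨p, hp, hp', h⟩ := h
    obtain ⟨p, -, rfl⟩ := PAModel.exists_cast_of_lt hp
    exact hrM p (by exact_mod_cast hp') ((hδ.realize M _ _).2 ⟨v, h⟩)
  -- The first missing number is `r` at every refuting stage, so it does not matter which of them
  -- the uniformized search finds.
  have hmiss : ∀ v : M, ¬ υ.Realize ![(t : M), v] → ∀ x : M,
      (firstMissingF δ).Realize ![x, v, ((2 ^ m : ℕ) : M)] ↔ x = ((code r : ℕ) : M) := by
    intro v hv x
    rw [realize_firstMissingF]
    have hsmall : ∀ y : M, y < ((code r : ℕ) : M) → ((2 ^ m : ℕ) : M) < y + 1 + 1 →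
        (outF δ).Realize ![y, v, ((2 ^ m : ℕ) : M)] := by
      intro y hy hmy
      obtain ⟨y, hlt, rfl⟩ := PAModel.exists_cast_of_lt hy
      have hmy' : 2 ^ m < y + 1 + 1 := by exact_mod_cast hmy
      obtain ⟨p, hp, hpy⟩ := hr.2.2 y hlt (by omega)
      exact hout y v hv p hp hpy
    constructor
    · rintro ⟨⟨⟨h1, -⟩, h3⟩, h4⟩
      rcases lt_trichotomy x ((code r : ℕ) : M) with h | h | h
      · exact (h3 (hsmall x h h1)).elim
      · exact h
      · refine (hnot v (h4 _ h ?_)).elim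
        exact_mod_cast (by omega : 2 ^ m < code r + 1 + 1)
    · rintro rfl
      refine ⟨⟨⟨?_, ?_⟩, hnot v⟩, hsmall⟩
      · exact_mod_cast (by omega : 2 ^ m < code r + 1 + 1)
      · have := hr.1.2
        rw [pow_succ, mul_two] at this
        exact_mod_cast this
  rw [hυ.realize] at hfalse
  push Not at hfalse
  obtain ⟨v, hv⟩ := hfalse
  -- The uniformized search considers only values below the stage; a nonstandard stage exceeds the
  -- standard number `code r`.
  have hlt : ((code r : ℕ) : M) < v :=
    lt_of_lt_of_le (by exact_mod_cast Nat.lt_succ_self _) (hbig v hv (code r + 1))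
  obtain ⟨y, w, hy, hyw⟩ := exists_realize_uniformF hlt
    ((realize_searchF_encode ht hq _ v).2 ⟨hv, (hmiss v hv _).2 rfl⟩)
  rw [realize_searchF_encode ht hq] at hyw
  rwa [← (hmiss w hyw.1 y).1 hyw.2]

theorem exists_length_le_of_pi1Complexity_le {U : arith.Formula (Fin 1)} {T : arith.Sentence}
    {n : ℕ} (h : pi1Complexity U T ≤ (n : ℕ∞)) :
    ∃ t : List Bool, t.length ≤ n ∧ Proves PA (T ⇔ atStr U t) := by
  by_contra! hno
  have : ((n + 1 : ℕ) : ℕ∞) ≤ pi1Complexity U T := le_iInf₂ fun t ht => by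
    by_contra! hlt
    have hlt' : t.length < n + 1 := by exact_mod_cast hlt
    exact hno t (by omega) ht
  have : n + 1 ≤ n := by exact_mod_cast this.trans h
  omega

theorem theoryC_le_theoryA {D : arith.Formula (Fin 2)} (hD : IsProvablyOptimal D)
    {U : arith.Formula (Fin 1)} (hU : IsOptimalPi1 U) :
    ∃ c : ℕ, ∀ n, TheoryLE (theoryC U n) (theoryA D (n + c)) := by
  obtain ⟨δ, hδ⟩ := hD.1.1.exists_isStageSigma
  obtain ⟨υ, hυ⟩ := hU.1.1.exists_isStagePi
  obtain ⟨c, hc⟩ := hD.2 _ (isInterpreter_uniformF (isDelta0_searchF hδ.delta0 hυ.delta0))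
  rw [proves_PA_iff] at hc
  refine ⟨2 * (c + 2) + 1, fun n => theoryLE_of_models (PA_subset_theoryC _ _)
    (PA_subset_theoryA _ _) fun M hM => ?_⟩
  rw [theoryC, Theory.model_union_iff, and_iff_right M.is_model, Theory.model_iff]
  rintro T ⟨⟨-, htrue⟩, hcomp⟩
  obtain ⟨t, hlen, ht⟩ := exists_length_le_of_pi1Complexity_le hcomp
  rw [realize_iff_atStr ht]
  by_contra hfalse
  have htlt : code t + 1 < 2 ^ (n + 1) := length_lt_iff.1 (by omega)
  have hpos := Nat.two_pow_pos (c + 2)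
  -- Here `k = c + 2` and `j = n + 1`, so that `m = 2 (c + 2) + (n + 1)`. The program `q` has length
  -- at most `n + c + 4`, and adding the constant `c` still leaves a length below `m`.
  obtain ⟨q, hq⟩ : ∃ q, q + 1 =
      2 ^ (c + 2) * (2 ^ (n + 1) + code t + (2 ^ (n + 1) + code t) + 1) :=
    ⟨_, Nat.succ_pred_eq_of_pos (Nat.mul_pos hpos (by omega))⟩
  obtain ⟨r, hr⟩ := exists_isFirstRandom (hD.1.functional stdModel) (2 * (c + 2) + (n + 1))
  have hindex : n + (2 * (c + 2) + 1) = 2 * (c + 2) + (n + 1) := by ring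
  rw [hindex, theoryA, theoryA_models_iff] at hM
  have hrM := hM _ rfl r hr
  have htrue' : U.Realize ![code t] := (realize_atStr_nat U t).1
    (((Sentence.realize_iff ℕ).1 (ht.sound ℕ nat_models_PA)).1 htrue)
  have hsearch := realize_search_of_not hδ hυ (by omega) hq hr hrM htrue' hfalse
  obtain ⟨p, hp, hpr⟩ := (realize_domination _ _ c).1 (hc M) _ _ hsearch
  have hqlt : q + 1 < 2 ^ (c + 2 + (n + 3)) := by
    rw [hq, pow_add _ (c + 2)]
    refine Nat.mul_lt_mul_of_pos_left ?_ hpos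
    rw [pow_succ 2 (n + 2), pow_succ 2 (n + 1)]
    omega
  have hp' := lt_of_realize_lenLe hp hqlt
  have hexp : c + (c + 2 + (n + 3)) = 2 * (c + 2) + (n + 1) := by ring
  rw [hexp] at hp'
  -- The program supplied by optimality is bounded by a standard number, hence standard, and the
  -- axiom on `r` excludes it.
  obtain ⟨p, -, rfl⟩ := PAModel.exists_cast_of_lt ((lt_add_one p).trans hp')
  exact (realize_geF _ _ _).1 hrM p (by exact_mod_cast hp') hpr

end Search

/-! ### Assembly -/

section Equivalence

/-- Routing both sequences through a monotone `R` equalizes the shifts. Monotonicity of `T` and `S`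
is not needed, and for `theoryA` it is not evident. -/
theorem O1Equiv.of_mono {T S R : ℕ → arith.Theory}
    (hR : ∀ m n, m ≤ n → TheoryLE (R m) (R n))
    (hT : ∃ a, ∀ n, TheoryLE (T n) (R (n + a))) (hT' : ∃ a, ∀ n, TheoryLE (R n) (T (n + a)))
    (hS : ∃ a, ∀ n, TheoryLE (S n) (R (n + a))) (hS' : ∃ a, ∀ n, TheoryLE (R n) (S (n + a))) :
    O1Equiv T S := by
  obtain ⟨a, ha⟩ := hT
  obtain ⟨a', ha'⟩ := hT'
  obtain ⟨b, hb⟩ := hS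
  obtain ⟨b', hb'⟩ := hS'
  refine ⟨a + a' + b + b', fun n => ⟨?_, ?_⟩⟩
  · have := hb' (n + a + a' + b)
    rw [show n + a + a' + b + b' = n + (a + a' + b + b') by ring] at this
    exact (ha n).trans ((hR _ _ (by omega)).trans this)
  · have := ha' (n + a + b + b')
    rw [show n + a + b + b' + a' = n + (a + a' + b + b') by ring] at this
    exact (hb n).trans ((hR _ _ (by omega)).trans this)

theorem exists_pi1Complexity_le {U : arith.Formula (Fin 1)} (hU : IsUniversalPi1 U)
    {T : arith.Sentence} (hT : IsPi1 T) : ∃ n : ℕ, pi1Complexity U T ≤ (n : ℕ∞) := by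
  obtain ⟨t, ht⟩ := hU.2 T hT
  exact ⟨t.length, iInf₂_le t ht⟩

theorem models_of_theoryLE {T S : arith.Theory} (h : TheoryLE T S) {M : PAModel} (hM : M ⊨ S) :
    M ⊨ T :=
  (Theory.model_iff _).2 fun φ hφ => (h φ (.ax ⟨φ, hφ, rfl⟩)).sound M hM

theorem randomAxioms_equiv_truePi1 {D : arith.Formula (Fin 2)} {U : arith.Formula (Fin 1)}
    (hU : IsUniversalPi1 U) (hAC : ∃ a, ∀ n, TheoryLE (theoryA D n) (theoryC U (n + a)))
    (hCA : ∃ a, ∀ n, TheoryLE (theoryC U n) (theoryA D (n + a))) {I : Set ℕ} (hI : I.Infinite)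
    (φ : arith.Sentence) :
    Proves (PA ∪ randomAxioms D I) φ ↔ Proves (PA ∪ truePi1) φ := by
  obtain ⟨a, ha⟩ := hAC
  obtain ⟨b, hb⟩ := hCA
  rw [proves_iff Set.subset_union_left, proves_iff Set.subset_union_left]
  refine forall_congr' fun M => imp_congr_left ⟨fun hM => ?_, fun hM => ?_⟩
  · rw [Theory.model_union_iff, and_iff_right M.is_model, Theory.model_iff]
    intro T hT
    obtain ⟨n, hn⟩ := exists_pi1Complexity_le hU hT.1
    -- The index `k = n + b + j` may overshoot `n + b`; monotonicity of `theoryC` brings `C_{n+j}`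
    -- back to the statement of complexity at most `n`.
    obtain ⟨k, hkI, hk⟩ := hI.exists_gt (n + b)
    obtain ⟨j, rfl⟩ := Nat.exists_eq_add_of_le hk.le
    have hA : M ⊨ theoryA D (n + j + b) := by
      rw [theoryA, theoryA_models_iff]
      rw [theoryA_models_iff] at hM
      rintro i hi
      refine hM i ?_
      obtain rfl : i = n + j + b := hi
      rwa [show n + j + b = n + b + j by ring]
    have hC := models_of_theoryLE (theoryC_mono U (Nat.le_add_right n j))
      (models_of_theoryLE (hb (n + j)) hA)
    exact (Theory.model_iff _).1 hC T (.inr ⟨hT, hn⟩)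
  · rw [theoryA_models_iff]
    intro n _
    have hC : M ⊨ theoryC U (n + a) := hM.mono (Set.union_subset_union_right _ fun T hT => hT.1)
    have hA := models_of_theoryLE (ha n) hC
    rw [theoryA, theoryA_models_iff] at hA
    exact hA n rfl

end Equivalence

end KolmPA

theorem theorem6 (D : KolmPA.arith.Formula (Fin 2)) (hD : KolmPA.IsProvablyOptimal D)
    (U : KolmPA.arith.Formula (Fin 1)) (hU : KolmPA.IsOptimalPi1 U) :
    KolmPA.O1Equiv (KolmPA.theoryA D) (KolmPA.theoryB D) ∧
    KolmPA.O1Equiv (KolmPA.theoryA D) (KolmPA.theoryC U) ∧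
    KolmPA.O1Equiv (KolmPA.theoryB D) (KolmPA.theoryC U) ∧
    ∀ I : Set ℕ, I.Infinite → ∀ φ : KolmPA.arith.Sentence,
      KolmPA.Proves (KolmPA.PA ∪ KolmPA.randomAxioms D I) φ ↔
        KolmPA.Proves (KolmPA.PA ∪ KolmPA.truePi1) φ := by
  have hmono : ∀ m n, m ≤ n → KolmPA.TheoryLE (KolmPA.theoryC U m) (KolmPA.theoryC U n) :=
    fun _ _ => KolmPA.theoryC_mono U
  obtain ⟨b, hBC⟩ := KolmPA.theoryB_le_theoryC hD.1 hU
  obtain ⟨a, hCA⟩ := KolmPA.theoryC_le_theoryA hD hU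
  have hAB := KolmPA.theoryA_le_theoryB hD.1
  -- The remaining comparisons are composites along the cycle, with `theoryC` as the monotone
  -- reference sequence.
  have hAC : ∀ n, KolmPA.TheoryLE (KolmPA.theoryA D n) (KolmPA.theoryC U (n + b)) :=
    fun n => (hAB n).trans (hBC n)
  have hCB : ∀ n, KolmPA.TheoryLE (KolmPA.theoryC U n) (KolmPA.theoryB D (n + a)) :=
    fun n => (hCA n).trans (hAB _)
  have hCC : ∃ c, ∀ n, KolmPA.TheoryLE (KolmPA.theoryC U n) (KolmPA.theoryC U (n + c)) :=
    ⟨0, fun n => hmono n n le_rfl⟩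
  exact ⟨.of_mono hmono ⟨b, hAC⟩ ⟨a, hCA⟩ ⟨b, hBC⟩ ⟨a, hCB⟩,
    .of_mono hmono ⟨b, hAC⟩ ⟨a, hCA⟩ hCC hCC,
    .of_mono hmono ⟨b, hBC⟩ ⟨a, hCB⟩ hCC hCC,
    fun I hI φ => KolmPA.randomAxioms_equiv_truePi1 hU.1 ⟨b, hAC⟩ ⟨a, hCA⟩ hI φ⟩
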